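/- All graphs are simple; unless $\infty$ appears they are finite, and sets of graphs are considered up to isomorphism. $G+H$ is the join, $G\cup H$ the disjoint union, $\infty\cdot G$ the disjoint union of countably many copies of $G$, $\overline{G}$ the complement, $K_{a,\infty}$ the complete bipartite graph with parts of size $a$ and $\aleph_0$, $e(G)$ the number of edges, $\Delta(G)$ the maximum degree. For a family $\mathcal F$ of finite graphs, $G$ is $\mathcal F$-free if it contains no member of $\mathcal F$ as a (not necessarily induced) subgraph; $\mathrm{ex}(n,\mathcal F)$ is the maximum number of edges of an $n$-vertex $\mathcal F$-free graph; $\mathrm{EX}^{B}(n,\mathcal F)$ is the set of graphs with the maximum number of edges among the $n$-vertex $\mathcal F$-free graphs containing a copy of $B$; $\mathrm{SPEX}(n,\mathcal F)$ is the set of $n$-vertex $\mathcal F$-free graphs whose adjacency matrix has the maximum largest eigenvalue. **Theorem 1.1.** Let $\mathcal F$ be a family of graphs and $k\ge 1$ an integer. Suppose that $\mathrm{ex}(n,\mathcal F)=O(n)$, that $K_{k+1,\infty}$ is not $\mathcal F$-free, and that for all large enough $n$ there is a graph $H=H_n\in\mathrm{EX}^{K_{k,n-k}}(n,\mathcal F)$,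 where one of the following holds (the same one for all large $n$): - (a) $H=K_{k,n-k}$; - (b) $H=K_k+\overline{K_{n-k}}$; - (c) $H=K_k+(K_2\cup\overline{K_{n-k-2}})$; - (d) $H=K_k+X$ where $X=X_n$ satisfies $e(X)\le Qn+O(1)$ for some constant $Q\in[0,3/4)$, and $\mathcal F$ is finite; - (e) $H=K_k+X$ where $X=X_n$ satisfies $e(X)\le Qn+O(1)$ for some constant $Q\in[3/4,\infty)$, and $\mathcal F$ is finite; - (f) (e) holds, and for some constant $d$ all but a bounded number (independent of $n$) of vertices of $X$ have degree $d$, and $K_k+(\infty\cdot K_{1,d+1})$ is not $\mathcal F$-free. Then: - If (a), (b) or (c) holds, then for all large enough $n$, $\mathrm{SPEX}(n,\mathcal F)=\{H\}$. - If (d) or (f) holds, then for all large enough $n$, $\mathrm{SPEX}(n,\mathcal F)\subseteq\mathrm{EX}^{K_k+\overline{K_{n-k}}}(n,\mathcal F)$. - If (e) holds, then for all large enough $n$ every graph in $\mathrm{SPEX}(n,\mathcal F)$ is of the form $K_k+Y$, where $e(Y)\ge e(X)-O(n^{1/2})$ and $\Delta(Y)$ is bounded by a constant depending only on $\mathcal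 F$. -/

import Mathlib

open Filter

namespace SpectralTuran

/-- A family of (finite) graphs; each member has vertex set `Fin m` for some `m`, so that up to
isomorphism every family of finite graphs is of this form, and such a family is finite as a set
exactly when it has finitely many members up to isomorphism. -/
abbrev GraphFamily : Type := Set (Σ m : ℕ, SimpleGraph (Fin m))

/-- `G` contains no member of `F` as a (not necessarily induced) subgraph. -/
def FamilyFree (F : GraphFamily) {V : Type*} (G : SimpleGraph V) : Prop :=
  ∀ A ∈ F, A.2.Free G

/-- The number of edges `e(G)`. -/
noncomputable def numEdges {V : Type*} (G : SimpleGraph V) : ℕ := G.edgeSet.ncard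

/-- The degree of a vertex. -/
noncomputable def deg {V : Type*} (G : SimpleGraph V) (v : V) : ℕ := (G.neighborSet v).ncard

/-- The join `G + H`: the disjoint union together with all edges between the two parts. -/
def graphJoin {V W : Type*} (G : SimpleGraph V) (H : SimpleGraph W) : SimpleGraph (V ⊕ W) :=
  (G ⊕g H) ⊔ completeBipartiteGraph V W

/-- The disjoint union of copies of `G`, one for each element of `ι`. -/
def copies (ι : Type*) {V : Type*} (G : SimpleGraph V) : SimpleGraph (ι × V) where
  Adj p q := p.1 = q.1 ∧ G.Adj p.2 q.2
  symm := ⟨fun _ _ h => ⟨h.1.symm, h.2.symm⟩⟩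
  loopless := ⟨fun _ h => G.irrefl h.2⟩

/-- The complete bipartite graph `K_{a,b}`. -/
abbrev Kbip (a b : ℕ) : SimpleGraph (Fin a ⊕ Fin b) := completeBipartiteGraph (Fin a) (Fin b)

/-- The join `K_k + X` of a clique of order `k` with `X`. -/
abbrev cliqueJoin (k : ℕ) {W : Type*} (X : SimpleGraph W) : SimpleGraph (Fin k ⊕ W) :=
  graphJoin (⊤ : SimpleGraph (Fin k)) X

/-- The graph `K_k + (complement of K_{n-k})`, of order `n` when `k ≤ n`. -/
abbrev cliqueJoinEmpty (k n : ℕ) : SimpleGraph (Fin k ⊕ Fin (n - k)) :=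
  cliqueJoin k (⊥ : SimpleGraph (Fin (n - k)))

/-- The graph `K_k + (K_2 ∪ (complement of K_{n-k-2}))`, of order `n` when `k + 2 ≤ n`. -/
abbrev cliqueJoinEdge (k n : ℕ) : SimpleGraph (Fin k ⊕ (Fin 2 ⊕ Fin (n - k - 2))) :=
  cliqueJoin k ((⊤ : SimpleGraph (Fin 2)) ⊕g (⊥ : SimpleGraph (Fin (n - k - 2))))

open scoped Classical in
/-- `λ(G)`, the largest eigenvalue of the adjacency matrix of `G`. -/
noncomputable def lambdaMax {V : Type*} [Fintype V] (G : SimpleGraph V) : ℝ :=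
  sSup (spectrum ℝ (G.adjMatrix ℝ))

/-- `ex(n, F)`, the maximum number of edges of an `F`-free graph of order `n`. -/
noncomputable def ex (F : GraphFamily) (n : ℕ) : ℕ :=
  sSup {e | ∃ G : SimpleGraph (Fin n), FamilyFree F G ∧ numEdges G = e}

/-- `EX^B(n, F)`, the graphs with the maximum number of edges among the `F`-free graphs of
order `n` that contain a copy of `B`. -/
def EXContaining {W : Type*} (B : SimpleGraph W) (F : GraphFamily) (n : ℕ) :
    Set (SimpleGraph (Fin n)) :=
  {G | (FamilyFree F G ∧ B.IsContained G) ∧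
    ∀ G' : SimpleGraph (Fin n), FamilyFree F G' → B.IsContained G' → numEdges G' ≤ numEdges G}

/-- `SPEX(n, F)`, the graphs with the maximum spectral radius among the `F`-free graphs of
order `n`. -/
def SPEX (F : GraphFamily) (n : ℕ) : Set (SimpleGraph (Fin n)) :=
  {G | FamilyFree F G ∧
    ∀ G' : SimpleGraph (Fin n), FamilyFree F G' → lambdaMax G' ≤ lambdaMax G}

/-- The graphs on the vertex set `Fin n` that are isomorphic to `H`. -/
def isoClass {V : Type*} (H : SimpleGraph V) (n : ℕ) : Set (SimpleGraph (Fin n)) :=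
  {G | Nonempty (G ≃g H)}

/-- The graph `H` belongs to the set `S` of graphs of order `n`, up to isomorphism. -/
def MemUpToIso {V : Type*} (H : SimpleGraph V) {n : ℕ} (S : Set (SimpleGraph (Fin n))) : Prop :=
  ∃ G ∈ S, Nonempty (G ≃g H)

/-- For all large `n`, the graph `K_k + X_n` belongs to `EX^{K_{k,n-k}}(n, F)`, and
`e(X_n) ≤ Q n + O(1)`. -/
def JoinExtremal (F : GraphFamily) (k : ℕ) (X : ∀ n : ℕ, SimpleGraph (Fin (n - k))) (Q : ℝ) :
    Prop :=
  (∀ᶠ n : ℕ in atTop, MemUpToIso (cliqueJoin k (X n)) (EXContaining (Kbip k (n - k)) F n)) ∧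
  ∃ C : ℝ, ∀ᶠ n : ℕ in atTop, (numEdges (X n) : ℝ) ≤ Q * n + C

end SpectralTuran

/-! A spectrally extremal `G` has spectral radius λ at least that of `K_{k,n-k}`, so λ² ≥ k(n-k).
Linear growth of `ex` makes every vertex set of `G` span linearly many edges (`Sparse`), and the
exclusion of `K_{k+1,∞}` bounds the common neighbourhoods of k+1 vertices (`NoBip`). Let x be a
Perron vector with maximum 1. Expanding λ²x over walks of two steps shows that only boundedly many
entries are not negligible, and that all but boundedly many vertices see at most k of these. The
bound λ² ≥ k(n-k) then leaves no slack: exactly k vertices, the core L, have weight near 1 and see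
almost everything, while all other weights are tiny (`exists_core`).

Call a vertex outside L exceptional if it misses some vertex of L. Joining the exceptional vertices
to all of L and deleting their other edges gains more in the quadratic form of x than it loses
(`quadForm_add_le_cleaned`). So there are none as soon as the cleaned graph is dominated by a graph
of spectral radius at most λ (`IsCore.exceptional_eq_empty`). When the extremal graph is explicit,
it is the dominating graph: extremality on L and its common neighbourhood limits the edges there,
and an edge inside L weighs far more than one outside.

For a finite family the cleaned graph is itself free (`FamilyFree.cleaned`), so `G = A + Y` with Y
of bounded degree. If A is complete, eliminating Y from the eigenvalue equation gives λ-(k-1) = k Σ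
w_i(Y)/λ^{i+1}, where w_i counts walks with i edges. One-sided truncations after i = 3 compare Y
with X (`walk_comparison`). Since w_0 agrees and w_1 is twice the number of edges, the edge count
dominates up to w_2/λ = O(√n); this forces A to be complete and e(Y) ≥ e(X) - O(√n).

Exact edge extremality follows once w_2 and w_3 of Y exceed those of X by O(1)
(`SPEX_subset_of_walkSum_le`). These are sums of degree sums and degree products over edges, so it
is enough that almost all edges of Y lie below, and almost all edges of X above, common values
(`walkSum_le_of_edge_types`). Packing supplies this: if infinitely many copies of T are excluded,
the copies of T in Y meet a bounded set (`exists_transversal`); if not, X has as many edges as a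
packing of T. Edge density below 3/4 excludes packing the trees with three edges and the triangle,
so almost all components have at most two edges. -/

namespace SpectralTuran

/-! ### Largest eigenvalue, Rayleigh quotients and Perron vectors. -/

section Basics

variable {V W : Type*}

open scoped Classical in
/-- The adjacency indicator of a graph as a real number. -/
noncomputable def ind (G : SimpleGraph V) (u v : V) : ℝ := if G.Adj u v then 1 else 0

lemma ind_of_adj {G : SimpleGraph V} {u v : V} (h : G.Adj u v) : ind G u v = 1 := by
  simp [ind, h]

lemma ind_of_not_adj {G : SimpleGraph V} {u v : V} (h : ¬ G.Adj u v) : ind G u v = 0 := by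
  simp [ind, h]

lemma ind_nonneg (G : SimpleGraph V) (u v : V) : 0 ≤ ind G u v := by
  unfold ind; split_ifs <;> norm_num

lemma ind_le_one (G : SimpleGraph V) (u v : V) : ind G u v ≤ 1 := by
  unfold ind; split_ifs <;> norm_num

lemma ind_comm (G : SimpleGraph V) (u v : V) : ind G u v = ind G v u := by
  by_cases h : G.Adj u v
  · rw [ind_of_adj h, ind_of_adj h.symm]
  · rw [ind_of_not_adj h, ind_of_not_adj fun h' => h h'.symm]

lemma ind_self (G : SimpleGraph V) (u : V) : ind G u u = 0 := by
  simp [ind]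

lemma ind_mono {G H : SimpleGraph V} (h : G ≤ H) (u v : V) : ind G u v ≤ ind H u v := by
  by_cases hG : G.Adj u v
  · rw [ind_of_adj hG, ind_of_adj (h hG)]
  · rw [ind_of_not_adj hG]; exact ind_nonneg _ _ _

open scoped Classical in
lemma adjMatrix_isHermitian (G : SimpleGraph V) : (G.adjMatrix ℝ).IsHermitian := by
  rw [Matrix.IsHermitian, Matrix.conjTranspose_eq_transpose_of_trivial]
  exact SimpleGraph.isSymm_adjMatrix G

lemma numEdges_congr {G : SimpleGraph V} {H : SimpleGraph W} (e : G ≃g H) :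
    numEdges G = numEdges H := by
  unfold numEdges
  rw [← Nat.card_coe_set_eq, ← Nat.card_coe_set_eq]
  exact Nat.card_congr e.mapEdgeSet

lemma numEdges_le_of_isContained [Finite W] {G : SimpleGraph V} {H : SimpleGraph W} (h : G.IsContained H) :
    numEdges G ≤ numEdges H := by
  obtain ⟨f⟩ := h
  unfold numEdges
  rw [← Nat.card_coe_set_eq, ← Nat.card_coe_set_eq]
  exact Nat.card_le_card_of_injective _ f.mapEdgeSet.injective

lemma FamilyFree.of_isContained {F : GraphFamily} {G : SimpleGraph V} {H : SimpleGraph W}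
    (hH : FamilyFree F H) (h : G.IsContained H) : FamilyFree F G :=
  fun A hA hAG => hH A hA (hAG.trans h)

variable [Fintype V] [Fintype W]

/-- The sum of a function over the neighbours of a vertex. -/
noncomputable def nbrSum (G : SimpleGraph V) (f : V → ℝ) (v : V) : ℝ := ∑ u, ind G v u * f u

/-- The quadratic form of the adjacency matrix. -/
noncomputable def quadForm (G : SimpleGraph V) (x : V → ℝ) : ℝ := ∑ u, ∑ v, ind G u v * x u * x v

open scoped Classical in
lemma mulVec_eq_nbrSum (G : SimpleGraph V) (f : V → ℝ) :
    (G.adjMatrix ℝ).mulVec f = nbrSum G f := by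
  ext v
  simp [Matrix.mulVec, dotProduct, nbrSum, ind, SimpleGraph.adjMatrix_apply]

lemma quadForm_eq_sum_mul_nbrSum (G : SimpleGraph V) (x : V → ℝ) :
    quadForm G x = ∑ v, x v * nbrSum G x v := by
  simp only [quadForm, nbrSum, Finset.mul_sum]
  refine Finset.sum_congr rfl fun u _ => Finset.sum_congr rfl fun v _ => by ring

lemma sum_nbrSum_mul_comm (G : SimpleGraph V) (f g : V → ℝ) :
    ∑ v, nbrSum G f v * g v = ∑ v, f v * nbrSum G g v := by
  simp only [nbrSum, Finset.sum_mul, Finset.mul_sum]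
  rw [Finset.sum_comm]
  refine Finset.sum_congr rfl fun u _ => Finset.sum_congr rfl fun v _ => ?_
  rw [ind_comm]; ring

open scoped Classical in
lemma exists_eigenvalue_eq_lambdaMax [Nonempty V] (G : SimpleGraph V) :
    (∃ i, (adjMatrix_isHermitian G).eigenvalues i = lambdaMax G) ∧
      ∀ i, (adjMatrix_isHermitian G).eigenvalues i ≤ lambdaMax G := by
  have hs : spectrum ℝ (G.adjMatrix ℝ) = Set.range (adjMatrix_isHermitian G).eigenvalues :=
    Matrix.IsHermitian.spectrum_real_eq_range_eigenvalues _
  have hfin := Set.finite_range (adjMatrix_isHermitian G).eigenvalues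
  unfold lambdaMax
  constructor
  · rw [congrArg sSup hs]
    exact (Set.range_nonempty _).csSup_mem hfin
  · intro i
    rw [congrArg sSup hs]
    exact le_csSup hfin.bddAbove ⟨i, rfl⟩

-- The eigenvalues of λ - A are λ minus those of A. Semidefiniteness yields both the Rayleigh bound
-- and its equality case.
open scoped Classical in
lemma posSemidef_lambdaMax_sub [Nonempty V] (G : SimpleGraph V) :
    (lambdaMax G • (1 : Matrix V V ℝ) - G.adjMatrix ℝ).PosSemidef := by
  have hA := adjMatrix_isHermitian G
  have hH : (lambdaMax G • (1 : Matrix V V ℝ) - G.adjMatrix ℝ).IsHermitian := by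
    refine Matrix.IsHermitian.sub ?_ hA
    rw [Matrix.IsHermitian, Matrix.conjTranspose_smul]; simp
  rw [hH.posSemidef_iff_eigenvalues_nonneg]
  intro i
  have hmem : hH.eigenvalues i ∈ spectrum ℝ (lambdaMax G • (1 : Matrix V V ℝ) - G.adjMatrix ℝ) := by
    rw [hH.spectrum_real_eq_range_eigenvalues]; exact ⟨i, rfl⟩
  have hsub := spectrum.singleton_sub_eq (R := ℝ) (G.adjMatrix ℝ) (lambdaMax G)
  rw [Algebra.algebraMap_eq_smul_one] at hsub
  rw [← hsub] at hmem
  obtain ⟨a, ha, b, hb, hab⟩ := Set.mem_sub.1 hmem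
  rw [hA.spectrum_real_eq_range_eigenvalues] at hb
  obtain ⟨j, rfl⟩ := hb
  have := (exists_eigenvalue_eq_lambdaMax G).2 j
  simp only [Set.mem_singleton_iff] at ha
  simp only [Pi.zero_apply]
  linarith

open scoped Classical in
lemma dotProduct_lambdaMax_sub (G : SimpleGraph V) (x : V → ℝ) :
    dotProduct (star x) ((lambdaMax G • (1 : Matrix V V ℝ) - G.adjMatrix ℝ).mulVec x)
      = lambdaMax G * ∑ v, x v ^ 2 - quadForm G x := by
  rw [Matrix.sub_mulVec, mulVec_eq_nbrSum, Matrix.smul_mulVec, Matrix.one_mulVec,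
    quadForm_eq_sum_mul_nbrSum, Finset.mul_sum, ← Finset.sum_sub_distrib]
  refine Finset.sum_congr rfl fun v _ => ?_
  simp; ring

lemma quadForm_le [Nonempty V] (G : SimpleGraph V) (x : V → ℝ) :
    quadForm G x ≤ lambdaMax G * ∑ v, x v ^ 2 := by
  classical
  have h := (posSemidef_lambdaMax_sub G).dotProduct_mulVec_nonneg x
  have h2 := dotProduct_lambdaMax_sub G x
  linarith

/-- A zero of a positive semidefinite form lies in the kernel of its matrix. -/
lemma nbrSum_eq_of_quadForm_eq [Nonempty V] (G : SimpleGraph V) (x : V → ℝ)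
    (h : lambdaMax G * ∑ v, x v ^ 2 ≤ quadForm G x) (v : V) :
    nbrSum G x v = lambdaMax G * x v := by
  classical
  have h1 := ((posSemidef_lambdaMax_sub G).dotProduct_mulVec_zero_iff x).1 (by
    rw [dotProduct_lambdaMax_sub]; linarith [quadForm_le G x])
  have h2 := congrFun h1 v
  rw [Matrix.sub_mulVec, mulVec_eq_nbrSum, Matrix.smul_mulVec, Matrix.one_mulVec] at h2
  simp at h2
  linarith

lemma lambdaMax_mul_eq_quadForm (G : SimpleGraph V) (x : V → ℝ) (μ : ℝ)
    (h : ∀ v, nbrSum G x v = μ * x v) : quadForm G x = μ * ∑ v, x v ^ 2 := by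
  rw [quadForm_eq_sum_mul_nbrSum, Finset.mul_sum]
  refine Finset.sum_congr rfl fun v _ => ?_
  rw [h]; ring

/-- A nonnegative eigenvector for the largest eigenvalue, with largest entry `1`. -/
structure IsPerron (G : SimpleGraph V) (x : V → ℝ) : Prop where
  eigen : ∀ v, nbrSum G x v = lambdaMax G * x v
  nonneg : ∀ v, 0 ≤ x v
  le_one : ∀ v, x v ≤ 1
  exists_eq_one : ∃ z, x z = 1

/-- Taking absolute values of a top eigenvector does not lower the quadratic form, so they attain
the Rayleigh maximum and again form an eigenvector. Connectivity is not assumed, so entries may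
vanish. -/
lemma exists_isPerron [Nonempty V] (G : SimpleGraph V) : ∃ x, IsPerron G x := by
  classical
  obtain ⟨i, hi⟩ := (exists_eigenvalue_eq_lambdaMax G).1
  set e : V → ℝ := ((adjMatrix_isHermitian G).eigenvectorBasis i).ofLp with he
  have hev : ∀ v, nbrSum G e v = lambdaMax G * e v := by
    intro v
    have := (adjMatrix_isHermitian G).mulVec_eigenvectorBasis i
    rw [hi, mulVec_eq_nbrSum] at this
    have := congrFun this v
    simpa using this
  have hne : ∃ v, e v ≠ 0 := by
    by_contra! hall
    have h1 := (adjMatrix_isHermitian G).eigenvectorBasis.orthonormal.ne_zero i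
    apply h1
    ext v
    exact hall v
  have habs : ∀ v, nbrSum G (fun v => |e v|) v = lambdaMax G * |e v| := by
    apply nbrSum_eq_of_quadForm_eq
    simp only [sq_abs]
    rw [← lambdaMax_mul_eq_quadForm G e _ hev]
    unfold quadForm
    refine Finset.sum_le_sum fun u _ => Finset.sum_le_sum fun v _ => ?_
    have h := ind_nonneg G u v
    rw [mul_assoc, mul_assoc, ← abs_mul]
    exact mul_le_mul_of_nonneg_left (le_abs_self _) h
  obtain ⟨z, -, hz⟩ := Finset.exists_max_image Finset.univ (fun v => |e v|) Finset.univ_nonempty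
  obtain ⟨v0, hv0⟩ := hne
  have hzpos : 0 < |e z| := lt_of_lt_of_le (abs_pos.2 hv0) (hz v0 (Finset.mem_univ _))
  refine ⟨fun v => |e v| / |e z|, ?_, fun v => by positivity, fun v => ?_, z, div_self hzpos.ne'⟩
  · intro v
    have := habs v
    unfold nbrSum at this ⊢
    rw [← mul_div_assoc, ← this, Finset.sum_div]
    exact Finset.sum_congr rfl fun u _ => by ring
  · rw [div_le_one hzpos]; exact hz v (Finset.mem_univ _)

lemma sum_sq_pos_of_exists {x : V → ℝ} (h : ∃ z, x z ≠ 0) : 0 < ∑ v, x v ^ 2 := by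
  obtain ⟨z, hz⟩ := h
  exact Finset.sum_pos' (fun v _ => sq_nonneg _) ⟨z, Finset.mem_univ _, by positivity⟩

lemma IsPerron.sum_sq_pos {G : SimpleGraph V} {x : V → ℝ} (h : IsPerron G x) :
    0 < ∑ v, x v ^ 2 := by
  obtain ⟨z, hz⟩ := h.exists_eq_one
  exact sum_sq_pos_of_exists ⟨z, by rw [hz]; norm_num⟩

/-- A Perron vector of the smaller graph, extended by zero along the copy, is a test vector for the
larger one. -/
lemma lambdaMax_le_of_isContained [Nonempty V] {G : SimpleGraph V} {H : SimpleGraph W}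
    (h : G.IsContained H) : lambdaMax G ≤ lambdaMax H := by
  classical
  obtain ⟨f⟩ := h
  obtain ⟨x, hx⟩ := exists_isPerron G
  have : Nonempty W := ⟨f (Classical.arbitrary V)⟩
  set y : W → ℝ := Function.extend f x 0 with hy
  have hyf : ∀ v, y (f v) = x v := fun v => f.injective.extend_apply _ _ _
  have hy0 : ∀ w, w ∉ Set.range f → y w = 0 := fun w hw => by
    rw [hy, Function.extend_apply' _ _ _ (by simpa using hw)]; rfl
  have hsum : ∀ g : W → ℝ, (∀ w, w ∉ Set.range f → g w = 0) → ∑ w, g w = ∑ v, g (f v) := by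
    intro g hg
    rw [← Finset.sum_image (s := Finset.univ) (g := f) (f := g) (fun a _ b _ hab => f.injective hab)]
    symm
    apply Finset.sum_subset (Finset.subset_univ _)
    intro w _ hw
    apply hg
    simpa using hw
  have h1 : ∑ w, y w ^ 2 = ∑ v, x v ^ 2 := by
    rw [hsum _ (fun w hw => by rw [hy0 w hw]; norm_num)]
    simp only [hyf]
  have h2 : quadForm G x ≤ quadForm H y := by
    unfold quadForm
    rw [hsum (fun u => ∑ v, ind H u v * y u * y v) (fun w hw => by simp [hy0 w hw])]
    refine Finset.sum_le_sum fun u _ => ?_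
    rw [hsum (fun v => ind H (f u) v * y (f u) * y v) (fun w hw => by simp [hy0 w hw])]
    refine Finset.sum_le_sum fun v _ => ?_
    rw [hyf, hyf]
    have : ind G u v ≤ ind H (f u) (f v) := by
      by_cases ha : G.Adj u v
      · rw [ind_of_adj ha, ind_of_adj (show H.Adj (f u) (f v) from f.toHom.map_adj ha)]
      · rw [ind_of_not_adj ha]; exact ind_nonneg _ _ _
    exact mul_le_mul_of_nonneg_right (mul_le_mul_of_nonneg_right this (hx.nonneg _)) (hx.nonneg _)
  have h3 := quadForm_le H y
  rw [lambdaMax_mul_eq_quadForm G x _ hx.eigen] at h2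
  rw [h1] at h3
  exact le_of_mul_le_mul_right (h2.trans h3) hx.sum_sq_pos

lemma lambdaMax_congr [Nonempty V] {G : SimpleGraph V} {H : SimpleGraph W}
    (e : G ≃g H) : lambdaMax G = lambdaMax H := by
  have : Nonempty W := ⟨e (Classical.arbitrary V)⟩
  exact le_antisymm (lambdaMax_le_of_isContained e.isContained)
    (lambdaMax_le_of_isContained e.symm.isContained)

lemma lambdaMax_Kbip {k m : ℕ} (hk : 1 ≤ k) (hm : 1 ≤ m) :
    Real.sqrt (k * m) ≤ lambdaMax (Kbip k m) := by
  have : Nonempty (Fin k ⊕ Fin m) := ⟨Sum.inl ⟨0, hk⟩⟩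
  set x : Fin k ⊕ Fin m → ℝ := Sum.elim (fun _ => Real.sqrt m) (fun _ => Real.sqrt k) with hx
  have hm' : (0 : ℝ) < m := by exact_mod_cast hm
  have hk' : (0 : ℝ) < k := by exact_mod_cast hk
  have h1 : ∑ v, x v ^ 2 = 2 * (k * m) := by
    simp [hx, Fintype.sum_sum_type, Real.sq_sqrt]; ring
  have h2 : quadForm (Kbip k m) x = 2 * (k * m) * Real.sqrt (k * m) := by
    simp [quadForm, hx, Fintype.sum_sum_type, ind]
    ring
  have h3 := quadForm_le (Kbip k m) x
  rw [h1, h2, mul_comm] at h3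
  exact le_of_mul_le_mul_right h3 (by positivity)

lemma sum_ind_eq_deg (G : SimpleGraph V) (v : V) : ∑ u, ind G v u = deg G v := by
  classical
  simp only [ind, Finset.sum_boole, deg]
  rw [Set.ncard_eq_toFinset_card']
  norm_cast
  congr 1
  ext; simp

lemma sum_deg_eq (G : SimpleGraph V) : ∑ v, (deg G v : ℝ) = 2 * numEdges G := by
  classical
  have h := G.sum_degrees_eq_twice_card_edges
  have h1 : ∀ v, deg G v = G.degree v := by
    intro v
    rw [deg, Set.ncard_eq_toFinset_card', ← SimpleGraph.card_neighborFinset_eq_degree]; rfl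
  have h2 : numEdges G = G.edgeFinset.card := by
    rw [numEdges, Set.ncard_eq_toFinset_card']; rfl
  simp only [h1, h2]
  exact_mod_cast h

lemma sum_sum_ind (G : SimpleGraph V) : ∑ u, ∑ v, ind G u v = 2 * numEdges G := by
  rw [← sum_deg_eq]
  exact Finset.sum_congr rfl fun u _ => sum_ind_eq_deg G u

end Basics

/-! ### Local sparsity and bounded common neighbourhoods. -/

section Sparsity

variable {V : Type*}

/-- Every set `U` of vertices spans at most `C |U|` edges. -/
def Sparse (C : ℝ) (G : SimpleGraph V) : Prop :=
  ∀ U : Finset V, ∑ u ∈ U, ∑ v ∈ U, ind G u v ≤ 2 * C * U.card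

/-- Any `k + 1` vertices have fewer than `m` common neighbours. -/
def NoBip (k m : ℕ) (G : SimpleGraph V) : Prop :=
  ∀ T S : Finset V, T.card = k + 1 → (∀ t ∈ T, ∀ s ∈ S, G.Adj t s) → S.card < m

lemma numEdges_le_ex {F : GraphFamily} {n : ℕ} {G : SimpleGraph (Fin n)} (h : FamilyFree F G) :
    numEdges G ≤ ex F n := by
  refine le_csSup ?_ ⟨G, h, rfl⟩
  refine ((Set.finite_univ (α := SimpleGraph (Fin n))).image numEdges).bddAbove.mono ?_
  rintro e ⟨G, -, rfl⟩
  exact ⟨G, trivial, rfl⟩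

/-- Induced subgraphs of free graphs are free, so the bound on `ex` applies to every vertex set of
size at least some N; smaller sets U span at most |U|² ≤ N|U| ordered adjacent pairs. -/
lemma exists_sparse {F : GraphFamily}
    (hex : (fun n : ℕ => (ex F n : ℝ)) =O[atTop] (fun n : ℕ => (n : ℝ))) :
    ∃ C : ℝ, 1 ≤ C ∧ ∀ (V : Type) (G : SimpleGraph V), FamilyFree F G → Sparse C G := by
  classical
  obtain ⟨c, hc⟩ := hex.bound
  obtain ⟨N, hN⟩ := eventually_atTop.1 hc
  refine ⟨max 1 (max c N), le_max_left _ _, fun V G hG U => ?_⟩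
  have hcard : Fintype.card U = U.card := Fintype.card_coe U
  set H := (G.induce (U : Set V)).overFin hcard
  have e : G.induce (U : Set V) ≃g H := (G.induce (U : Set V)).overFinIso hcard
  have hH : FamilyFree F H := hG.of_isContained (e.symm.isContained.trans
    (SimpleGraph.Embedding.induce (G := G) (U : Set V)).isContained)
  have h1 : ∑ u ∈ U, ∑ v ∈ U, ind G u v = 2 * numEdges H := by
    rw [← numEdges_congr e, ← sum_sum_ind, ← Finset.sum_coe_sort U]
    refine Finset.sum_congr rfl fun u _ => ?_
    rw [← Finset.sum_coe_sort U]
    exact Finset.sum_congr rfl fun v _ => by simp [ind]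
  rw [h1, mul_assoc]
  refine mul_le_mul_of_nonneg_left ?_ (by norm_num)
  rcases le_or_gt N U.card with hle | hlt
  · have h2 := hN _ hle
    simp only [Real.norm_natCast] at h2
    calc (numEdges H : ℝ) ≤ ex F U.card := by exact_mod_cast numEdges_le_ex hH
      _ ≤ c * U.card := h2
      _ ≤ _ := by gcongr; exact (le_max_left _ _).trans (le_max_right _ _)
  · have h2 : 2 * (numEdges H : ℝ) ≤ U.card * U.card := by
      rw [← sum_sum_ind]
      calc ∑ u, ∑ v, ind H u v ≤ ∑ u : Fin U.card, ∑ v : Fin U.card, (1 : ℝ) := by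
            gcongr; exact ind_le_one _ _ _
        _ = _ := by simp
    have h3 : (U.card : ℝ) * U.card ≤ N * U.card := by
      gcongr
    have h4 : (N : ℝ) * U.card ≤ max 1 (max c N) * U.card := by
      gcongr; exact (le_max_right _ _).trans (le_max_right _ _)
    have : (0 : ℝ) ≤ numEdges H := by positivity
    linarith

/-- The forbidden member found in `K_{k+1,∞}` is finite, so it uses only finitely many vertices of
the infinite side and already lies in some `K_{k+1,m}`. -/
lemma exists_noBip {F : GraphFamily} {k : ℕ}
    (hK : ¬ FamilyFree F (completeBipartiteGraph (Fin (k + 1)) ℕ)) :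
    ∃ m : ℕ, ∀ (V : Type) (G : SimpleGraph V), FamilyFree F G → NoBip k m G := by
  classical
  unfold FamilyFree at hK
  push Not at hK
  obtain ⟨A, hA, hAf⟩ := hK
  obtain ⟨f⟩ := hAf
  let idx : Fin (k + 1) ⊕ ℕ → ℕ := Sum.elim (fun _ => 0) id
  obtain ⟨m, hm⟩ : ∃ m, ∀ i, idx (f i) < m :=
    ⟨(Finset.univ.sup fun i => idx (f i)) + 1, fun i =>
      Nat.lt_succ_of_le (Finset.le_sup (f := fun i => idx (f i)) (Finset.mem_univ i))⟩
  refine ⟨m, fun V G hG T S hT hTS => ?_⟩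
  by_contra! hS
  rcases Nat.eq_zero_or_pos m with rfl | hmpos
  · have : IsEmpty (Fin A.1) := ⟨fun i => by simpa using hm i⟩
    exact hG A hA SimpleGraph.IsContained.of_isEmpty
  obtain ⟨g⟩ : Nonempty (Fin m ↪ S) := Function.Embedding.nonempty_of_card_le (by simpa using hS)
  let t : Fin (k + 1) ≃ T := (Fintype.equivFinOfCardEq (by simpa using hT)).symm
  -- All indices used by the copy are below m, so the minimum never acts on them; it only makes the
  -- map total.
  let φ : Fin (k + 1) ⊕ ℕ → V :=
    Sum.elim (fun i => t i) (fun j => g ⟨min j (m - 1), by omega⟩)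
  refine hG A hA ⟨⟨⟨fun i => φ (f i), ?_⟩, ?_⟩⟩
  · intro a b hab
    have h := f.toHom.map_adj hab
    change (completeBipartiteGraph (Fin (k + 1)) ℕ).Adj (f a) (f b) at h
    rcases ha : f a with i | i <;> rcases hb : f b with j | j <;> rw [ha, hb] at h
    · simp at h
    · simpa [φ] using hTS _ (t i).2 _ (g _).2
    · simpa [φ] using (hTS _ (t j).2 _ (g _).2).symm
    · simp at h
  · intro a b hab
    change φ (f a) = φ (f b) at hab
    apply f.injective
    change f a = f b
    have hma := hm a
    have hmb := hm b
    rcases ha : f a with i | i <;> rcases hb : f b with j | j <;> rw [ha] at hab hma <;>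
      rw [hb] at hab hmb
    · simpa [φ, Subtype.coe_inj] using hab
    · have h := hTS _ (t i).2 _ (g ⟨min j (m - 1), by omega⟩).2
      simp only [φ, Sum.elim_inl, Sum.elim_inr] at hab
      rw [hab] at h
      exact absurd h (G.irrefl)
    · have h := hTS _ (t j).2 _ (g ⟨min i (m - 1), by omega⟩).2
      simp only [φ, Sum.elim_inl, Sum.elim_inr] at hab
      rw [hab] at h
      exact absurd h (G.irrefl)
    · simp only [φ, Sum.elim_inr, Subtype.coe_inj, EmbeddingLike.apply_eq_iff_eq,
        Fin.mk.injEq] at hab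
      simp only [idx, Sum.elim_inr, id] at hma hmb
      congr 1
      omega

lemma NoBip.congr {W : Type*} {k m : ℕ} {G : SimpleGraph V} {H : SimpleGraph W} (e : G ≃g H)
    (h : NoBip k m G) : NoBip k m H := by
  intro T S hT hTS
  rw [← Finset.card_map e.symm.toEquiv.toEmbedding]
  refine h (T.map e.symm.toEquiv.toEmbedding) _ (by rw [Finset.card_map, hT]) ?_
  simp only [Finset.mem_map]
  rintro _ ⟨t, ht, rfl⟩ _ ⟨s, hs, rfl⟩
  exact e.symm.map_adj_iff.2 (hTS t ht s hs)

end Sparsity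

/-! ### Walks of two steps and the number of heavy vertices. -/

section Core

open scoped Classical

set_option linter.unusedSectionVars false

variable {V : Type*} [Fintype V]

/-- The neighbours of a vertex as a finset. -/
noncomputable def nb (G : SimpleGraph V) (v : V) : Finset V := Finset.univ.filter (G.Adj v ·)

@[simp] lemma mem_nb {G : SimpleGraph V} {u v : V} : u ∈ nb G v ↔ G.Adj v u := by simp [nb]

lemma sum_ind_mul (G : SimpleGraph V) (f : V → ℝ) (U : Finset V) (v : V) :
    ∑ u ∈ U, ind G v u * f u = ∑ u ∈ U with u ∈ nb G v, f u := by
  rw [Finset.sum_filter]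
  refine Finset.sum_congr rfl fun u _ => ?_
  by_cases h : G.Adj v u <;> simp [ind, h]

lemma sum_ind_eq_card (G : SimpleGraph V) (U : Finset V) (v : V) :
    ∑ u ∈ U, ind G v u = ((U.filter (· ∈ nb G v)).card : ℝ) := by
  have := sum_ind_mul G (fun _ => 1) U v
  simpa using this

lemma nbrSum_eq_sum_nb (G : SimpleGraph V) (f : V → ℝ) (v : V) :
    nbrSum G f v = ∑ u ∈ nb G v, f u := by
  rw [nbrSum, sum_ind_mul]
  congr 1
  ext; simp

lemma card_nb (G : SimpleGraph V) (v : V) : (nb G v).card = deg G v := by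
  have h := sum_ind_eq_deg G v
  rw [sum_ind_eq_card] at h
  have h2 : Finset.univ.filter (· ∈ nb G v) = nb G v := by ext; simp
  rw [h2] at h
  exact_mod_cast h

lemma sum_sum_ind_le_of_subset (G : SimpleGraph V) {A A' B B' : Finset V} (hA : A ⊆ A')
    (hB : B ⊆ B') : ∑ u ∈ A, ∑ v ∈ B, ind G u v ≤ ∑ u ∈ A', ∑ v ∈ B', ind G u v := by
  calc _ ≤ ∑ u ∈ A, ∑ v ∈ B', ind G u v := Finset.sum_le_sum fun u _ =>
        Finset.sum_le_sum_of_subset_of_nonneg hB fun v _ _ => ind_nonneg _ _ _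
    _ ≤ _ := Finset.sum_le_sum_of_subset_of_nonneg hA fun u _ _ =>
        Finset.sum_nonneg fun v _ => ind_nonneg _ _ _

variable {G : SimpleGraph V} {C : ℝ}

lemma Sparse.sum_sum_le (hS : Sparse C G) : ∑ u, ∑ v, ind G u v ≤ 2 * C * Fintype.card V := by
  simpa using hS Finset.univ

lemma Sparse.sum_sum_le_add (hS : Sparse C G) (hC : 0 ≤ C) (A B : Finset V) :
    ∑ u ∈ A, ∑ v ∈ B, ind G u v ≤ 2 * C * (A.card + B.card) := by
  calc _ ≤ ∑ u ∈ A ∪ B, ∑ v ∈ A ∪ B, ind G u v :=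
        sum_sum_ind_le_of_subset G Finset.subset_union_left Finset.subset_union_right
    _ ≤ 2 * C * (A ∪ B).card := hS _
    _ ≤ _ := by
      gcongr
      exact_mod_cast Finset.card_union_le A B

variable {x : V → ℝ}

lemma IsPerron.lambda_mul (hx : IsPerron G x) (v : V) :
    lambdaMax G * x v = ∑ u ∈ nb G v, x u := by
  rw [← hx.eigen, nbrSum_eq_sum_nb]

/-- Apply the eigenvalue equation twice. Walks ending outside U have weight at most η each, and
their number is at most the total degree 2Cn. -/
lemma IsPerron.two_walk (hx : IsPerron G x) (hS : Sparse C G) (z : V) (U : Finset V) {η : ℝ}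
    (hη : 0 ≤ η) (hU : ∀ w, w ∉ U → x w ≤ η) :
    lambdaMax G ^ 2 * x z ≤ ∑ u ∈ nb G z, ∑ w ∈ U, ind G u w * x w
      + 2 * C * η * Fintype.card V := by
  have h1 : lambdaMax G ^ 2 * x z = ∑ u ∈ nb G z, ∑ w, ind G u w * x w := by
    rw [sq, mul_assoc, hx.lambda_mul, Finset.mul_sum]
    exact Finset.sum_congr rfl fun u _ => (hx.eigen u).symm
  have h2 : ∀ u, ∑ w, ind G u w * x w
      = ∑ w ∈ U, ind G u w * x w + ∑ w ∈ Uᶜ, ind G u w * x w :=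
    fun u => (Finset.sum_add_sum_compl U _).symm
  rw [h1]
  simp only [h2, Finset.sum_add_distrib]
  gcongr
  calc ∑ u ∈ nb G z, ∑ w ∈ Uᶜ, ind G u w * x w
      ≤ ∑ u ∈ nb G z, ∑ w ∈ Uᶜ, ind G u w * η := by
        refine Finset.sum_le_sum fun u _ => Finset.sum_le_sum fun w hw => ?_
        exact mul_le_mul_of_nonneg_left (hU w (by simpa using hw)) (ind_nonneg _ _ _)
    _ = (∑ u ∈ nb G z, ∑ w ∈ Uᶜ, ind G u w) * η := by simp only [Finset.sum_mul]
    _ ≤ (∑ u, ∑ w, ind G u w) * η := by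
        gcongr
        exact sum_sum_ind_le_of_subset G (Finset.subset_univ _) (Finset.subset_univ _)
    _ ≤ (2 * C * Fintype.card V) * η := by gcongr; exact hS.sum_sum_le
    _ = _ := by ring

/-- The vertices of weight at least `η`. -/
noncomputable def heavy (x : V → ℝ) (η : ℝ) : Finset V := Finset.univ.filter (η ≤ x ·)

@[simp] lemma mem_heavy {η : ℝ} {v : V} : v ∈ heavy x η ↔ η ≤ x v := by simp [heavy]

/-- Entries are at most 1, so a vertex of weight at least η has degree at least ηλ; compare with the
total degree. This crude count bootstraps the bounded one in `card_heavy_le`. -/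
lemma IsPerron.card_heavy_mul_le (hx : IsPerron G x) (hS : Sparse C G) (η : ℝ)
    (hl : 0 ≤ lambdaMax G) :
    (heavy x η).card * (η * lambdaMax G) ≤ 2 * C * Fintype.card V := by
  calc ((heavy x η).card : ℝ) * (η * lambdaMax G) = ∑ v ∈ heavy x η, η * lambdaMax G := by simp
    _ ≤ ∑ v ∈ heavy x η, ∑ u, ind G v u := by
      refine Finset.sum_le_sum fun v hv => ?_
      calc η * lambdaMax G ≤ lambdaMax G * x v := by
            rw [mul_comm]; exact mul_le_mul_of_nonneg_left (by simpa using hv) hl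
        _ = ∑ u, ind G v u * x u := (hx.eigen v).symm
        _ ≤ _ := Finset.sum_le_sum fun u _ =>
            mul_le_of_le_one_right (ind_nonneg _ _ _) (hx.le_one u)
    _ ≤ ∑ v, ∑ u, ind G v u := sum_sum_ind_le_of_subset G (Finset.subset_univ _) le_rfl
    _ ≤ _ := hS.sum_sum_le

/-- Since λ²x_z is at least about ηn, many two-step walks start at z. Those ending at vertices
heavier than a smaller threshold number at most 2C(deg z + their count), and the count is negligible
for large λ, so deg z must be linear. -/
lemma IsPerron.le_deg_of_le (hx : IsPerron G x) (hS : Sparse C G) (hC : 1 ≤ C) {k : ℕ} {η : ℝ}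
    (hη : 0 < η) (hl : 256 * C ^ 3 / η ^ 2 ≤ lambdaMax G)
    (hl2 : Fintype.card V - k ≤ lambdaMax G ^ 2) (hn : 8 * (k : ℝ) ≤ Fintype.card V)
    {z : V} (hz : η ≤ x z) : η * Fintype.card V ≤ 4 * C * (nb G z).card := by
  set l := lambdaMax G with hldef
  set n : ℝ := (Fintype.card V : ℝ) with hn'
  have hC0 : 0 < C := by linarith
  have hlpos : 0 < l := lt_of_lt_of_le (by positivity) hl
  have hn0 : 0 ≤ n := by positivity
  -- This threshold makes the tail term 2Cη0n equal to ηn/4; the lower bound on λ then makes the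
  -- heavy count contribute at most ηn/8.
  set η0 := η / (8 * C) with hη0
  have hη0pos : 0 < η0 := by positivity
  have h1 := hx.two_walk hS z (heavy x η0) hη0pos.le (fun w hw => by
    rw [mem_heavy, not_le] at hw; exact hw.le)
  have h2 : ∑ u ∈ nb G z, ∑ w ∈ heavy x η0, ind G u w * x w
      ≤ 2 * C * ((nb G z).card + (heavy x η0).card) := by
    refine le_trans ?_ (hS.sum_sum_le_add hC0.le _ _)
    exact Finset.sum_le_sum fun u _ => Finset.sum_le_sum fun w _ =>
      mul_le_of_le_one_right (ind_nonneg _ _ _) (hx.le_one w)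
  have h3 := hx.card_heavy_mul_le hS η0 hlpos.le
  have h4 : 2 * C * ((heavy x η0).card : ℝ) ≤ η * n / 8 := by
    have h5 : 32 * C ^ 2 / η ≤ η0 * l := by
      calc 32 * C ^ 2 / η = η0 * (256 * C ^ 3 / η ^ 2) := by rw [hη0]; field_simp; ring
        _ ≤ _ := by gcongr
    have h6 : ((heavy x η0).card : ℝ) * (32 * C ^ 2 / η) ≤ 2 * C * n :=
      le_trans (mul_le_mul_of_nonneg_left h5 (by positivity)) h3
    rw [mul_div_assoc', div_le_iff₀ hη] at h6
    have h7 : (2 * C * ((heavy x η0).card : ℝ)) * (16 * C) ≤ (η * n / 8) * (16 * C) := by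
      nlinarith
    exact le_of_mul_le_mul_right h7 (by positivity)
  have h8 : 2 * C * η0 * n = η * n / 4 := by rw [hη0]; field_simp; ring
  have h9 : (n - k) * η ≤ l ^ 2 * x z := by
    rcases le_or_gt 0 (n - k) with h | h
    · exact mul_le_mul hl2 hz hη.le (by positivity)
    · have : 0 ≤ l ^ 2 * x z := mul_nonneg (by positivity) (hx.nonneg z)
      nlinarith
  have h10 : η * k ≤ η * n / 8 := by nlinarith
  nlinarith

/-- Each heavy vertex has degree at least ηn/(4C), while all degrees together are at most 2Cn. -/
lemma IsPerron.card_heavy_le (hx : IsPerron G x) (hS : Sparse C G) (hC : 1 ≤ C) {k : ℕ} {η : ℝ}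
    (hη : 0 < η) (hl : 256 * C ^ 3 / η ^ 2 ≤ lambdaMax G)
    (hl2 : Fintype.card V - k ≤ lambdaMax G ^ 2) (hn : 8 * (k : ℝ) ≤ Fintype.card V) :
    ((heavy x η).card : ℝ) ≤ 8 * C ^ 2 / η := by
  obtain ⟨z, -⟩ := hx.exists_eq_one
  have hn0 : (0 : ℝ) < Fintype.card V := by exact_mod_cast Fintype.card_pos_iff.2 ⟨z⟩
  have h1 : ((heavy x η).card : ℝ) * (η * Fintype.card V / (4 * C)) ≤ 2 * C * Fintype.card V := by
    calc ((heavy x η).card : ℝ) * (η * Fintype.card V / (4 * C))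
        = ∑ v ∈ heavy x η, η * Fintype.card V / (4 * C) := by simp
      _ ≤ ∑ v ∈ heavy x η, ∑ u, ind G v u := by
        refine Finset.sum_le_sum fun v hv => ?_
        have := hx.le_deg_of_le hS hC hη hl hl2 hn (mem_heavy.1 hv)
        rw [sum_ind_eq_deg, ← card_nb, div_le_iff₀ (by linarith)]
        linarith
      _ ≤ ∑ v, ∑ u, ind G v u := sum_sum_ind_le_of_subset G (Finset.subset_univ _) le_rfl
      _ ≤ _ := hS.sum_sum_le
  rw [le_div_iff₀ hη]
  rw [mul_div_assoc', div_le_iff₀ (by linarith)] at h1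
  have : ((heavy x η).card * η) * Fintype.card V ≤ (8 * C ^ 2) * (Fintype.card V : ℝ) := by
    nlinarith
  exact le_of_mul_le_mul_right this hn0

/-- Assign to each such vertex k+1 of its neighbours in U; every (k+1)-subset is assigned fewer than
m times. -/
lemma NoBip.card_filter_le {k m : ℕ} (hB : NoBip k m G) (U : Finset V) :
    (Finset.univ.filter fun u => k + 1 ≤ (U.filter (· ∈ nb G u)).card).card
      ≤ 2 ^ U.card * m := by
  have hsub : (Finset.univ.filter fun u => k + 1 ≤ (U.filter (· ∈ nb G u)).card) ⊆
      (U.powersetCard (k + 1)).biUnion fun T => Finset.univ.filter fun u => ∀ t ∈ T, G.Adj t u := by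
    intro u hu
    simp only [Finset.mem_filter, Finset.mem_univ, true_and] at hu
    obtain ⟨T, hT, hTc⟩ := Finset.exists_subset_card_eq hu
    simp only [Finset.mem_biUnion, Finset.mem_powersetCard, Finset.mem_filter, Finset.mem_univ,
      true_and]
    refine ⟨T, ⟨hT.trans (Finset.filter_subset _ _), hTc⟩, fun t ht => ?_⟩
    have := (Finset.mem_filter.1 (hT ht)).2
    exact (mem_nb.1 this).symm
  calc _ ≤ _ := Finset.card_le_card hsub
    _ ≤ (U.powersetCard (k + 1)).card * m := by
      refine Finset.card_biUnion_le_card_mul _ _ _ fun T hT => ?_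
      refine (hB T _ (Finset.mem_powersetCard.1 hT).2 ?_).le
      intro t ht s hs
      exact (Finset.mem_filter.1 hs).2 t ht
    _ ≤ U.powerset.card * m := by
      gcongr
      exact fun T hT => Finset.mem_powerset.2 (Finset.mem_powersetCard.1 hT).1
    _ = _ := by rw [Finset.card_powerset]

/-- All but boundedly many vertices send at most k edges to U. The coefficient k of |A| is what
matches λ² ≥ k(n-k). -/
lemma NoBip.sum_sum_le {k m : ℕ} (hB : NoBip k m G) (U A : Finset V) :
    ∑ u ∈ A, ∑ w ∈ U, ind G u w ≤ k * A.card + 2 ^ U.card * m * U.card := by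
  set Bad := Finset.univ.filter fun u => k + 1 ≤ (U.filter (· ∈ nb G u)).card with hBad
  have h1 : ∀ u, ∑ w ∈ U, ind G u w ≤ k + (if u ∈ Bad then (U.card : ℝ) else 0) := by
    intro u
    rw [sum_ind_eq_card]
    split_ifs with h
    · have : ((U.filter (· ∈ nb G u)).card : ℝ) ≤ U.card := by
        exact_mod_cast Finset.card_filter_le _ _
      have : (0 : ℝ) ≤ k := by positivity
      linarith
    · simp only [hBad, Finset.mem_filter, Finset.mem_univ, true_and, not_le] at h
      rw [add_zero]
      exact_mod_cast Nat.lt_succ_iff.1 h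
  calc _ ≤ ∑ u ∈ A, ((k : ℝ) + (if u ∈ Bad then (U.card : ℝ) else 0)) :=
        Finset.sum_le_sum fun u _ => h1 u
    _ ≤ k * A.card + ∑ u, (if u ∈ Bad then (U.card : ℝ) else 0) := by
      rw [Finset.sum_add_distrib, Finset.sum_const, nsmul_eq_mul, mul_comm]
      refine add_le_add le_rfl (Finset.sum_le_sum_of_subset_of_nonneg (Finset.subset_univ _) ?_)
      intro u _ _
      split_ifs <;> positivity
    _ = k * A.card + Bad.card * U.card := by simp
    _ ≤ _ := by
      gcongr
      exact_mod_cast hB.card_filter_le U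

end Core

/-! ### The core: exactly k dominant vertices. -/

section Core

open scoped Classical

variable {V : Type*} [Fintype V] {G : SimpleGraph V} {C : ℝ} {x : V → ℝ}

/-- The vertices outside `L` that miss some vertex of `L`. -/
noncomputable def exceptional (G : SimpleGraph V) (L : Finset V) : Finset V :=
  Finset.univ.filter fun v => v ∉ L ∧ ∃ l ∈ L, ¬ G.Adj l v

/-- The common neighbours of the vertices of `L`. -/
noncomputable def commonNb (G : SimpleGraph V) (L : Finset V) : Finset V :=
  Finset.univ.filter fun v => v ∉ L ∧ ∀ l ∈ L, G.Adj l v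

lemma mem_exceptional {L : Finset V} {v : V} :
    v ∈ exceptional G L ↔ v ∉ L ∧ ∃ l ∈ L, ¬ G.Adj l v := by simp [exceptional]

lemma mem_commonNb {L : Finset V} {v : V} :
    v ∈ commonNb G L ↔ v ∉ L ∧ ∀ l ∈ L, G.Adj l v := by simp [commonNb]

/-- The vertex together with L makes k+1 vertices with these common neighbours. -/
lemma NoBip.card_nb_inter_commonNb_lt {k m : ℕ} (hB : NoBip k m G) {L : Finset V}
    (hL : L.card = k) {v : V} (hv : v ∉ L) : (nb G v ∩ commonNb G L).card < m := by
  refine hB (insert v L) _ (by rw [Finset.card_insert_of_notMem hv, hL]) ?_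
  intro t ht s hs
  rw [Finset.mem_inter, mem_nb, mem_commonNb] at hs
  rcases Finset.mem_insert.1 ht with rfl | ht
  · exact hs.1
  · exact hs.2.2 t ht

lemma card_exceptional_le {L : Finset V} {δ : ℝ}
    (h : ∀ l ∈ L, (1 - δ) * Fintype.card V ≤ (nb G l).card) :
    ((exceptional G L).card : ℝ) ≤ L.card * (δ * Fintype.card V) := by
  have hsub : exceptional G L ⊆ L.biUnion fun l => (nb G l)ᶜ := by
    intro v hv
    rw [mem_exceptional] at hv
    obtain ⟨-, l, hl, hlv⟩ := hv
    exact Finset.mem_biUnion.2 ⟨l, hl, by simpa using hlv⟩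
  calc ((exceptional G L).card : ℝ) ≤ ((L.biUnion fun l => (nb G l)ᶜ).card : ℝ) := by
        exact_mod_cast Finset.card_le_card hsub
    _ ≤ ∑ l ∈ L, (((nb G l)ᶜ).card : ℝ) := by exact_mod_cast Finset.card_biUnion_le
    _ ≤ ∑ l ∈ L, δ * Fintype.card V := by
      refine Finset.sum_le_sum fun l hl => ?_
      have h1 := h l hl
      have h2 : ((nb G l).card : ℝ) + ((nb G l)ᶜ).card = Fintype.card V := by
        exact_mod_cast Finset.card_add_card_compl (nb G l)
      linarith
    _ = _ := by simp

-- Outside L, a vertex has fewer than m neighbours among the common neighbours of L and otherwise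
-- only exceptional ones. Expanding two steps and counting the edges among exceptional vertices by
-- sparsity bounds everything by O(λ) plus a multiple of the number of exceptional vertices.
set_option maxHeartbeats 800000 in
lemma IsPerron.light_bound (hx : IsPerron G x) (hS : Sparse C G) {k m : ℕ}
    (hB : NoBip k m G) (hl : 0 ≤ lambdaMax G) {L : Finset V} (hL : L.card = k) {v : V}
    (hv : v ∉ L) :
    lambdaMax G ^ 2 * x v ≤ k * lambdaMax G + (k + m) * m
      + (k + 2 * m + 2 * C) * (exceptional G L).card := by
  set R := exceptional G L with hR
  set l := lambdaMax G with hldef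
  set S := commonNb G L with hSdef
  have hdisj : ∀ u, u ∉ L → u ∈ S ∨ u ∈ R := by
    intro u hu
    rw [hSdef, hR, mem_commonNb, mem_exceptional]
    by_cases h : ∀ l ∈ L, G.Adj l u
    · exact Or.inl ⟨hu, h⟩
    · push Not at h; exact Or.inr ⟨hu, h⟩
  have hdeg : ∀ u, u ∉ L → ((nb G u \ L).card : ℝ) ≤ m + (nb G u ∩ R).card := by
    intro u hu
    have h1 : nb G u \ L ⊆ (nb G u ∩ S) ∪ (nb G u ∩ R) := by
      intro w hw
      rw [Finset.mem_sdiff] at hw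
      rw [← Finset.inter_union_distrib_left, Finset.mem_inter, Finset.mem_union]
      exact ⟨hw.1, hdisj w hw.2⟩
    have h2 := (Finset.card_le_card h1).trans (Finset.card_union_le _ _)
    have h3 : (nb G u ∩ S).card < m := hB.card_nb_inter_commonNb_lt hL hu
    have h4 : (nb G u \ L).card ≤ m + (nb G u ∩ R).card := by omega
    exact_mod_cast h4
  have hsplit : ∀ u, l * x u ≤ k + ∑ w ∈ nb G u \ L, x w := by
    intro u
    rw [hx.lambda_mul, ← Finset.sum_inter_add_sum_sdiff (nb G u) L]
    gcongr
    calc ∑ w ∈ nb G u ∩ L, x w ≤ ∑ w ∈ nb G u ∩ L, (1 : ℝ) :=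
          Finset.sum_le_sum fun w _ => hx.le_one w
      _ = ((nb G u ∩ L).card : ℝ) := by simp
      _ ≤ k := by rw [← hL]; exact_mod_cast Finset.card_le_card Finset.inter_subset_right
  have hcard : ∀ u, ∑ w ∈ nb G u \ L, x w ≤ (nb G u \ L).card := by
    intro u
    calc ∑ w ∈ nb G u \ L, x w ≤ ∑ w ∈ nb G u \ L, (1 : ℝ) :=
          Finset.sum_le_sum fun w _ => hx.le_one w
      _ = _ := by simp
  have hsub : nb G v \ L ⊆ (nb G v ∩ S) ∪ R := by
    intro w hw
    rw [Finset.mem_sdiff] at hw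
    rcases hdisj w hw.2 with h | h
    · exact Finset.mem_union_left _ (Finset.mem_inter.2 ⟨hw.1, h⟩)
    · exact Finset.mem_union_right _ h
  have hRL : ∀ u ∈ R, u ∉ L := fun u hu => (mem_exceptional.1 hu).1
  have hSL : ∀ u ∈ S, u ∉ L := fun u hu => (mem_commonNb.1 hu).1
  have hsum : ∑ u ∈ nb G v \ L, ((nb G u \ L).card : ℝ) ≤ m * (m + R.card)
      + (m + 2 * C) * R.card := by
    calc ∑ u ∈ nb G v \ L, ((nb G u \ L).card : ℝ)
        ≤ ∑ u ∈ (nb G v ∩ S) ∪ R, ((nb G u \ L).card : ℝ) :=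
          Finset.sum_le_sum_of_subset_of_nonneg hsub fun _ _ _ => Nat.cast_nonneg _
      _ ≤ ∑ u ∈ nb G v ∩ S, ((nb G u \ L).card : ℝ) + ∑ u ∈ R, ((nb G u \ L).card : ℝ) := by
          rw [← Finset.sum_union_inter]
          have : 0 ≤ ∑ u ∈ nb G v ∩ S ∩ R, ((nb G u \ L).card : ℝ) :=
            Finset.sum_nonneg fun _ _ => Nat.cast_nonneg _
          linarith
      _ ≤ ∑ u ∈ nb G v ∩ S, ((m : ℝ) + R.card) + ∑ u ∈ R, ((m : ℝ) + (nb G u ∩ R).card) := by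
          gcongr with u hu u hu
          · refine (hdeg u (hSL u (Finset.mem_inter.1 hu).2)).trans ?_
            gcongr
            exact Finset.inter_subset_right
          · exact hdeg u (hRL u hu)
      _ ≤ _ := by
          have h1 : ((nb G v ∩ S).card : ℝ) ≤ m := by
            exact_mod_cast (hB.card_nb_inter_commonNb_lt hL hv).le
          have h2 : ∑ u ∈ R, ((nb G u ∩ R).card : ℝ) ≤ 2 * C * R.card := by
            refine le_trans (le_of_eq ?_) (hS R)
            refine Finset.sum_congr rfl fun u _ => ?_
            rw [sum_ind_eq_card]
            congr 2
            ext; simp [and_comm]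
          rw [Finset.sum_const, nsmul_eq_mul]
          have h3 : ((nb G v ∩ S).card : ℝ) * (m + R.card) ≤ m * (m + R.card) := by gcongr
          rw [Finset.sum_add_distrib, Finset.sum_const, nsmul_eq_mul]
          linarith
  have hR0 : (0 : ℝ) ≤ R.card := Nat.cast_nonneg _
  calc l ^ 2 * x v = l * (l * x v) := by ring
    _ ≤ l * (k + ∑ u ∈ nb G v \ L, x u) := by gcongr; exact hsplit v
    _ = k * l + ∑ u ∈ nb G v \ L, l * x u := by rw [← Finset.mul_sum]; ring
    _ ≤ k * l + ∑ u ∈ nb G v \ L, ((k : ℝ) + (nb G u \ L).card) := by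
        gcongr with u hu
        exact (hsplit u).trans (by gcongr; exact hcard u)
    _ ≤ k * l + (k * (m + R.card) + (m * (m + R.card) + (m + 2 * C) * R.card)) := by
        rw [Finset.sum_add_distrib, Finset.sum_const, nsmul_eq_mul]
        have h1 : ((nb G v \ L).card : ℝ) ≤ m + R.card := by
          refine (hdeg v hv).trans ?_
          gcongr
          exact Finset.inter_subset_right
        have h2 : ((nb G v \ L).card : ℝ) * k ≤ (m + R.card) * k := by gcongr
        linarith
    _ = _ := by ring

set_option maxHeartbeats 1600000 in
/-- If the spectral radius is as large as that of `K_{k,n-k}`, then exactly `k` vertices carry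
almost all the weight of the Perron vector and are adjacent to almost everything. -/
theorem exists_core (k m : ℕ) (hk : 1 ≤ k) {C : ℝ} (hC : 1 ≤ C) {ε : ℝ} (hε : 0 < ε) :
    ∃ K : ℝ, ∀ (V : Type) [Fintype V] (G : SimpleGraph V) (x : V → ℝ), IsPerron G x →
      Sparse C G → NoBip k m G → K ≤ lambdaMax G → K ≤ Fintype.card V →
      k * ((Fintype.card V : ℝ) - k) ≤ lambdaMax G ^ 2 →
      ∃ L : Finset V, L.card = k ∧ (∀ l ∈ L, 1 - ε ≤ x l) ∧ (∀ v, v ∉ L → x v ≤ ε) ∧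
        ((exceptional G L).card : ℝ) ≤ ε * Fintype.card V := by
  have hk' : (1 : ℝ) ≤ k := by exact_mod_cast hk
  have hC0 : 0 < C := by linarith
  obtain ⟨ε', hε', hε'1, hε'2⟩ : ∃ ε' : ℝ, 0 < ε' ∧ ε' ≤ 1 ∧ ε' ≤ ε :=
    ⟨min 1 ε, by positivity, min_le_left _ _, min_le_right _ _⟩
  -- M is the coefficient of the exceptional vertices in `light_bound`. With at most 2kδn of these,
  -- the choice of δ keeps their term below ε'n/4.
  obtain ⟨M, hM⟩ : ∃ y : ℝ, y = k + 2 * m + 2 * C := ⟨_, rfl⟩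
  have hM1 : 1 ≤ M := by have : (0 : ℝ) ≤ m := by positivity
                         linarith
  obtain ⟨δ, hδ⟩ : ∃ y : ℝ, y = ε' / (8 * (k + 1) * M) := ⟨_, rfl⟩
  have hM0 : 0 < M := by linarith
  have hδ0 : 0 < δ := by rw [hδ]; positivity
  have hδ1 : 8 * (k + 1) * M * δ = ε' := by rw [hδ]; field_simp
  have hδ2 : 8 * (k + 1) * δ ≤ ε' := by
    rw [← hδ1]
    have : 8 * ((k : ℝ) + 1) * δ * 1 ≤ 8 * (k + 1) * δ * M := by gcongr
    linarith
  have hkδ : 0 ≤ (k : ℝ) * δ := by positivity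
  -- Chosen so that the tail 2Cηn in `two_walk` is δn/4.
  obtain ⟨η, hη⟩ : ∃ y : ℝ, y = δ / (8 * C) := ⟨_, rfl⟩
  have hη0 : 0 < η := by rw [hη]; positivity
  have hη1 : 2 * C * η = δ / 4 := by rw [hη]; field_simp; norm_num
  have hηδ : η ≤ 1 - δ := by
    have : η * 1 ≤ η * C := by gcongr
    linarith
  -- b bounds the number of η-heavy vertices, and K1 the error term of `NoBip.sum_sum_le` for that
  -- set.
  obtain ⟨b, hb⟩ : ∃ y : ℝ, y = 8 * C ^ 2 / η := ⟨_, rfl⟩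
  obtain ⟨K1, hK1⟩ : ∃ y : ℝ, y = 2 ^ ⌊b⌋₊ * m * b := ⟨_, rfl⟩
  have hb0 : 0 ≤ b := by rw [hb]; positivity
  have hK10 : 0 ≤ K1 := by rw [hK1]; positivity
  -- A sum of nonnegative terms, which serve the various largeness requirements on λ and n below.
  refine ⟨1 + 8 * k + 256 * C ^ 3 / η ^ 2 + (k ^ 2 + K1) * (4 / (3 * δ)) +
    4 * (k ^ 2 + (k ^ 2 + K1) / δ) + 2 * m + 4 * k / ε' + 4 * ((k + m) * m) / ε',
    fun V _ G x hx hS hB hKl hKn hl2 => ?_⟩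
  obtain ⟨l, hldef⟩ : ∃ y : ℝ, y = lambdaMax G := ⟨_, rfl⟩
  obtain ⟨n, hn⟩ : ∃ y : ℝ, y = (Fintype.card V : ℝ) := ⟨_, rfl⟩
  rw [← hldef] at hKl hl2
  rw [← hn] at hKn hl2
  rw [← hn]
  have p1 : 0 ≤ 256 * C ^ 3 / η ^ 2 := by positivity
  have p2 : 0 ≤ ((k : ℝ) ^ 2 + K1) * (4 / (3 * δ)) := by positivity
  have p3 : 0 ≤ 4 * ((k : ℝ) ^ 2 + (k ^ 2 + K1) / δ) := by positivity
  have p4 : (0 : ℝ) ≤ 2 * m := by positivity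
  have p5 : 0 ≤ 4 * k / ε' := by positivity
  have p6 : 0 ≤ 4 * (((k : ℝ) + m) * m) / ε' := by positivity
  have hn1 : 1 ≤ n := by linarith
  have hl1 : 1 ≤ l := by linarith
  have hl0 : 0 ≤ l := by linarith
  have h8k : 8 * (k : ℝ) ≤ n := by linarith
  have hlA : 256 * C ^ 3 / η ^ 2 ≤ l := by linarith
  have hnk : n - k ≤ l ^ 2 := by
    exact (le_mul_of_one_le_left (by linarith) hk').trans hl2
  have hn3 : k ^ 2 + K1 ≤ 3 / 4 * δ * n := by
    have : (k ^ 2 + K1) * (4 / (3 * δ)) ≤ n := by linarith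
    calc k ^ 2 + K1 = 3 / 4 * δ * ((k ^ 2 + K1) * (4 / (3 * δ))) := by field_simp
      _ ≤ _ := by gcongr
  obtain ⟨H, hH⟩ : ∃ U, U = heavy x η := ⟨_, rfl⟩
  have hHcard : (H.card : ℝ) ≤ b := by
    rw [hH]
    refine hb ▸ hx.card_heavy_le hS hC hη0 (k := k) ?_ ?_ ?_
    · rwa [← hldef]
    · rwa [← hldef, ← hn]
    · rwa [← hn]
  have hHK : (2 : ℝ) ^ H.card * m * H.card ≤ K1 := by
    have : H.card ≤ ⌊b⌋₊ := Nat.le_floor hHcard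
    rw [hK1]
    gcongr
    norm_num
  have hHl : ∀ w, w ∉ H → x w ≤ η := fun w hw => by
    rw [hH, mem_heavy, not_le] at hw; exact hw.le
  have hcount : ∀ z, ∑ u ∈ nb G z, ∑ w ∈ H, ind G u w ≤ k * (nb G z).card + K1 := fun z =>
    (hB.sum_sum_le H (nb G z)).trans (by gcongr)
  have hnb : ∀ z, ((nb G z).card : ℝ) ≤ n := fun z => by
    rw [hn]; exact_mod_cast Finset.card_le_univ _
  obtain ⟨L, hL⟩ : ∃ U, U = heavy x (1 - δ) := ⟨_, rfl⟩
  -- Two-step walks from z into H number at most k·deg z + K1, against λ²x_z ≥ k(n-k)(1-δ).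
  have hdeg : ∀ z ∈ L, (1 - 2 * δ) * n ≤ (nb G z).card := by
    intro z hz
    rw [hL, mem_heavy] at hz
    have h1 := hx.two_walk hS z H hη0.le hHl
    rw [← hldef, ← hn] at h1
    have h2 : ∑ u ∈ nb G z, ∑ w ∈ H, ind G u w * x w ≤ k * (nb G z).card + K1 := by
      refine le_trans ?_ (hcount z)
      exact Finset.sum_le_sum fun u _ => Finset.sum_le_sum fun w _ =>
        mul_le_of_le_one_right (ind_nonneg _ _ _) (hx.le_one w)
    rw [hη1] at h1
    have h3 : (k * (n - k)) * (1 - δ) ≤ l ^ 2 * x z := by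
      refine mul_le_mul hl2 hz ?_ (by positivity)
      linarith
    have h4 : k * ((1 - 2 * δ) * n) ≤ k * ((nb G z).card : ℝ) := by
      have e1 : (k * (n - k)) * (1 - δ) = k * n - k * δ * n - k ^ 2 + δ * k ^ 2 := by ring
      have e2 : 0 ≤ δ * (k : ℝ) ^ 2 := by positivity
      have e3 : δ * n ≤ k * δ * n := by
        rw [mul_assoc]
        exact le_mul_of_one_le_left (mul_nonneg hδ0.le (by linarith)) hk'
      linarith
    exact le_of_mul_le_mul_left h4 (by linarith)
  have hLH : L ⊆ H := by
    intro w hw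
    rw [hL, mem_heavy] at hw
    rw [hH, mem_heavy]
    linarith
  -- at least `k` vertices
  have hge : k ≤ L.card := by
    by_contra! hlt
    obtain ⟨z, hz⟩ := hx.exists_eq_one
    have h1 := hx.two_walk hS z H hη0.le hHl
    rw [← hldef, ← hn] at h1
    rw [hz, mul_one, hη1] at h1
    -- For z of weight 1, p and q count the two-step walks ending in L and in H \ L. Each of the
    -- latter loses at least δ, and the total slack is small, so q is at most n/4 + O(1). With fewer
    -- than k vertices in L, p is at most (k-1)n, which is too little.
    set p := ∑ u ∈ nb G z, ∑ w ∈ L, ind G u w with hp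
    set q := ∑ u ∈ nb G z, ∑ w ∈ H \ L, ind G u w with hq
    have hsplit : ∀ f : V → V → ℝ, ∑ u ∈ nb G z, ∑ w ∈ H, f u w
        = ∑ u ∈ nb G z, ∑ w ∈ H \ L, f u w + ∑ u ∈ nb G z, ∑ w ∈ L, f u w := by
      intro f
      rw [← Finset.sum_add_distrib]
      exact Finset.sum_congr rfl fun u _ => (Finset.sum_sdiff hLH).symm
    have hpq : q + p ≤ k * n + K1 := by
      rw [hp, hq, ← hsplit]
      refine (hcount z).trans ?_
      gcongr
      exact hnb z
    have h2 : ∑ u ∈ nb G z, ∑ w ∈ H, ind G u w * x w ≤ (1 - δ) * q + p := by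
      rw [hsplit, hq, Finset.mul_sum]
      simp only [Finset.mul_sum]
      refine add_le_add (Finset.sum_le_sum fun u _ => Finset.sum_le_sum fun w hw => ?_)
        (Finset.sum_le_sum fun u _ => Finset.sum_le_sum fun w _ =>
          mul_le_of_le_one_right (ind_nonneg _ _ _) (hx.le_one w))
      rw [mul_comm]
      refine mul_le_mul_of_nonneg_right ?_ (ind_nonneg _ _ _)
      rw [hL, Finset.mem_sdiff, mem_heavy, not_le] at hw
      exact hw.2.le
    have h3 : p ≤ (k - 1) * n := by
      calc p ≤ ∑ u ∈ nb G z, ∑ w ∈ L, (1 : ℝ) := by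
            rw [hp]; gcongr; exact ind_le_one _ _ _
        _ = (nb G z).card * L.card := by simp
        _ ≤ n * (k - 1) := by
            have : (L.card : ℝ) + 1 ≤ k := by exact_mod_cast hlt
            gcongr
            · exact hnb z
            · linarith
        _ = _ := by ring
    have h4 : δ * q ≤ K1 + k ^ 2 + δ / 4 * n := by linarith
    have h5 : q ≤ (k ^ 2 + K1) / δ + n / 4 := by
      have : δ * q ≤ δ * ((k ^ 2 + K1) / δ + n / 4) := by
        have : δ * ((k ^ 2 + K1) / δ + n / 4) = k ^ 2 + K1 + δ * n / 4 := by field_simp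
        linarith
      exact le_of_mul_le_mul_left this hδ0
    have hq0 : 0 ≤ q := Finset.sum_nonneg fun u _ => Finset.sum_nonneg fun w _ => ind_nonneg _ _ _
    have h6 : 0 ≤ δ * q := by positivity
    have h7 : δ ≤ 1 / 8 := by linarith
    have h8 : δ * n ≤ 1 / 8 * n := by gcongr
    linarith
  -- Any k+1 vertices of L would have at least (1 - 2(k+1)δ)n ≥ 3n/4 common neighbours.
  have hle : L.card ≤ k := by
    by_contra! hgt
    obtain ⟨T, hTL, hT⟩ := Finset.exists_subset_card_eq (Nat.succ_le_of_lt hgt)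
    have h1 := hB T (Finset.univ.filter fun v => ∀ t ∈ T, G.Adj t v) hT
      (fun t ht s hs => (Finset.mem_filter.1 hs).2 t ht)
    have h2 : (((Finset.univ.filter fun v => ∀ t ∈ T, G.Adj t v)ᶜ).card : ℝ)
        ≤ T.card * (2 * δ * n) := by
      have hsub : (Finset.univ.filter fun v => ∀ t ∈ T, G.Adj t v)ᶜ
          ⊆ T.biUnion fun t => (nb G t)ᶜ := by
        intro v hv
        simp only [Finset.mem_compl, Finset.mem_filter, Finset.mem_univ, true_and, not_forall] at hv
        obtain ⟨t, ht, htv⟩ := hv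
        exact Finset.mem_biUnion.2 ⟨t, ht, by simpa using htv⟩
      calc _ ≤ ((T.biUnion fun t => (nb G t)ᶜ).card : ℝ) := by
            exact_mod_cast Finset.card_le_card hsub
        _ ≤ ∑ t ∈ T, (((nb G t)ᶜ).card : ℝ) := by exact_mod_cast Finset.card_biUnion_le
        _ ≤ ∑ t ∈ T, 2 * δ * n := by
          refine Finset.sum_le_sum fun t ht => ?_
          have h1 := hdeg t (hTL ht)
          have h2 : ((nb G t).card : ℝ) + ((nb G t)ᶜ).card = n := by
            rw [hn]; exact_mod_cast Finset.card_add_card_compl (nb G t)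
          linarith
        _ = _ := by simp
    have h3 : ((Finset.univ.filter fun v => ∀ t ∈ T, G.Adj t v).card : ℝ)
        + ((Finset.univ.filter fun v => ∀ t ∈ T, G.Adj t v)ᶜ).card = n := by
      rw [hn]; exact_mod_cast Finset.card_add_card_compl _
    have h4 : ((Finset.univ.filter fun v => ∀ t ∈ T, G.Adj t v).card : ℝ) < m := by
      exact_mod_cast h1
    rw [hT] at h2
    push_cast at h2
    have h5 : 8 * ((k : ℝ) + 1) * δ * n ≤ 1 * n := by gcongr; linarith
    linarith
  have hLk : L.card = k := le_antisymm hle hge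
  have hexc : ((exceptional G L).card : ℝ) ≤ k * (2 * δ * n) := by
    have := card_exceptional_le (G := G) (L := L) (δ := 2 * δ) (by rwa [← hn])
    rwa [hLk, ← hn] at this
  refine ⟨L, hLk, fun w hw => ?_, fun v hv => ?_, ?_⟩
  · rw [hL, mem_heavy] at hw
    linarith
  -- The three terms of `light_bound` are at most λ² times ε'/4, ε'/4 and ε'/2.
  · refine le_trans ?_ hε'2
    have h1 := hx.light_bound hS hB (hldef ▸ hl0) hLk hv
    rw [← hldef, ← hM] at h1
    have hlsq : 1 ≤ l ^ 2 := one_le_pow₀ hl1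
    have hll : l * ε' ≤ l ^ 2 * ε' := by
      rw [sq]; gcongr; exact le_mul_of_one_le_left hl0 hl1
    have e1 : k * l ≤ ε' / 4 * l ^ 2 := by
      have : 4 * k / ε' ≤ l := by linarith
      rw [div_le_iff₀ hε'] at this
      have := mul_le_mul_of_nonneg_right this hl0
      linarith
    have e2 : ((k : ℝ) + m) * m ≤ ε' / 4 * l ^ 2 := by
      have : 4 * ((k + m) * m) / ε' ≤ l := by linarith
      rw [div_le_iff₀ hε'] at this
      linarith
    have e3 : M * (exceptional G L).card ≤ ε' / 2 * l ^ 2 := by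
      calc M * ((exceptional G L).card : ℝ) ≤ M * (k * (2 * δ * n)) := by gcongr
        _ ≤ ε' / 4 * n := by
          have : M * (k * (2 * δ * n)) + 2 * M * δ * n = ε' / 4 * n := by rw [← hδ1]; ring
          have : 0 ≤ 2 * M * δ * n := by positivity
          linarith
        _ ≤ ε' / 4 * (2 * l ^ 2) := by gcongr; linarith
        _ = _ := by ring
    have h2 : l ^ 2 * x v ≤ l ^ 2 * ε' := by linarith
    exact le_of_mul_le_mul_left h2 (by positivity)
  · refine hexc.trans ?_
    calc (k : ℝ) * (2 * δ * n) ≤ ε' * n := by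
          have : 8 * ((k : ℝ) + 1) * δ * n ≤ ε' * n := by gcongr
          have : 0 ≤ k * δ * n := by positivity
          have : 0 ≤ δ * n := by positivity
          linarith
      _ ≤ _ := by gcongr

end Core

/-! ### Cleaning the exceptional vertices. -/

section Switching

open scoped Classical

variable {V : Type*}

/-- The complete bipartite graph between `L` and its complement. -/
def crossOn (L : Finset V) : SimpleGraph V where
  Adj u v := (u ∈ L ∧ v ∉ L) ∨ (u ∉ L ∧ v ∈ L)
  symm := ⟨fun _ _ h => h.elim (fun h => Or.inr h.symm) (fun h => Or.inl h.symm)⟩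
  loopless := ⟨fun _ h => h.elim (fun h => h.2 h.1) (fun h => h.1 h.2)⟩

/-- The clique on `U`, with all other vertices isolated. -/
def cliqueOn (U : Finset V) : SimpleGraph V where
  Adj u v := u ≠ v ∧ u ∈ U ∧ v ∈ U
  symm := ⟨fun _ _ h => ⟨h.1.symm, h.2.2, h.2.1⟩⟩
  loopless := ⟨fun _ h => h.1 rfl⟩

lemma crossOn_adj {L : Finset V} {u v : V} :
    (crossOn L).Adj u v ↔ (u ∈ L ∧ v ∉ L) ∨ (u ∉ L ∧ v ∈ L) := Iff.rfl

lemma cliqueOn_adj {U : Finset V} {u v : V} :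
    (cliqueOn U).Adj u v ↔ u ≠ v ∧ u ∈ U ∧ v ∈ U := Iff.rfl

/-- The edges of `G` inside `U`. -/
abbrev within (G : SimpleGraph V) (U : Finset V) : SimpleGraph V := G ⊓ cliqueOn U

lemma within_adj {G : SimpleGraph V} {U : Finset V} {u v : V} :
    (within G U).Adj u v ↔ G.Adj u v ∧ u ∈ U ∧ v ∈ U := by
  simp only [SimpleGraph.inf_adj, cliqueOn_adj]
  exact ⟨fun h => ⟨h.1, h.2.2⟩, fun h => ⟨h.1, h.1.ne, h.2⟩⟩

lemma within_le_cliqueOn (G : SimpleGraph V) (U : Finset V) : within G U ≤ cliqueOn U :=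
  inf_le_right

lemma disjoint_crossOn_cliqueOn {L U : Finset V} (h : U ⊆ L ∨ Disjoint U L) :
    Disjoint (crossOn L) (cliqueOn U) := by
  rw [SimpleGraph.disjoint_left]
  intro u v huv huv'
  rw [crossOn_adj] at huv
  rw [cliqueOn_adj] at huv'
  rcases h with h | h
  · have h1 := h huv'.2.1
    have h2 := h huv'.2.2
    tauto
  · have h1 := Finset.disjoint_left.1 h huv'.2.1
    have h2 := Finset.disjoint_left.1 h huv'.2.2
    tauto

lemma disjoint_cliqueOn {U U' : Finset V} (h : Disjoint U U') :
    Disjoint (cliqueOn U) (cliqueOn U') := by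
  rw [SimpleGraph.disjoint_left]
  intro u v huv huv'
  exact Finset.disjoint_left.1 h huv.2.1 huv'.2.1

lemma ind_sup {A B : SimpleGraph V} (h : Disjoint A B) (u v : V) :
    ind (A ⊔ B) u v = ind A u v + ind B u v := by
  rw [SimpleGraph.disjoint_left] at h
  have := h u v
  by_cases hA : A.Adj u v <;> by_cases hB : B.Adj u v <;> simp_all [ind]

/-- Degeneracy: some vertex of U has at most 2C neighbours in U. Remove it, charge its edges to its
own weight, and repeat; each edge is counted in both directions, hence 4C. -/
lemma Sparse.sum_sum_min_le {G : SimpleGraph V} {C : ℝ} (hS : Sparse C G) {x : V → ℝ}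
    (hx : ∀ v, 0 ≤ x v) (U : Finset V) :
    ∑ u ∈ U, ∑ v ∈ U, ind G u v * min (x u) (x v) ≤ 4 * C * ∑ u ∈ U, x u := by
  induction hc : U.card generalizing U with
  | zero => simp [Finset.card_eq_zero.1 hc]
  | succ n ih =>
    obtain ⟨v, hv, hdeg⟩ : ∃ v ∈ U, ∑ u ∈ U, ind G v u ≤ 2 * C := by
      by_contra! hcon
      have h1 := hS U
      have h2 : ∑ v ∈ U, 2 * C < ∑ v ∈ U, ∑ u ∈ U, ind G v u :=
        Finset.sum_lt_sum_of_nonempty (Finset.card_pos.1 (by omega)) hcon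
      rw [Finset.sum_const, nsmul_eq_mul] at h2
      linarith
    have hU : U = insert v (U.erase v) := (Finset.insert_erase hv).symm
    have hnot : v ∉ U.erase v := Finset.notMem_erase v U
    have ih' := ih (U.erase v) (by rw [Finset.card_erase_of_mem hv, hc]; rfl)
    have h3 : ∑ u ∈ U.erase v, ind G v u * min (x v) (x u) ≤ 2 * C * x v := by
      calc _ ≤ ∑ u ∈ U.erase v, ind G v u * x v :=
            Finset.sum_le_sum fun u _ =>
              mul_le_mul_of_nonneg_left (min_le_left _ _) (ind_nonneg _ _ _)
        _ = (∑ u ∈ U.erase v, ind G v u) * x v := by rw [Finset.sum_mul]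
        _ ≤ (∑ u ∈ U, ind G v u) * x v := by
            refine mul_le_mul_of_nonneg_right ?_ (hx v)
            exact Finset.sum_le_sum_of_subset_of_nonneg (Finset.erase_subset _ _)
              fun _ _ _ => ind_nonneg _ _ _
        _ ≤ _ := mul_le_mul_of_nonneg_right hdeg (hx v)
    have h4 : ∑ u ∈ U.erase v, ind G u v * min (x u) (x v)
        = ∑ u ∈ U.erase v, ind G v u * min (x v) (x u) :=
      Finset.sum_congr rfl fun u _ => by rw [ind_comm, min_comm]
    rw [hU]
    simp only [Finset.sum_insert hnot, Finset.sum_add_distrib, ind_self, zero_mul, zero_add]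
    rw [h4]
    linarith

variable [Fintype V]

lemma quadForm_sup {A B : SimpleGraph V} (h : Disjoint A B) (x : V → ℝ) :
    quadForm (A ⊔ B) x = quadForm A x + quadForm B x := by
  simp only [quadForm, ind_sup h, add_mul, Finset.sum_add_distrib]

variable {G : SimpleGraph V} {L : Finset V} {C : ℝ} {x : V → ℝ}

lemma disjoint_commonNb : Disjoint (commonNb G L) L :=
  Finset.disjoint_left.2 fun _ h => (mem_commonNb.1 h).1

/-- Keep the edges of `G` inside `L` and inside the common neighbourhood of `L`, add all edges
between `L` and its complement, and delete all other edges. -/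
noncomputable def cleaned (G : SimpleGraph V) (L : Finset V) : SimpleGraph V :=
  crossOn L ⊔ (within G L ⊔ within G (commonNb G L))

lemma quadForm_cleaned (x : V → ℝ) : quadForm (cleaned G L) x = quadForm (crossOn L) x
    + quadForm (within G L) x + quadForm (within G (commonNb G L)) x := by
  rw [cleaned, quadForm_sup, quadForm_sup, add_assoc]
  · exact (disjoint_cliqueOn disjoint_commonNb.symm).mono inf_le_right inf_le_right
  · rw [disjoint_sup_right]
    exact ⟨(disjoint_crossOn_cliqueOn (Or.inl subset_rfl)).mono_right inf_le_right,
      (disjoint_crossOn_cliqueOn (Or.inr disjoint_commonNb)).mono_right inf_le_right⟩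

lemma cleaned_eq_of_exceptional_eq_empty (h : exceptional G L = ∅) : cleaned G L = G := by
  have h1 : ∀ v, v ∉ L → v ∈ commonNb G L := by
    intro v hv
    rw [mem_commonNb]
    refine ⟨hv, fun l hl => ?_⟩
    by_contra hcon
    have : v ∈ exceptional G L := mem_exceptional.2 ⟨hv, l, hl, hcon⟩
    simp [h] at this
  ext u v
  simp only [cleaned, SimpleGraph.sup_adj, crossOn_adj, within_adj]
  constructor
  · rintro ((⟨hu, hv⟩ | ⟨hu, hv⟩) | h | h)
    · exact (mem_commonNb.1 (h1 v hv)).2 u hu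
    · exact ((mem_commonNb.1 (h1 u hu)).2 v hv).symm
    · exact h.1
    · exact h.1
  · intro huv
    have := h1 u
    have := h1 v
    tauto

lemma sum_univ_split (G : SimpleGraph V) (L : Finset V) (f : V → ℝ) :
    ∑ v, f v = ∑ v ∈ L, f v + ∑ v ∈ commonNb G L, f v + ∑ v ∈ exceptional G L, f v := by
  have h1 : (Finset.univ : Finset V) = (L ∪ commonNb G L) ∪ exceptional G L := by
    ext v
    simp only [Finset.mem_univ, Finset.mem_union, mem_commonNb, mem_exceptional, true_iff]
    by_cases hv : v ∈ L
    · simp [hv]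
    · by_cases h : ∀ l ∈ L, G.Adj l v
      · exact Or.inl (Or.inr ⟨hv, h⟩)
      · push Not at h; exact Or.inr ⟨hv, h⟩
  rw [h1, Finset.sum_union, Finset.sum_union disjoint_commonNb.symm]
  rw [Finset.disjoint_left]
  intro v hv hv'
  rw [mem_exceptional] at hv'
  rcases Finset.mem_union.1 hv with h | h
  · exact hv'.1 h
  · obtain ⟨l, hl, hlv⟩ := hv'.2
    exact hlv ((mem_commonNb.1 h).2 l hl)

/-- An exceptional v gains at least 2(1-ε)x_v from a missed vertex of L. It loses at most 2mεx_v on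
fewer than m edges to common neighbours, and edges among exceptional vertices cost at most 4Cε times
the total exceptional weight, as x_u x_v ≤ ε min(x_u, x_v). The condition on ε leaves a net gain of
at least the sum of the x_v. -/
lemma quadForm_add_le_cleaned (hS : Sparse C G) {k m : ℕ} (hB : NoBip k m G)
    (hL : L.card = k) (hx : ∀ v, 0 ≤ x v) {ε : ℝ} (hε0 : 0 ≤ ε) (hε : ε * (2 + 2 * m + 4 * C) ≤ 1)
    (hheavy : ∀ l ∈ L, 1 - ε ≤ x l) (hlight : ∀ v, v ∉ L → x v ≤ ε) :
    quadForm G x + ∑ v ∈ exceptional G L, x v ≤ quadForm (cleaned G L) x := by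
  obtain ⟨S, hSdef⟩ : ∃ U, U = commonNb G L := ⟨_, rfl⟩
  obtain ⟨R, hRdef⟩ : ∃ U, U = exceptional G L := ⟨_, rfl⟩
  have hSmem : ∀ v, v ∈ S ↔ v ∉ L ∧ ∀ l ∈ L, G.Adj l v := fun v => hSdef ▸ mem_commonNb
  have hRmem : ∀ v, v ∈ R ↔ v ∉ L ∧ ∃ l ∈ L, ¬ G.Adj l v := fun v => hRdef ▸ mem_exceptional
  obtain ⟨d, hd⟩ : ∃ d : V → V → ℝ, d = fun u v =>
    ind (cleaned G L) u v * x u * x v - ind G u v * x u * x v := ⟨_, rfl⟩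
  have hadj : ∀ u v, (cleaned G L).Adj u v ↔ ((u ∈ L ∧ v ∉ L) ∨ (u ∉ L ∧ v ∈ L)) ∨
      (G.Adj u v ∧ u ∈ L ∧ v ∈ L) ∨ (G.Adj u v ∧ u ∈ S ∧ v ∈ S) := by
    intro u v
    simp only [cleaned, SimpleGraph.sup_adj, crossOn_adj, within_adj, hSdef]
  have hSR : ∀ v, v ∈ S → v ∉ R := by
    intro v hv hv'
    obtain ⟨l, hl, hlv⟩ := ((hRmem v).1 hv').2
    exact hlv (((hSmem v).1 hv).2 l hl)
  have dcomm : ∀ u v, d u v = d v u := by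
    intro u v
    rw [hd]
    simp only [ind_comm _ u v]
    ring
  have d0 : ∀ u v, ((cleaned G L).Adj u v ↔ G.Adj u v) → d u v = 0 := by
    intro u v h
    by_cases hG : G.Adj u v
    · simp [hd, ind_of_adj hG, ind_of_adj (h.2 hG)]
    · simp [hd, ind_of_not_adj hG, ind_of_not_adj (fun h' => hG (h.1 h'))]
  have dLL : ∀ u ∈ L, ∀ v ∈ L, d u v = 0 := by
    intro u hu v hv
    apply d0
    rw [hadj, hSmem]; tauto
  have dLS : ∀ u ∈ L, ∀ v ∈ S, d u v = 0 := by
    intro u hu v hv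
    apply d0
    rw [hSmem] at hv
    have := hv.2 u hu
    rw [hadj]; tauto
  have dSS : ∀ u ∈ S, ∀ v ∈ S, d u v = 0 := by
    intro u hu v hv
    apply d0
    have h1 := ((hSmem u).1 hu).1
    have h2 := ((hSmem v).1 hv).1
    rw [hadj]; tauto
  have dRL : ∀ v ∈ R, ∀ l ∈ L, d v l = (1 - ind G v l) * x v * x l := by
    intro v hv l hl
    have h1 := ((hRmem v).1 hv).1
    have : (cleaned G L).Adj v l := by rw [hadj]; tauto
    rw [hd]
    simp only [ind_of_adj this]; ring
  have dRV : ∀ v ∈ R, ∀ u, u ∉ L → d v u = - (ind G v u * x v * x u) := by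
    intro v hv u hu
    have h1 := ((hRmem v).1 hv).1
    have h2 : v ∉ S := fun h => hSR v h hv
    have : ¬ (cleaned G L).Adj v u := by rw [hadj]; tauto
    rw [hd]
    simp only [ind_of_not_adj this]; ring
  have hsplit : ∀ f : V → ℝ, ∑ v, f v = ∑ v ∈ L, f v + ∑ v ∈ S, f v + ∑ v ∈ R, f v := by
    intro f; rw [hSdef, hRdef]; exact sum_univ_split G L f
  have hzero : ∀ A B : Finset V, (∀ u ∈ A, ∀ v ∈ B, d u v = 0) → ∑ u ∈ A, ∑ v ∈ B, d u v = 0 :=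
    fun A B h => Finset.sum_eq_zero fun u hu => Finset.sum_eq_zero fun v hv => h u hu v hv
  have hcomm : ∀ A B : Finset V, ∑ u ∈ A, ∑ v ∈ B, d u v = ∑ u ∈ B, ∑ v ∈ A, d u v := by
    intro A B
    rw [Finset.sum_comm]
    exact Finset.sum_congr rfl fun u _ => Finset.sum_congr rfl fun v _ => dcomm _ _
  have htotal : quadForm (cleaned G L) x - quadForm G x
      = 2 * ∑ v ∈ R, ∑ l ∈ L, d v l + 2 * ∑ v ∈ R, ∑ u ∈ S, d v u + ∑ v ∈ R, ∑ u ∈ R, d v u := by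
    have h1 : quadForm (cleaned G L) x - quadForm G x = ∑ u, ∑ v, d u v := by
      simp only [quadForm, hd, Finset.sum_sub_distrib]
    rw [h1, hsplit]
    simp only [hsplit, Finset.sum_add_distrib]
    rw [hzero L L dLL, hzero L S dLS, hcomm S L, hzero L S dLS, hzero S S dSS, hcomm L R,
      hcomm S R]
    ring
  have hRx : ∀ v ∈ R, 0 ≤ x v := fun v _ => hx v
  have b1 : (1 - ε) * ∑ v ∈ R, x v ≤ ∑ v ∈ R, ∑ l ∈ L, d v l := by
    rw [Finset.mul_sum]
    refine Finset.sum_le_sum fun v hv => ?_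
    obtain ⟨l, hl, hlv⟩ := ((hRmem v).1 hv).2
    calc (1 - ε) * x v ≤ x l * x v := mul_le_mul_of_nonneg_right (hheavy l hl) (hx v)
      _ = d v l := by
        rw [dRL v hv l hl, ind_of_not_adj fun h => hlv h.symm]; ring
      _ ≤ _ := by
        refine Finset.single_le_sum (f := fun l => d v l) (fun l hl => ?_) hl
        rw [dRL v hv l hl]
        exact mul_nonneg (mul_nonneg (by linarith [ind_le_one G v l]) (hx v)) (hx l)
  have b2 : - (m * ε) * ∑ v ∈ R, x v ≤ ∑ v ∈ R, ∑ u ∈ S, d v u := by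
    rw [Finset.mul_sum]
    refine Finset.sum_le_sum fun v hv => ?_
    have h1 : ∀ u ∈ S, - (ε * x v) * ind G v u ≤ d v u := by
      intro u hu
      have huL := ((hSmem u).1 hu).1
      rw [dRV v hv u huL]
      have : ind G v u * x v * x u ≤ ind G v u * x v * ε :=
        mul_le_mul_of_nonneg_left (hlight u huL) (mul_nonneg (ind_nonneg _ _ _) (hx v))
      linarith
    refine le_trans ?_ (Finset.sum_le_sum h1)
    rw [← Finset.mul_sum, sum_ind_eq_card]
    have h2 : (((S.filter (· ∈ nb G v)).card : ℕ) : ℝ) ≤ m := by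
      have h3 := hB.card_nb_inter_commonNb_lt hL ((hRmem v).1 hv).1
      have h4 : S.filter (· ∈ nb G v) = nb G v ∩ commonNb G L := by
        rw [hSdef]; ext; simp [and_comm]
      rw [h4]
      exact_mod_cast h3.le
    have h5 : 0 ≤ ε * x v := mul_nonneg hε0 (hx v)
    have h6 := mul_le_mul_of_nonneg_left h2 h5
    linarith
  have b3 : - (4 * C * ε) * ∑ v ∈ R, x v ≤ ∑ v ∈ R, ∑ u ∈ R, d v u := by
    have h1 := hS.sum_sum_min_le hx R
    have h2 : - ε * ∑ u ∈ R, ∑ v ∈ R, ind G u v * min (x u) (x v) ≤ ∑ v ∈ R, ∑ u ∈ R, d v u := by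
      simp only [Finset.mul_sum]
      refine Finset.sum_le_sum fun v hv => Finset.sum_le_sum fun u hu => ?_
      rw [dRV v hv u ((hRmem u).1 hu).1]
      have h3 : x v * x u ≤ ε * min (x v) (x u) := by
        rcases le_total (x v) (x u) with h | h
        · rw [min_eq_left h, mul_comm]
          exact mul_le_mul_of_nonneg_right (hlight u ((hRmem u).1 hu).1) (hx v)
        · rw [min_eq_right h]
          exact mul_le_mul_of_nonneg_right (hlight v ((hRmem v).1 hv).1) (hx u)
      have := mul_le_mul_of_nonneg_left h3 (ind_nonneg G v u)
      linarith
    have h4 := mul_le_mul_of_nonneg_left h1 hε0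
    linarith
  have hR0 : 0 ≤ ∑ v ∈ R, x v := Finset.sum_nonneg hRx
  have h7 := mul_le_mul_of_nonneg_right hε hR0
  rw [← hRdef]
  linarith

/-- The Rayleigh bound for H forces x to vanish on R. Since zero entries are possible, this is not
yet absurd; but then x attains the maximum for H too, and the eigenvalue equation of H at v in R
fails because v has a neighbour of positive weight. -/
lemma IsPerron.eq_empty_of_quadForm_le (hx : IsPerron G x) {H : SimpleGraph V} {R : Finset V}
    (hQ : quadForm G x + ∑ v ∈ R, x v ≤ quadForm H x)
    (hR : ∀ v ∈ R, ∃ l, H.Adj v l ∧ 0 < x l) (hl : lambdaMax H ≤ lambdaMax G) : R = ∅ := by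
  obtain ⟨z, -⟩ := hx.exists_eq_one
  have : Nonempty V := ⟨z⟩
  have h1 := lambdaMax_mul_eq_quadForm G x _ hx.eigen
  have h2 := quadForm_le H x
  have h3 : lambdaMax H * ∑ v, x v ^ 2 ≤ lambdaMax G * ∑ v, x v ^ 2 :=
    mul_le_mul_of_nonneg_right hl hx.sum_sq_pos.le
  have h4 : 0 ≤ ∑ v ∈ R, x v := Finset.sum_nonneg fun v _ => hx.nonneg v
  have h5 : ∑ v ∈ R, x v = 0 := by linarith
  rw [Finset.eq_empty_iff_forall_notMem]
  intro v hv
  have h6 : x v = 0 := (Finset.sum_eq_zero_iff_of_nonneg fun v _ => hx.nonneg v).1 h5 v hv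
  have h7 := nbrSum_eq_of_quadForm_eq H x (by linarith) v
  rw [h6, mul_zero, nbrSum_eq_sum_nb] at h7
  obtain ⟨l, hvl, hlpos⟩ := hR v hv
  have h8 : x l ≤ ∑ u ∈ nb H v, x u :=
    Finset.single_le_sum (fun u _ => hx.nonneg u) (mem_nb.2 hvl)
  linarith

lemma IsPerron.quadForm_le_of_lambdaMax_le (hx : IsPerron G x) {H : SimpleGraph V}
    (hl : lambdaMax H ≤ lambdaMax G) : quadForm H x ≤ quadForm G x := by
  obtain ⟨z, -⟩ := hx.exists_eq_one
  have : Nonempty V := ⟨z⟩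
  rw [lambdaMax_mul_eq_quadForm G x _ hx.eigen]
  exact (quadForm_le H x).trans (mul_le_mul_of_nonneg_right hl hx.sum_sq_pos.le)

end Switching

/-! ### Adjacency, containment and edge counts of joins. -/

section Join

variable {V W : Type*}

lemma ind_congr {G : SimpleGraph V} {H : SimpleGraph W} {u v : V} {u' v' : W}
    (h : G.Adj u v ↔ H.Adj u' v') : ind G u v = ind H u' v' := by
  by_cases hG : G.Adj u v
  · rw [ind_of_adj hG, ind_of_adj (h.1 hG)]
  · rw [ind_of_not_adj hG, ind_of_not_adj fun h' => hG (h.2 h')]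

lemma numEdges_bot : numEdges (⊥ : SimpleGraph V) = 0 := by simp [numEdges]

@[simp] lemma graphJoin_inl_inl {A : SimpleGraph V} {B : SimpleGraph W} {u v : V} :
    (graphJoin A B).Adj (Sum.inl u) (Sum.inl v) ↔ A.Adj u v := by simp [graphJoin]

@[simp] lemma graphJoin_inr_inr {A : SimpleGraph V} {B : SimpleGraph W} {u v : W} :
    (graphJoin A B).Adj (Sum.inr u) (Sum.inr v) ↔ B.Adj u v := by simp [graphJoin]

@[simp] lemma graphJoin_inl_inr {A : SimpleGraph V} {B : SimpleGraph W} {u : V} {v : W} :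
    (graphJoin A B).Adj (Sum.inl u) (Sum.inr v) := by simp [graphJoin]

@[simp] lemma graphJoin_inr_inl {A : SimpleGraph V} {B : SimpleGraph W} {u : V} {v : W} :
    (graphJoin A B).Adj (Sum.inr v) (Sum.inl u) := by simp [graphJoin]

lemma completeBipartiteGraph_le_graphJoin (A : SimpleGraph V) (B : SimpleGraph W) :
    completeBipartiteGraph V W ≤ graphJoin A B := le_sup_right

lemma graphJoin_mono {A A' : SimpleGraph V} {B B' : SimpleGraph W} (hA : A ≤ A') (hB : B ≤ B') :
    graphJoin A B ≤ graphJoin A' B' := by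
  rintro (u | u) (v | v) h
  · exact graphJoin_inl_inl.2 (hA (graphJoin_inl_inl.1 h))
  · simp
  · simp
  · exact graphJoin_inr_inr.2 (hB (graphJoin_inr_inr.1 h))

lemma graphJoin_isContained {V' W' : Type*} {A : SimpleGraph V} {B : SimpleGraph W}
    {A' : SimpleGraph V'} {B' : SimpleGraph W'} (hA : A.IsContained A') (hB : B.IsContained B') :
    (graphJoin A B).IsContained (graphJoin A' B') := by
  obtain ⟨f⟩ := hA
  obtain ⟨g⟩ := hB
  refine ⟨⟨⟨Sum.map f g, ?_⟩, Sum.map_injective.2 ⟨f.injective, g.injective⟩⟩⟩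
  rintro (u | u) (v | v) h
  · exact graphJoin_inl_inl.2 (f.toHom.map_adj (graphJoin_inl_inl.1 h))
  · simp
  · simp
  · exact graphJoin_inr_inr.2 (g.toHom.map_adj (graphJoin_inr_inr.1 h))

variable [Fintype V] [Fintype W]

lemma numEdges_graphJoin (A : SimpleGraph V) (B : SimpleGraph W) :
    numEdges (graphJoin A B) = numEdges A + numEdges B + Fintype.card V * Fintype.card W := by
  have h := sum_sum_ind (graphJoin A B)
  have hA := sum_sum_ind A
  have hB := sum_sum_ind B
  have e1 : ∀ u v, ind (graphJoin A B) (Sum.inl u) (Sum.inl v) = ind A u v :=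
    fun _ _ => ind_congr graphJoin_inl_inl
  have e2 : ∀ u v, ind (graphJoin A B) (Sum.inr u) (Sum.inr v) = ind B u v :=
    fun _ _ => ind_congr graphJoin_inr_inr
  have e3 : ∀ u v, ind (graphJoin A B) (Sum.inl u) (Sum.inr v) = 1 := by simp [ind]
  have e4 : ∀ u v, ind (graphJoin A B) (Sum.inr u) (Sum.inl v) = 1 := by simp [ind]
  simp only [Fintype.sum_sum_type, e1, e2, e3, e4, Finset.sum_add_distrib, hA, hB] at h
  simp only [Finset.sum_const, Finset.card_univ, nsmul_eq_mul, mul_one] at h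
  have h' : (numEdges (graphJoin A B) : ℝ)
      = numEdges A + numEdges B + Fintype.card V * Fintype.card W := by linarith
  exact_mod_cast h'

lemma two_mul_numEdges_top (k : ℕ) : 2 * (numEdges (⊤ : SimpleGraph (Fin k)) : ℝ) = k * (k - 1) := by
  classical
  rw [← sum_sum_ind]
  have : ∀ u v : Fin k, ind (⊤ : SimpleGraph (Fin k)) u v = 1 - if u = v then 1 else 0 := by
    intro u v
    by_cases h : u = v <;> simp [ind, h]
  simp [this]
  ring

end Join

/-! ### Recognising joins from a vertex set and its complement. -/

section Split

open scoped Classical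

variable {V : Type*} [Fintype V]

lemma exists_split_equiv {L : Finset V} {k n : ℕ} (hL : L.card = k) (hn : Fintype.card V = n) :
    ∃ e : Fin k ⊕ Fin (n - k) ≃ V, (∀ i, e (Sum.inl i) ∈ L) ∧ ∀ j, e (Sum.inr j) ∉ L := by
  have hc : Fintype.card {v // v ∉ L} = n - k := by
    rw [Fintype.card_subtype_compl, Fintype.card_coe, hL, hn]
  let e1 : Fin k ≃ {v // v ∈ L} := (Fintype.equivFinOfCardEq (by rw [Fintype.card_coe, hL])).symm
  let e2 : Fin (n - k) ≃ {v // v ∉ L} := (Fintype.equivFinOfCardEq hc).symm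
  refine ⟨(Equiv.sumCongr e1 e2).trans (Equiv.sumCompl (· ∈ L)), fun i => ?_, fun j => ?_⟩
  · simp
  · simpa using (e2 j).2

/-- A graph containing all edges between `L` and its complement is a join. -/
def graphJoinIso {U W : Type*} {L : Finset V} {H : SimpleGraph V} (e : U ⊕ W ≃ V)
    (h1 : ∀ i, e (Sum.inl i) ∈ L) (h2 : ∀ j, e (Sum.inr j) ∉ L) (hH : crossOn L ≤ H) :
    graphJoin (H.comap (e ∘ Sum.inl)) (H.comap (e ∘ Sum.inr)) ≃g H where
  toEquiv := e
  map_rel_iff' := by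
    rintro (u | u) (v | v)
    · simp
    · simp only [graphJoin_inl_inr, iff_true]
      exact hH (Or.inl ⟨h1 u, h2 v⟩)
    · simp only [graphJoin_inr_inl, iff_true]
      exact hH (Or.inr ⟨h2 u, h1 v⟩)
    · simp

lemma nonempty_iso_Kbip {L : Finset V} {k n : ℕ} (hL : L.card = k) (hn : Fintype.card V = n) :
    Nonempty (crossOn L ≃g Kbip k (n - k)) := by
  obtain ⟨e, h1, h2⟩ := exists_split_equiv hL hn
  refine ⟨RelIso.symm ⟨e, ?_⟩⟩
  rintro (u | u) (v | v) <;> simp [crossOn_adj, h1, h2]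

lemma nonempty_iso_cliqueJoinEmpty {L : Finset V} {k n : ℕ} (hL : L.card = k)
    (hn : Fintype.card V = n) : Nonempty (crossOn L ⊔ cliqueOn L ≃g cliqueJoinEmpty k n) := by
  obtain ⟨e, h1, h2⟩ := exists_split_equiv hL hn
  refine ⟨RelIso.symm ⟨e, ?_⟩⟩
  rintro (u | u) (v | v) <;> simp [crossOn_adj, cliqueOn_adj, h1, h2]

lemma nonempty_iso_cliqueJoinEdge {L : Finset V} {k n : ℕ} (hL : L.card = k)
    (hn : Fintype.card V = n) {P : Finset V} (hP : P.card = 2) (hPL : Disjoint P L) :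
    Nonempty (crossOn L ⊔ cliqueOn L ⊔ cliqueOn P ≃g cliqueJoinEdge k n) := by
  obtain ⟨e, h1, h2⟩ := exists_split_equiv hL hn
  obtain ⟨P', hP'⟩ : ∃ P' : Finset (Fin (n - k)), ∀ j, j ∈ P' ↔ e (Sum.inr j) ∈ P :=
    ⟨Finset.univ.filter fun j => e (Sum.inr j) ∈ P, by simp⟩
  have hP'c : P'.card = 2 := by
    rw [← hP, ← Finset.card_image_of_injective P'
      (f := fun j => e (Sum.inr j)) (e.injective.comp Sum.inr_injective)]
    congr 1
    ext v
    simp only [Finset.mem_image, hP']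
    constructor
    · rintro ⟨j, hj, rfl⟩; exact hj
    · intro hv
      obtain ⟨i | j, rfl⟩ := e.surjective v
      · exact absurd (h1 i) (Finset.disjoint_left.1 hPL hv)
      · exact ⟨j, hv, rfl⟩
  obtain ⟨e', h1', h2'⟩ := exists_split_equiv hP'c (Fintype.card_fin (n - k))
  simp only [hP'] at h1' h2'
  refine ⟨RelIso.symm ⟨(Equiv.sumCongr (Equiv.refl _) e').trans e, ?_⟩⟩
  have h3 : ∀ i, e (Sum.inl i) ∉ P := fun i h => Finset.disjoint_left.1 hPL h (h1 i)
  rintro (u | u | u) (v | v | v) <;> simp [crossOn_adj, cliqueOn_adj, h1, h2, h1', h2', h3]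

end Split

/-! ### Edge counts against quadratic forms. -/

section EdgeCount

open scoped Classical

variable {V : Type*} [Fintype V]

lemma numEdges_sup {A B : SimpleGraph V} (h : Disjoint A B) :
    numEdges (A ⊔ B) = numEdges A + numEdges B := by
  have h1 := sum_sum_ind (A ⊔ B)
  simp only [ind_sup h, Finset.sum_add_distrib, sum_sum_ind] at h1
  have : (numEdges (A ⊔ B) : ℝ) = numEdges A + numEdges B := by linarith
  exact_mod_cast this

lemma numEdges_comap_equiv {W : Type*} [Fintype W] {G : SimpleGraph V} {U : Finset V}
    (e : W ≃ U) : numEdges (G.comap fun i => (e i : V)) = numEdges (within G U) := by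
  have h1 := sum_sum_ind (G.comap fun i => (e i : V))
  have h2 := sum_sum_ind (within G U)
  have h3 : ∑ u, ∑ v, ind (within G U) u v = ∑ u ∈ U, ∑ v ∈ U, ind G u v := by
    rw [← Finset.sum_subset (Finset.subset_univ U)]
    · refine Finset.sum_congr rfl fun u hu => ?_
      rw [← Finset.sum_subset (Finset.subset_univ U)]
      · refine Finset.sum_congr rfl fun v hv => ?_
        by_cases h : G.Adj u v
        · rw [ind_of_adj h, ind_of_adj (within_adj.2 ⟨h, hu, hv⟩)]
        · rw [ind_of_not_adj h, ind_of_not_adj fun h' => h (within_adj.1 h').1]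
      · intro v _ hv
        exact ind_of_not_adj fun h' => hv (within_adj.1 h').2.2
    · intro u _ hu
      exact Finset.sum_eq_zero fun v _ => ind_of_not_adj fun h' => hu (within_adj.1 h').2.1
  have h4 : ∑ u ∈ U, ∑ v ∈ U, ind G u v = ∑ u, ∑ v, ind (G.comap fun i => (e i : V)) u v := by
    rw [← Finset.sum_coe_sort U, ← e.sum_comp]
    refine Finset.sum_congr rfl fun u _ => ?_
    rw [← Finset.sum_coe_sort U, ← e.sum_comp]
    exact Finset.sum_congr rfl fun v _ => by simp [ind]
  have : (numEdges (G.comap fun i => (e i : V)) : ℝ) = numEdges (within G U) := by linarith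
  exact_mod_cast this

lemma two_mul_numEdges_cliqueOn (U : Finset V) :
    2 * (numEdges (cliqueOn U) : ℝ) = U.card * (U.card - 1) := by
  have h : within ⊤ U = cliqueOn U := top_inf_eq _
  rw [← h, ← numEdges_comap_equiv (G := ⊤) (U := U)
    (Fintype.equivFinOfCardEq (Fintype.card_coe U)).symm, ← two_mul_numEdges_top]
  congr 3
  ext u v
  simp

lemma quadForm_le_of_adj_le {A : SimpleGraph V} {x : V → ℝ} (hx : ∀ v, 0 ≤ x v) {ε : ℝ}
    (h : ∀ u v, A.Adj u v → x u ≤ ε) : quadForm A x ≤ 2 * ε ^ 2 * numEdges A := by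
  have h1 := sum_sum_ind A
  calc quadForm A x ≤ ∑ u, ∑ v, ind A u v * ε ^ 2 := by
        refine Finset.sum_le_sum fun u _ => Finset.sum_le_sum fun v _ => ?_
        by_cases hA : A.Adj u v
        · rw [ind_of_adj hA, one_mul, one_mul, sq]
          have h2 := h u v hA
          exact mul_le_mul h2 (h v u hA.symm) (hx v) ((hx u).trans h2)
        · simp [ind_of_not_adj hA]
    _ = (∑ u, ∑ v, ind A u v) * ε ^ 2 := by simp only [Finset.sum_mul]
    _ = _ := by rw [h1]; ring

lemma le_quadForm_of_adj_le {A : SimpleGraph V} {x : V → ℝ} {ε : ℝ} (hε : 0 ≤ ε)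
    (h : ∀ u v, A.Adj u v → ε ≤ x u) : 2 * ε ^ 2 * numEdges A ≤ quadForm A x := by
  have h1 := sum_sum_ind A
  calc 2 * ε ^ 2 * numEdges A = (∑ u, ∑ v, ind A u v) * ε ^ 2 := by rw [h1]; ring
    _ = ∑ u, ∑ v, ind A u v * ε ^ 2 := by simp only [Finset.sum_mul]
    _ ≤ _ := by
        refine Finset.sum_le_sum fun u _ => Finset.sum_le_sum fun v _ => ?_
        by_cases hA : A.Adj u v
        · rw [ind_of_adj hA, one_mul, one_mul, sq]
          have h2 := h u v hA
          exact mul_le_mul h2 (h v u hA.symm) hε (hε.trans h2)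
        · simp [ind_of_not_adj hA]

lemma eq_bot_of_numEdges_eq_zero {A : SimpleGraph V} (h : numEdges A = 0) : A = ⊥ := by
  rw [numEdges, Set.ncard_eq_zero] at h
  exact SimpleGraph.edgeSet_eq_empty.1 h

/-- The number of edges inside `L` and inside its common neighbourhood is bounded by the extremal
number for graphs containing a complete bipartite graph. -/
lemma numEdges_within_add_le {W : Type*} {F : GraphFamily} {k : ℕ} {G : SimpleGraph V}
    (hG : FamilyFree F G) {L : Finset V} (hL : L.card = k) {H : SimpleGraph W}
    (hH : MemUpToIso H (EXContaining (Kbip k (k + (commonNb G L).card - k)) F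
      (k + (commonNb G L).card))) :
    numEdges (within G L) + numEdges (within G (commonNb G L)) + k * (commonNb G L).card
      ≤ numEdges H := by
  obtain ⟨S, hS⟩ : ∃ S, S = commonNb G L := ⟨_, rfl⟩
  rw [← hS] at hH ⊢
  rw [Nat.add_sub_cancel_left] at hH
  obtain ⟨H', ⟨-, hmax⟩, ⟨iso⟩⟩ := hH
  rw [← numEdges_congr iso]
  let e1 : Fin k ≃ L := (Fintype.equivFinOfCardEq (by rw [Fintype.card_coe, hL])).symm
  let e2 : Fin S.card ≃ S := (Fintype.equivFinOfCardEq (by rw [Fintype.card_coe])).symm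
  let φ : Fin k ⊕ Fin S.card → V := Sum.elim (fun i => (e1 i : V)) (fun i => (e2 i : V))
  have hSL : ∀ i, (e2 i : V) ∉ L ∧ ∀ l ∈ L, G.Adj l (e2 i) := fun i =>
    mem_commonNb.1 (hS ▸ (e2 i).2)
  have hφ : Function.Injective φ := by
    rintro (u | u) (v | v) h
    · simpa [φ, Subtype.coe_inj] using h
    · simp only [φ, Sum.elim_inl, Sum.elim_inr] at h
      exact absurd (h ▸ (e1 u).2) (hSL v).1
    · simp only [φ, Sum.elim_inl, Sum.elim_inr] at h
      exact absurd (h ▸ (e1 v).2) (hSL u).1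
    · simpa [φ, Subtype.coe_inj] using h
  -- On L and S alone `G` is already a join, of order k + |S|; extremality is therefore used at this
  -- order rather than at the order of `G`.
  have hJ : graphJoin (G.comap fun i => (e1 i : V)) (G.comap fun i => (e2 i : V)) = G.comap φ := by
    ext u v
    rcases u with u | u <;> rcases v with v | v
    · simp [φ]
    · simpa [φ] using (hSL v).2 _ (e1 u).2
    · simpa [φ] using ((hSL u).2 _ (e1 v).2).symm
    · simp [φ]
  let G' : SimpleGraph (Fin (k + S.card)) := (G.comap φ).comap finSumFinEquiv.symm
  have iso' : G' ≃g G.comap φ := SimpleGraph.Iso.comap finSumFinEquiv.symm _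
  have h1 : numEdges G' = numEdges (within G L) + numEdges (within G S) + k * S.card := by
    rw [numEdges_congr iso', ← hJ, numEdges_graphJoin, numEdges_comap_equiv,
      numEdges_comap_equiv, Fintype.card_fin, Fintype.card_fin]
  rw [← h1]
  apply hmax
  · exact hG.of_isContained (iso'.isContained.trans
      (SimpleGraph.Embedding.comap ⟨φ, hφ⟩ G).isContained)
  · refine SimpleGraph.IsContained.trans ?_ iso'.symm.isContained
    rw [← hJ]
    exact SimpleGraph.IsContained.of_le (completeBipartiteGraph_le_graphJoin _ _)

end EdgeCount

/-! ### Identifying the extremal graph from a core. -/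

section CoreStructure

open scoped Classical

set_option linter.unusedSectionVars false

variable {V : Type*} [Fintype V]

/-- `L` is a set of `k` vertices that dominates the Perron vector `x` of `G`, up to `ε`. -/
structure IsCore (k m : ℕ) (C ε : ℝ) (G : SimpleGraph V) (x : V → ℝ) (L : Finset V) : Prop where
  perron : IsPerron G x
  sparse : Sparse C G
  noBip : NoBip k m G
  card : L.card = k
  heavy : ∀ l ∈ L, 1 - ε ≤ x l
  light : ∀ v, v ∉ L → x v ≤ ε
  small : ((exceptional G L).card : ℝ) ≤ ε * Fintype.card V

variable {k m : ℕ} {C ε : ℝ} {G : SimpleGraph V} {x : V → ℝ} {L : Finset V}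

lemma card_eq_add (G : SimpleGraph V) (L : Finset V) :
    Fintype.card V = L.card + (commonNb G L).card + (exceptional G L).card := by
  have h := sum_univ_split G L (fun _ => 1)
  simp only [Finset.sum_const, nsmul_eq_mul, mul_one, Finset.card_univ] at h
  exact_mod_cast h

lemma IsCore.le_card_commonNb (h : IsCore k m C ε G x L) (hε : ε ≤ 1 / 2) :
    (Fintype.card V : ℝ) / 2 - k ≤ (commonNb G L).card := by
  have h1 := card_eq_add G L
  have h2 : (Fintype.card V : ℝ) = L.card + (commonNb G L).card + (exceptional G L).card := by
    exact_mod_cast h1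
  have h3 := h.small
  have h4 : ε * Fintype.card V ≤ 1 / 2 * Fintype.card V := by gcongr
  rw [h.card] at h2
  linarith

/-- The comparison graph `H` is kept separate from the cleaned graph, because for infinite families
the cleaned graph need not be free; it may be replaced by a free graph with at least as large a
form. -/
lemma IsCore.exceptional_eq_empty (h : IsCore k m C ε G x L) (hε0 : 0 ≤ ε)
    (hε : ε * (2 + 2 * m + 4 * C) ≤ 1) (hε1 : ε ≤ 1 / 2) {H : SimpleGraph V}
    (hH : crossOn L ≤ H) (hQ : quadForm (cleaned G L) x ≤ quadForm H x)
    (hl : lambdaMax H ≤ lambdaMax G) : exceptional G L = ∅ := by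
  refine h.perron.eq_empty_of_quadForm_le (H := H) ?_ ?_ hl
  · exact (quadForm_add_le_cleaned h.sparse h.noBip h.card h.perron.nonneg hε0 hε h.heavy
      h.light).trans hQ
  · intro v hv
    obtain ⟨hvL, l, hl, -⟩ := mem_exceptional.1 hv
    refine ⟨l, hH (Or.inr ⟨hvL, hl⟩), ?_⟩
    have := h.heavy l hl
    linarith

lemma IsCore.eq_crossOn (h : IsCore k m C ε G x L) (hε0 : 0 ≤ ε)
    (hε : ε * (2 + 2 * m + 4 * C) ≤ 1) (hε1 : ε ≤ 1 / 2)
    (he : numEdges (within G L) + numEdges (within G (commonNb G L)) = 0)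
    (hl : lambdaMax (crossOn L) ≤ lambdaMax G) : G = crossOn L := by
  have h1 : within G L = ⊥ := eq_bot_of_numEdges_eq_zero (by omega)
  have h2 : within G (commonNb G L) = ⊥ := eq_bot_of_numEdges_eq_zero (by omega)
  have h3 : cleaned G L = crossOn L := by rw [cleaned, h1, h2, sup_bot_eq, sup_bot_eq]
  have h4 := h.exceptional_eq_empty hε0 hε hε1 le_rfl (by rw [h3]) hl
  rw [← h3, cleaned_eq_of_exceptional_eq_empty h4]

/-- The edges missing inside `L`. -/
noncomputable def missing (G : SimpleGraph V) (L : Finset V) : SimpleGraph V :=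
  cliqueOn L \ within G L

lemma within_sup_missing (G : SimpleGraph V) (L : Finset V) :
    within G L ⊔ missing G L = cliqueOn L := sup_sdiff_cancel_right (within_le_cliqueOn G L)

lemma quadForm_cliqueOn (G : SimpleGraph V) (L : Finset V) (x : V → ℝ) :
    quadForm (cliqueOn L) x = quadForm (within G L) x + quadForm (missing G L) x := by
  conv_lhs => rw [← within_sup_missing G L]
  exact quadForm_sup disjoint_sdiff_self_right x

lemma numEdges_cliqueOn (G : SimpleGraph V) (L : Finset V) :
    numEdges (cliqueOn L) = numEdges (within G L) + numEdges (missing G L) := by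
  conv_lhs => rw [← within_sup_missing G L]
  exact numEdges_sup disjoint_sdiff_self_right

/-- An edge inside L contributes at least 2(3/4)² = 9/8 to the form, one between common neighbours
at most 2(1/4)² = 1/8. Trading the second kind for the first gains at least 1 per edge. -/
lemma IsCore.le_quadForm_missing (h : IsCore k m C ε G x L) (hε1 : ε ≤ 1 / 4) :
    9 / 8 * (numEdges (missing G L) : ℝ) ≤ quadForm (missing G L) x := by
  have h1 := le_quadForm_of_adj_le (A := missing G L) (x := x) (ε := 3 / 4) (by norm_num) (by
    intro u v huv
    have := h.heavy u (sdiff_le (a := cliqueOn L) (b := within G L) huv).2.1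
    linarith)
  linarith

lemma IsCore.light_of_mem_commonNb (h : IsCore k m C ε G x L) (hε1 : ε ≤ 1 / 4) {v : V}
    (hv : v ∈ commonNb G L) : x v ≤ 1 / 4 :=
  (h.light v (mem_commonNb.1 hv).1).trans hε1

lemma quadForm_crossOn_sup_cliqueOn (L : Finset V) (x : V → ℝ) :
    quadForm (crossOn L ⊔ cliqueOn L) x = quadForm (crossOn L) x + quadForm (cliqueOn L) x :=
  quadForm_sup (disjoint_crossOn_cliqueOn (Or.inl subset_rfl)) x

/-- By the edge count, there are at most as many edges among common neighbours as edges missing in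
L. Completing L in exchange gains at least the number of missing edges, which must therefore be
zero. -/
lemma IsCore.eq_crossOn_sup_cliqueOn (h : IsCore k m C ε G x L) (hε0 : 0 ≤ ε)
    (hε : ε * (2 + 2 * m + 4 * C) ≤ 1) (hε1 : ε ≤ 1 / 4)
    (he : numEdges (within G L) + numEdges (within G (commonNb G L)) ≤ numEdges (cliqueOn L))
    (hl : lambdaMax (crossOn L ⊔ cliqueOn L) ≤ lambdaMax G) : G = crossOn L ⊔ cliqueOn L := by
  have h1 := numEdges_cliqueOn G L
  have h2 := h.le_quadForm_missing hε1
  have h3 := quadForm_le_of_adj_le (A := within G (commonNb G L)) h.perron.nonneg (ε := 1 / 4)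
    (fun u v huv => h.light_of_mem_commonNb hε1 (within_adj.1 huv).2.1)
  have h4 : (numEdges (within G (commonNb G L)) : ℝ) ≤ numEdges (missing G L) := by
    exact_mod_cast (by omega)
  have h5 : (0 : ℝ) ≤ numEdges (missing G L) := Nat.cast_nonneg _
  have h6 : quadForm (cleaned G L) x + numEdges (missing G L)
      ≤ quadForm (crossOn L ⊔ cliqueOn L) x := by
    rw [quadForm_cleaned, quadForm_crossOn_sup_cliqueOn, quadForm_cliqueOn G]
    linarith
  have h7 := h.exceptional_eq_empty hε0 hε (by linarith) le_sup_left (by linarith) hl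
  have h8 := cleaned_eq_of_exceptional_eq_empty h7
  have h9 := h.perron.quadForm_le_of_lambdaMax_le hl
  rw [h8] at h6
  have h10 : (numEdges (missing G L) : ℝ) ≤ 0 := by linarith
  have h11 : numEdges (missing G L) = 0 := by
    have : numEdges (missing G L) ≤ 0 := by exact_mod_cast h10
    omega
  have h12 : within G L = cliqueOn L := by
    rw [← within_sup_missing G L, eq_bot_of_numEdges_eq_zero h11, sup_bot_eq]
  have h13 : within G (commonNb G L) = ⊥ := eq_bot_of_numEdges_eq_zero (by omega)
  calc G = cleaned G L := h8.symm
    _ = _ := by rw [cleaned, h12, h13, sup_bot_eq]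

lemma numEdges_cliqueOn_of_card_eq_two {P : Finset V} (hP : P.card = 2) :
    numEdges (cliqueOn P) = 1 := by
  have h := two_mul_numEdges_cliqueOn P
  rw [hP] at h
  have : (numEdges (cliqueOn P) : ℝ) = 1 := by push_cast at h; linarith
  exact_mod_cast this

lemma IsCore.eq_crossOn_sup_cliqueOn_sup (h : IsCore k m C ε G x L) (hε0 : 0 ≤ ε)
    (hε : ε * (2 + 2 * m + 4 * C) ≤ 1) (hε1 : ε ≤ 1 / 4) (hk : 1 ≤ k) (hlpos : 0 < lambdaMax G)
    (he : numEdges (within G L) + numEdges (within G (commonNb G L)) ≤ numEdges (cliqueOn L) + 1)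
    (hS : 2 ≤ (commonNb G L).card)
    (hl : ∀ P : Finset V, P.card = 2 → Disjoint P L →
      lambdaMax (crossOn L ⊔ cliqueOn L ⊔ cliqueOn P) ≤ lambdaMax G) :
    ∃ P : Finset V, P.card = 2 ∧ Disjoint P L ∧ G = crossOn L ⊔ cliqueOn L ⊔ cliqueOn P := by
  obtain ⟨S, hSdef⟩ : ∃ S, S = commonNb G L := ⟨_, rfl⟩
  have hnn := h.perron.nonneg
  -- P is an edge of `G` between common neighbours if there is one, and otherwise an arbitrary pair
  -- of them. In the first case the edge is kept and only the others are traded for missing edges of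
  -- L.
  obtain ⟨P, hP, hPS, hPe⟩ : ∃ P : Finset V, P.card = 2 ∧ P ⊆ S ∧
      (within G S = ⊥ ∨ cliqueOn P ≤ within G S) := by
    by_cases hb : within G S = ⊥
    · obtain ⟨P, hP, hP2⟩ := Finset.exists_subset_card_eq (hSdef ▸ hS)
      exact ⟨P, hP2, hP, Or.inl hb⟩
    · obtain ⟨u, v, huv⟩ := SimpleGraph.ne_bot_iff_exists_adj.1 hb
      refine ⟨{u, v}, Finset.card_pair huv.ne, ?_, Or.inr ?_⟩
      · intro w hw
        rw [within_adj] at huv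
        simp only [Finset.mem_insert, Finset.mem_singleton] at hw
        rcases hw with rfl | rfl
        · exact huv.2.1
        · exact huv.2.2
      · intro a b hab
        rw [cliqueOn_adj] at hab
        simp only [Finset.mem_insert, Finset.mem_singleton] at hab
        obtain ⟨hne, rfl | rfl, rfl | rfl⟩ := hab
        · exact absurd rfl hne
        · exact huv
        · exact huv.symm
        · exact absurd rfl hne
  have hPL : Disjoint P L := Finset.disjoint_of_subset_left (hSdef ▸ hPS) disjoint_commonNb
  have hl' := hl P hP hPL
  have hP1 := numEdges_cliqueOn_of_card_eq_two hP
  have h1 := numEdges_cliqueOn G L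
  have h2 := h.le_quadForm_missing hε1
  have hM0 : (0 : ℝ) ≤ numEdges (missing G L) := Nat.cast_nonneg _
  rw [← hSdef] at he
  have h3 : quadForm (within G S) x ≤ quadForm (cliqueOn P) x
      + 1 / 8 * numEdges (missing G L) := by
    rcases hPe with hb | hle
    · have e0 : quadForm (within G S) x = 0 := by rw [hb]; simp [quadForm, ind]
      have e1 : 0 ≤ quadForm (cliqueOn P) x := Finset.sum_nonneg fun u _ =>
        Finset.sum_nonneg fun v _ => mul_nonneg (mul_nonneg (ind_nonneg _ _ _) (hnn u)) (hnn v)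
      linarith
    · have e1 : within G S = cliqueOn P ⊔ (within G S \ cliqueOn P) :=
        (sup_sdiff_cancel_right hle).symm
      have e2 : quadForm (within G S) x
          = quadForm (cliqueOn P) x + quadForm (within G S \ cliqueOn P) x := by
        rw [← quadForm_sup disjoint_sdiff_self_right, ← e1]
      have e3 : numEdges (within G S)
          = numEdges (cliqueOn P) + numEdges (within G S \ cliqueOn P) := by
        rw [← numEdges_sup disjoint_sdiff_self_right, ← e1]
      have e4 := quadForm_le_of_adj_le (A := within G S \ cliqueOn P) hnn (ε := 1 / 4)
        (fun u v huv => h.light_of_mem_commonNb hε1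
          (hSdef ▸ (within_adj.1 (sdiff_le (a := within G S) (b := cliqueOn P) huv)).2.1))
      have e5 : (numEdges (within G S \ cliqueOn P) : ℝ) ≤ numEdges (missing G L) := by
        exact_mod_cast (by omega)
      linarith
  have hdisj : Disjoint (crossOn L ⊔ cliqueOn L) (cliqueOn P) := by
    rw [disjoint_sup_left]
    exact ⟨disjoint_crossOn_cliqueOn (Or.inr hPL), disjoint_cliqueOn hPL.symm⟩
  have h6 : quadForm (cleaned G L) x + numEdges (missing G L)
      ≤ quadForm (crossOn L ⊔ cliqueOn L ⊔ cliqueOn P) x := by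
    rw [quadForm_cleaned, quadForm_sup hdisj, quadForm_crossOn_sup_cliqueOn, quadForm_cliqueOn G,
      ← hSdef]
    linarith
  have h7 := h.exceptional_eq_empty hε0 hε (by linarith) (le_sup_left.trans le_sup_left)
    (by linarith) hl'
  have h8 := cleaned_eq_of_exceptional_eq_empty h7
  have h9 := h.perron.quadForm_le_of_lambdaMax_le hl'
  rw [h8] at h6
  have h11 : numEdges (missing G L) = 0 := by
    have h10 : (numEdges (missing G L) : ℝ) ≤ 0 := by linarith
    have : numEdges (missing G L) ≤ 0 := by exact_mod_cast h10
    omega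
  have h12 : within G L = cliqueOn L := by
    rw [← within_sup_missing G L, eq_bot_of_numEdges_eq_zero h11, sup_bot_eq]
  have h13 : G = crossOn L ⊔ (cliqueOn L ⊔ within G S) := by
    calc G = cleaned G L := h8.symm
      _ = _ := by rw [cleaned, h12, ← hSdef]
  refine ⟨P, hP, hPL, ?_⟩
  rcases hPe with hb | hle
  -- If P is not an edge of `G`, adding it would strictly increase the form: each common neighbour
  -- has positive weight, being adjacent to a core vertex.
  · exfalso
    have e0 : quadForm G x = quadForm (crossOn L ⊔ cliqueOn L) x := by
      rw [hb, sup_bot_eq] at h13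
      rw [← h13]
    rw [quadForm_sup hdisj, ← e0] at h9
    obtain ⟨l, hlL⟩ : L.Nonempty := Finset.card_pos.1 (by rw [h.card]; omega)
    have hpos : ∀ v ∈ S, 0 < x v := by
      intro v hv
      have hvl : G.Adj v l := ((mem_commonNb.1 (hSdef ▸ hv)).2 l hlL).symm
      have e1 := h.perron.lambda_mul v
      have e2 : x l ≤ ∑ u ∈ nb G v, x u :=
        Finset.single_le_sum (fun u _ => hnn u) (mem_nb.2 hvl)
      have e3 := h.heavy l hlL
      have e4 : 0 < lambdaMax G * x v := by linarith
      exact pos_of_mul_pos_right e4 hlpos.le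
    obtain ⟨u, v, huv, rfl⟩ := Finset.card_eq_two.1 hP
    have e5 : ind (cliqueOn {u, v}) u v * x u * x v ≤ quadForm (cliqueOn {u, v}) x := by
      refine le_trans ?_ (Finset.single_le_sum (f := fun a => ∑ b, ind (cliqueOn {u, v}) a b *
        x a * x b) (fun a _ => Finset.sum_nonneg fun b _ => mul_nonneg (mul_nonneg
        (ind_nonneg _ _ _) (hnn a)) (hnn b)) (Finset.mem_univ u))
      exact Finset.single_le_sum (f := fun b => ind (cliqueOn {u, v}) u b * x u * x b)
        (fun b _ => mul_nonneg (mul_nonneg (ind_nonneg _ _ _) (hnn u)) (hnn b)) (Finset.mem_univ v)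
    rw [ind_of_adj (by simp [cliqueOn_adj, huv])] at e5
    have e6 := mul_pos (hpos u (hPS (by simp))) (hpos v (hPS (by simp)))
    linarith
  · have e1 : within G S = cliqueOn P := by
      have e1 : within G S = cliqueOn P ⊔ (within G S \ cliqueOn P) :=
        (sup_sdiff_cancel_right hle).symm
      have e3 : numEdges (within G S)
          = numEdges (cliqueOn P) + numEdges (within G S \ cliqueOn P) := by
        rw [← numEdges_sup disjoint_sdiff_self_right, ← e1]
      rw [e1, eq_bot_of_numEdges_eq_zero (A := within G S \ cliqueOn P) (by omega), sup_bot_eq]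
    rw [e1, ← sup_assoc] at h13
    exact h13

end CoreStructure

/-! ### Explicit extremal graphs. -/

section SmallCases

open scoped Classical

/-- The free graph containing `K_{k,n-k}` is a competitor, so λ² ≥ k(n-k) ≥ n/2. This feeds
`exists_core` and also makes λ exceed any prescribed constant. -/
lemma eventually_exists_isCore {F : GraphFamily} {k m : ℕ} {C : ℝ} (hk : 1 ≤ k) (hC : 1 ≤ C)
    (hS : ∀ (V : Type) (G : SimpleGraph V), FamilyFree F G → Sparse C G)
    (hB : ∀ (V : Type) (G : SimpleGraph V), FamilyFree F G → NoBip k m G)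
    {ε : ℝ} (hε : 0 < ε) (K : ℝ) :
    ∀ᶠ n : ℕ in atTop, ∀ G ∈ SPEX F n,
      (∃ H : SimpleGraph (Fin n), FamilyFree F H ∧ (Kbip k (n - k)).IsContained H) →
      ∃ x L, IsCore k m C ε G x L ∧ K ≤ lambdaMax G ∧ 0 < lambdaMax G ∧
        (n : ℝ) ≤ 2 * lambdaMax G ^ 2 := by
  obtain ⟨K₁, hK₁⟩ := exists_core k m hk hC hε
  obtain ⟨K₂, hK₂⟩ : ∃ K₂ : ℝ, K₂ = max 1 (max K K₁) := ⟨_, rfl⟩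
  have hK21 : 1 ≤ K₂ := hK₂ ▸ le_max_left _ _
  have hK2K : K ≤ K₂ := hK₂ ▸ (le_max_left _ _).trans (le_max_right _ _)
  have hK2K1 : K₁ ≤ K₂ := hK₂ ▸ (le_max_right _ _).trans (le_max_right _ _)
  have e1 : ∀ᶠ n : ℕ in atTop, 2 * K₂ ^ 2 ≤ n := tendsto_natCast_atTop_atTop.eventually_ge_atTop _
  filter_upwards [e1, eventually_ge_atTop (2 * k + 1)] with n hn hnk G hG ⟨H, hHF, hHK⟩
  have hk' : (1 : ℝ) ≤ k := by exact_mod_cast hk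
  have hnk' : 2 * (k : ℝ) + 1 ≤ n := by exact_mod_cast hnk
  have : Nonempty (Fin n) := ⟨⟨0, by omega⟩⟩
  have : Nonempty (Fin k ⊕ Fin (n - k)) := ⟨Sum.inl ⟨0, hk⟩⟩
  have h1 : Real.sqrt (k * ((n - k : ℕ) : ℝ)) ≤ lambdaMax G :=
    (lambdaMax_Kbip hk (by omega)).trans ((lambdaMax_le_of_isContained hHK).trans (hG.2 H hHF))
  rw [Nat.cast_sub (by omega)] at h1
  have h2 : (n : ℝ) / 2 ≤ k * ((n : ℝ) - k) := by
    have : (n : ℝ) - k ≤ k * ((n : ℝ) - k) := le_mul_of_one_le_left (by linarith) hk'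
    linarith
  have hK2l : K₂ ≤ lambdaMax G := by
    refine le_trans ?_ h1
    apply Real.le_sqrt_of_sq_le
    linarith
  have hl2 : (k : ℝ) * (n - k) ≤ lambdaMax G ^ 2 := by
    have h0 : 0 ≤ (k : ℝ) * (n - k) := by linarith [Nat.cast_nonneg (α := ℝ) n]
    calc (k : ℝ) * (n - k) = Real.sqrt (k * (n - k)) ^ 2 := (Real.sq_sqrt h0).symm
      _ ≤ _ := by gcongr
  obtain ⟨x, hx⟩ := exists_isPerron G
  have hSG := hS _ G hG.1
  have hBG := hB _ G hG.1
  have hK2n : K₂ ≤ n := by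
    have : K₂ ≤ K₂ ^ 2 := by rw [sq]; exact le_mul_of_one_le_left (by linarith) hK21
    linarith
  obtain ⟨L, hL, hheavy, hlight, hsmall⟩ := hK₁ (Fin n) G x hx hSG hBG (by linarith)
    (by rw [Fintype.card_fin]; linarith) (by rw [Fintype.card_fin]; exact hl2)
  exact ⟨x, L, ⟨hx, hSG, hBG, hL, hheavy, hlight, hsmall⟩, by linarith, by linarith, by linarith⟩

lemma SPEX_nonempty {F : GraphFamily} {n : ℕ} {H : SimpleGraph (Fin n)} (hH : FamilyFree F H) :
    (SPEX F n).Nonempty := by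
  obtain ⟨G, hG, hmax⟩ := Set.exists_max_image {G : SimpleGraph (Fin n) | FamilyFree F G} lambdaMax
    (Set.toFinite _) ⟨H, hH⟩
  exact ⟨G, hG, hmax⟩

lemma FamilyFree.congr {V W : Type*} {F : GraphFamily} {G : SimpleGraph V} {H : SimpleGraph W}
    (e : G ≃g H) (h : FamilyFree F G) : FamilyFree F H :=
  h.of_isContained e.symm.isContained

/-- A maximiser exists, as there are finitely many graphs on `Fin n`; being isomorphic to `T`, it
transfers its maximality to every graph of that isomorphism class. -/
lemma SPEX_eq_isoClass {F : GraphFamily} {n : ℕ} (hn : 0 < n) {W : Type*} [Fintype W]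
    {T : SimpleGraph W} {H : SimpleGraph (Fin n)} (hH : FamilyFree F H)
    (h : ∀ G ∈ SPEX F n, Nonempty (G ≃g T)) : SPEX F n = isoClass T n := by
  have : Nonempty (Fin n) := ⟨⟨0, hn⟩⟩
  refine Set.Subset.antisymm h ?_
  rintro G ⟨e⟩
  obtain ⟨G₀, hG₀⟩ := SPEX_nonempty hH
  obtain ⟨e₀⟩ := h G₀ hG₀
  have e' : G₀ ≃g G := e₀.trans e.symm
  refine ⟨hG₀.1.congr e', fun G' hG' => ?_⟩
  rw [← lambdaMax_congr e']
  exact hG₀.2 G' hG'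

lemma MemUpToIso.exists_free {F : GraphFamily} {n : ℕ} {W U : Type*} {T : SimpleGraph W}
    {B : SimpleGraph U} (h : MemUpToIso T (EXContaining B F n)) :
    ∃ H : SimpleGraph (Fin n), FamilyFree F H ∧ B.IsContained H ∧ Nonempty (H ≃g T) := by
  obtain ⟨H, ⟨⟨h1, h2⟩, -⟩, h3⟩ := h
  exact ⟨H, h1, h2, h3⟩

lemma lambdaMax_le_of_mem_SPEX {F : GraphFamily} {n : ℕ} {V : Type*} [Fintype V] [Nonempty V]
    {G H : SimpleGraph (Fin n)} (hG : G ∈ SPEX F n) (hH : FamilyFree F H) {T : SimpleGraph V}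
    (e : H ≃g T) : lambdaMax T ≤ lambdaMax G := by
  rw [lambdaMax_congr e.symm]
  exact hG.2 H hH

lemma numEdges_Kbip (k s : ℕ) : numEdges (Kbip k s) = k * s := by
  have h : Kbip k s = graphJoin ⊥ ⊥ := by
    ext u v
    rcases u with u | u <;> rcases v with v | v <;> simp
  rw [h, numEdges_graphJoin, numEdges_bot, numEdges_bot]
  simp

lemma numEdges_top_eq_cliqueOn {V : Type*} [Fintype V] {k : ℕ} {L : Finset V} (hL : L.card = k) :
    numEdges (⊤ : SimpleGraph (Fin k)) = numEdges (cliqueOn L) := by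
  have h1 := two_mul_numEdges_top k
  have h2 := two_mul_numEdges_cliqueOn L
  rw [hL] at h2
  have : (numEdges (⊤ : SimpleGraph (Fin k)) : ℝ) = numEdges (cliqueOn L) := by linarith
  exact_mod_cast this

lemma numEdges_edge_sum_bot (s : ℕ) :
    numEdges ((⊤ : SimpleGraph (Fin 2)) ⊕g (⊥ : SimpleGraph (Fin s))) = 1 := by
  have h := sum_sum_ind ((⊤ : SimpleGraph (Fin 2)) ⊕g (⊥ : SimpleGraph (Fin s)))
  simp only [Fintype.sum_sum_type, Fin.sum_univ_two] at h
  simp [ind] at h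
  have : (numEdges ((⊤ : SimpleGraph (Fin 2)) ⊕g (⊥ : SimpleGraph (Fin s))) : ℝ) = 1 := by linarith
  exact_mod_cast this

variable {F : GraphFamily} {k : ℕ}

/-- The common part of the cases in which the extremal graph is explicit. -/
lemma eventually_exists_isCore_of_memUpToIso (hk : 1 ≤ k)
    (hex : (fun n : ℕ => (ex F n : ℝ)) =O[atTop] (fun n : ℕ => (n : ℝ)))
    (hK : ¬ FamilyFree F (completeBipartiteGraph (Fin (k + 1)) ℕ))
    {W : ℕ → Type} (T : ∀ n, SimpleGraph (W n))
    (hT : ∀ᶠ n : ℕ in atTop, MemUpToIso (T n) (EXContaining (Kbip k (n - k)) F n)) :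
    ∃ (m : ℕ) (C ε : ℝ), 0 ≤ ε ∧ ε * (2 + 2 * m + 4 * C) ≤ 1 ∧ ε ≤ 1 / 4 ∧
    ∀ᶠ n : ℕ in atTop, 0 < n ∧ ∀ G ∈ SPEX F n, ∃ x L, IsCore k m C ε G x L ∧ 0 < lambdaMax G ∧
      2 ≤ (commonNb G L).card ∧
      numEdges (within G L) + numEdges (within G (commonNb G L)) + k * (commonNb G L).card
      ≤ numEdges (T (k + (commonNb G L).card)) := by
  obtain ⟨C, hC, hS⟩ := exists_sparse hex
  obtain ⟨m, hB⟩ := exists_noBip hK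
  -- Taking ε as the reciprocal of this sum satisfies both the gain condition of the cleaning step
  -- and ε ≤ 1/4.
  have hpos : 0 < 4 + 2 * (m : ℝ) + 4 * C := by positivity
  have hε : 0 < 1 / (4 + 2 * (m : ℝ) + 4 * C) := by positivity
  have hε1 : 1 / (4 + 2 * (m : ℝ) + 4 * C) ≤ 1 / 4 := by
    apply one_div_le_one_div_of_le (by norm_num)
    have : (0 : ℝ) ≤ m := by positivity
    linarith
  refine ⟨m, C, 1 / (4 + 2 * m + 4 * C), hε.le, ?_, hε1, ?_⟩
  · rw [div_mul_eq_mul_div, one_mul, div_le_one hpos]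
    linarith
  -- The extremal hypothesis is needed at order k + |S|, where S is the common neighbourhood; this
  -- exceeds N for large n because |S| ≥ n/2 - k.
  obtain ⟨N, hN⟩ := eventually_atTop.1 hT
  have e1 : ∀ᶠ n : ℕ in atTop, 2 * ((k : ℝ) + N + 2) ≤ n :=
    tendsto_natCast_atTop_atTop.eventually_ge_atTop _
  filter_upwards [eventually_exists_isCore hk hC hS hB hε 0, hT, eventually_gt_atTop 0, e1] with
    n hcore hTn hn hn1
  refine ⟨hn, fun G hG => ?_⟩
  obtain ⟨H, hH, hHK, -⟩ := hTn.exists_free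
  obtain ⟨x, L, hL, -, hl, -⟩ := hcore G hG ⟨H, hH, hHK⟩
  have h1 := hL.le_card_commonNb (by linarith)
  rw [Fintype.card_fin] at h1
  have h2 : N + 2 ≤ (commonNb G L).card := by
    have : ((N + 2 : ℕ) : ℝ) ≤ (commonNb G L).card := by push_cast; linarith
    exact_mod_cast this
  refine ⟨x, L, hL, hl, by omega, numEdges_within_add_le hG.1 hL.card (hN _ (by omega))⟩

theorem SPEX_eq_Kbip (hk : 1 ≤ k)
    (hex : (fun n : ℕ => (ex F n : ℝ)) =O[atTop] (fun n : ℕ => (n : ℝ)))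
    (hK : ¬ FamilyFree F (completeBipartiteGraph (Fin (k + 1)) ℕ))
    (hT : ∀ᶠ n : ℕ in atTop, MemUpToIso (Kbip k (n - k)) (EXContaining (Kbip k (n - k)) F n)) :
    ∀ᶠ n : ℕ in atTop, SPEX F n = isoClass (Kbip k (n - k)) n := by
  obtain ⟨m, C, ε, hε0, hε, hε1, hev⟩ :=
    eventually_exists_isCore_of_memUpToIso hk hex hK (fun n => Kbip k (n - k)) hT
  filter_upwards [hev, hT] with n ⟨hn, hcore⟩ hTn
  obtain ⟨H, hH, -, ⟨e⟩⟩ := hTn.exists_free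
  refine SPEX_eq_isoClass hn hH fun G hG => ?_
  obtain ⟨x, L, hL, -, -, he⟩ := hcore G hG
  rw [Nat.add_sub_cancel_left, numEdges_Kbip] at he
  obtain ⟨e'⟩ := nonempty_iso_Kbip hL.card (Fintype.card_fin n)
  have : Nonempty (Fin n) := ⟨⟨0, hn⟩⟩
  have hGL := hL.eq_crossOn hε0 hε (by linarith) (by omega)
    (lambdaMax_le_of_mem_SPEX hG hH (e.trans e'.symm))
  rw [hGL]
  exact ⟨e'⟩

theorem SPEX_eq_cliqueJoinEmpty (hk : 1 ≤ k)
    (hex : (fun n : ℕ => (ex F n : ℝ)) =O[atTop] (fun n : ℕ => (n : ℝ)))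
    (hK : ¬ FamilyFree F (completeBipartiteGraph (Fin (k + 1)) ℕ))
    (hT : ∀ᶠ n : ℕ in atTop,
      MemUpToIso (cliqueJoinEmpty k n) (EXContaining (Kbip k (n - k)) F n)) :
    ∀ᶠ n : ℕ in atTop, SPEX F n = isoClass (cliqueJoinEmpty k n) n := by
  obtain ⟨m, C, ε, hε0, hε, hε1, hev⟩ :=
    eventually_exists_isCore_of_memUpToIso hk hex hK (fun n => cliqueJoinEmpty k n) hT
  filter_upwards [hev, hT] with n ⟨hn, hcore⟩ hTn
  obtain ⟨H, hH, -, ⟨e⟩⟩ := hTn.exists_free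
  refine SPEX_eq_isoClass hn hH fun G hG => ?_
  obtain ⟨x, L, hL, -, -, he⟩ := hcore G hG
  rw [numEdges_graphJoin, numEdges_bot, Fintype.card_fin, Fintype.card_fin,
    Nat.add_sub_cancel_left, numEdges_top_eq_cliqueOn hL.card] at he
  obtain ⟨e'⟩ := nonempty_iso_cliqueJoinEmpty hL.card (Fintype.card_fin n)
  have : Nonempty (Fin n) := ⟨⟨0, hn⟩⟩
  have hGL := hL.eq_crossOn_sup_cliqueOn hε0 hε hε1 (by omega)
    (lambdaMax_le_of_mem_SPEX hG hH (e.trans e'.symm))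
  rw [hGL]
  exact ⟨e'⟩

theorem SPEX_eq_cliqueJoinEdge (hk : 1 ≤ k)
    (hex : (fun n : ℕ => (ex F n : ℝ)) =O[atTop] (fun n : ℕ => (n : ℝ)))
    (hK : ¬ FamilyFree F (completeBipartiteGraph (Fin (k + 1)) ℕ))
    (hT : ∀ᶠ n : ℕ in atTop,
      MemUpToIso (cliqueJoinEdge k n) (EXContaining (Kbip k (n - k)) F n)) :
    ∀ᶠ n : ℕ in atTop, SPEX F n = isoClass (cliqueJoinEdge k n) n := by
  obtain ⟨m, C, ε, hε0, hε, hε1, hev⟩ :=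
    eventually_exists_isCore_of_memUpToIso hk hex hK (fun n => cliqueJoinEdge k n) hT
  filter_upwards [hev, hT] with n ⟨hn, hcore⟩ hTn
  obtain ⟨H, hH, -, ⟨e⟩⟩ := hTn.exists_free
  refine SPEX_eq_isoClass hn hH fun G hG => ?_
  obtain ⟨x, L, hL, hl, hS, he⟩ := hcore G hG
  rw [numEdges_graphJoin, numEdges_edge_sum_bot, Fintype.card_sum, Fintype.card_fin,
    Fintype.card_fin, Fintype.card_fin, Nat.add_sub_cancel_left, Nat.add_sub_cancel' hS,
    numEdges_top_eq_cliqueOn hL.card] at he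
  have : Nonempty (Fin n) := ⟨⟨0, hn⟩⟩
  obtain ⟨P, hP, hPL, hGL⟩ := hL.eq_crossOn_sup_cliqueOn_sup hε0 hε hε1 hk hl (by omega) hS
    fun P hP hPL => by
      obtain ⟨e'⟩ := nonempty_iso_cliqueJoinEdge hL.card (Fintype.card_fin n) hP hPL
      exact lambdaMax_le_of_mem_SPEX hG hH (e.trans e'.symm)
  rw [hGL]
  exact nonempty_iso_cliqueJoinEdge hL.card (Fintype.card_fin n) hP hPL

end SmallCases

/-! ### Freeness of the cleaned graph and the degree bound outside the core. -/

section Redirect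

open scoped Classical

variable {V : Type*} [Fintype V]

/-- If the common neighbourhood of `L` is large, then cleaning preserves freeness: the exceptional
vertices of a copy can be replaced by unused common neighbours. -/
lemma FamilyFree.cleaned {F : GraphFamily} {G : SimpleGraph V} (hG : FamilyFree F G)
    {L : Finset V} (hF : ∀ A ∈ F, A.1 ≤ (commonNb G L).card) : FamilyFree F (cleaned G L) := by
  rintro A hA ⟨f⟩
  obtain ⟨S, hS⟩ : ∃ S, S = commonNb G L := ⟨_, rfl⟩
  obtain ⟨R, hR⟩ : ∃ R, R = exceptional G L := ⟨_, rfl⟩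
  have hSm : ∀ v, v ∈ S ↔ v ∉ L ∧ ∀ l ∈ L, G.Adj l v := fun v => hS ▸ mem_commonNb
  have hRm : ∀ v, v ∈ R ↔ v ∉ L ∧ ∃ l ∈ L, ¬ G.Adj l v := fun v => hR ▸ mem_exceptional
  have hadj : ∀ u v, (SpectralTuran.cleaned G L).Adj u v ↔ ((u ∈ L ∧ v ∉ L) ∨ (u ∉ L ∧ v ∈ L)) ∨
      (G.Adj u v ∧ u ∈ L ∧ v ∈ L) ∨ (G.Adj u v ∧ u ∈ S ∧ v ∈ S) := by
    intro u v
    simp only [SpectralTuran.cleaned, SimpleGraph.sup_adj, crossOn_adj, within_adj, hS]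
  have hSR : ∀ v, v ∈ S → v ∉ R := by
    intro v hv hv'
    obtain ⟨l, hl, hlv⟩ := ((hRm v).1 hv').2
    exact hlv (((hSm v).1 hv).2 l hl)
  have hcover : ∀ v, v ∉ L → v ∉ R → v ∈ S := by
    intro v hvL hvR
    rw [hSm]
    refine ⟨hvL, fun l hl => ?_⟩
    by_contra hc
    exact hvR ((hRm v).2 ⟨hvL, l, hl, hc⟩)
  obtain ⟨I, hI⟩ : ∃ I, I = Finset.univ.image f := ⟨_, rfl⟩
  have hfI : ∀ a, f a ∈ I := fun a => hI ▸ Finset.mem_image_of_mem _ (Finset.mem_univ _)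
  have hIc : I.card ≤ S.card := by
    rw [hI, Finset.card_image_of_injective _ (show Function.Injective f from f.injective),
      Finset.card_univ, Fintype.card_fin, hS]
    exact hF A hA
  -- The exceptional and common-neighbour vertices of the copy are disjoint parts of I, and |I| ≤
  -- |S|, so enough common neighbours are unused.
  have hcard : (I ∩ R).card ≤ (S \ I).card := by
    have h1 := Finset.card_sdiff_add_card_inter S I
    have h2 : ((I ∩ R) ∪ (S ∩ I)).card ≤ I.card := by
      apply Finset.card_le_card
      intro v
      simp only [Finset.mem_union, Finset.mem_inter]
      tauto
    rw [Finset.card_union_of_disjoint] at h2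
    · omega
    · rw [Finset.disjoint_left]
      intro v hv hv'
      exact hSR v (Finset.mem_inter.1 hv').1 (Finset.mem_inter.1 hv).2
  obtain ⟨g⟩ : Nonempty ((I ∩ R : Finset V) ↪ (S \ I : Finset V)) :=
    Function.Embedding.nonempty_of_card_le
      (by rwa [Fintype.card_coe, Fintype.card_coe])
  let ψ : V → V := fun v => if h : v ∈ I ∩ R then g ⟨v, h⟩ else v
  have hψ1 : ∀ v (h : v ∈ I ∩ R), ψ v = g ⟨v, h⟩ := fun v h => dif_pos h
  have hψ2 : ∀ v, v ∉ R → ψ v = v := fun v h => dif_neg fun h' => h (Finset.mem_inter.1 h').2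
  have hψS : ∀ v (h : v ∈ I ∩ R), ψ v ∈ S ∧ ψ v ∉ I := by
    intro v h
    rw [hψ1 v h, ← Finset.mem_sdiff]
    exact (g ⟨v, h⟩).2
  -- In the cleaned graph an exceptional vertex is adjacent to L only, so any common neighbour can
  -- take its place.
  have hRadj : ∀ u v, u ∈ I → u ∈ R → (SpectralTuran.cleaned G L).Adj u v →
      G.Adj (ψ u) (ψ v) := by
    intro u v huI hu huv
    have h1 := ((hRm u).1 hu).1
    have h2 : u ∉ S := fun h => hSR u h hu
    have h3 : v ∈ L := by rw [hadj] at huv; tauto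
    rw [hψ2 v fun h => ((hRm v).1 h).1 h3]
    exact (((hSm _).1 (hψS u (Finset.mem_inter.2 ⟨huI, hu⟩)).1).2 v h3).symm
  refine hG A hA ⟨⟨⟨fun a => ψ (f a), ?_⟩, ?_⟩⟩
  · intro a b hab
    have h : (SpectralTuran.cleaned G L).Adj (f a) (f b) := f.toHom.map_adj hab
    by_cases ha : f a ∈ R
    · exact hRadj _ _ (hfI a) ha h
    by_cases hb : f b ∈ R
    · exact (hRadj _ _ (hfI b) hb h.symm).symm
    rw [hψ2 _ ha, hψ2 _ hb]
    rw [hadj] at h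
    rcases h with (h | h) | h | h
    · exact ((hSm _).1 (hcover _ h.2 hb)).2 _ h.1
    · exact (((hSm _).1 (hcover _ h.1 ha)).2 _ h.2).symm
    · exact h.1
    · exact h.1
  · intro a b hab
    change ψ (f a) = ψ (f b) at hab
    apply f.injective
    change f a = f b
    by_cases ha : f a ∈ R <;> by_cases hb : f b ∈ R
    · have ha' := Finset.mem_inter.2 ⟨hfI a, ha⟩
      have hb' := Finset.mem_inter.2 ⟨hfI b, hb⟩
      rw [hψ1 _ ha', hψ1 _ hb', Subtype.coe_inj, g.apply_eq_iff_eq, Subtype.mk.injEq] at hab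
      exact hab
    · have ha' := Finset.mem_inter.2 ⟨hfI a, ha⟩
      rw [hψ2 _ hb] at hab
      exact absurd (hab ▸ hfI b) (hψS _ ha').2
    · have hb' := Finset.mem_inter.2 ⟨hfI b, hb⟩
      rw [hψ2 _ ha] at hab
      exact absurd (hab ▸ hfI a) (hψS _ hb').2
    · rwa [hψ2 _ ha, hψ2 _ hb] at hab

lemma IsPerron.congr {W : Type*} [Fintype W] {G : SimpleGraph V} {H : SimpleGraph W} (e : H ≃g G)
    {x : V → ℝ} (hx : IsPerron G x) : IsPerron H (x ∘ e) := by
  obtain ⟨z, hz⟩ := hx.exists_eq_one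
  have : Nonempty V := ⟨z⟩
  refine ⟨fun v => ?_, fun v => hx.nonneg _, fun v => hx.le_one _, e.symm z, by simpa using hz⟩
  rw [← lambdaMax_congr e.symm, Function.comp_apply, ← hx.eigen, nbrSum, nbrSum,
    ← e.toEquiv.sum_comp]
  refine Finset.sum_congr rfl fun u _ => ?_
  rw [ind_congr (u' := e v) (v' := e u) (e.map_adj_iff.symm)]
  rfl

/-- The neighbours of v in Y are common neighbours of v and the k vertices on the other side of the
join. -/
lemma NoBip.deg_le {W : Type*} [Fintype W] {k m : ℕ} {A : SimpleGraph (Fin k)}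
    {Y : SimpleGraph W} (h : NoBip k m (graphJoin A Y)) (v : W) : deg Y v ≤ m := by
  have h1 := h (insert (Sum.inr v) (Finset.univ.map Function.Embedding.inl))
    ((nb Y v).map Function.Embedding.inr) ?_ ?_
  · rw [Finset.card_map, card_nb] at h1
    exact h1.le
  · rw [Finset.card_insert_of_notMem (by simp), Finset.card_map, Finset.card_univ,
      Fintype.card_fin]
  · intro t ht s hs
    obtain ⟨u, hu, rfl⟩ := Finset.mem_map.1 hs
    rcases Finset.mem_insert.1 ht with rfl | ht
    · exact graphJoin_inr_inr.2 (mem_nb.1 hu)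
    · obtain ⟨i, -, rfl⟩ := Finset.mem_map.1 ht
      exact graphJoin_inl_inr

end Redirect

/-! ### Walk counts and the eigenvalue equation of a join. -/

section Walks

variable {W : Type*} [Fintype W]

/-- The number of walks with `i` edges starting at a vertex. -/
noncomputable def walk (Y : SimpleGraph W) : ℕ → W → ℝ
  | 0 => fun _ => 1
  | i + 1 => nbrSum Y (walk Y i)

/-- The total number of walks with `i` edges. -/
noncomputable def walkSum (Y : SimpleGraph W) (i : ℕ) : ℝ := ∑ v, walk Y i v

lemma nbrSum_nonneg (Y : SimpleGraph W) {f : W → ℝ} (hf : ∀ v, 0 ≤ f v) (v : W) :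
    0 ≤ nbrSum Y f v :=
  Finset.sum_nonneg fun u _ => mul_nonneg (ind_nonneg _ _ _) (hf u)

lemma walk_nonneg (Y : SimpleGraph W) (i : ℕ) (v : W) : 0 ≤ walk Y i v := by
  induction i generalizing v with
  | zero => exact zero_le_one
  | succ i ih => exact nbrSum_nonneg Y ih v

lemma walk_le {Y : SimpleGraph W} {D : ℕ} (hD : ∀ v, deg Y v ≤ D) (i : ℕ) (v : W) :
    walk Y i v ≤ (D : ℝ) ^ i := by
  induction i generalizing v with
  | zero => simp [walk]
  | succ i ih =>
    calc walk Y (i + 1) v = ∑ u, ind Y v u * walk Y i u := rfl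
      _ ≤ ∑ u, ind Y v u * (D : ℝ) ^ i := Finset.sum_le_sum fun u _ =>
          mul_le_mul_of_nonneg_left (ih u) (ind_nonneg _ _ _)
      _ = deg Y v * (D : ℝ) ^ i := by rw [← Finset.sum_mul, sum_ind_eq_deg]
      _ ≤ D * (D : ℝ) ^ i := by gcongr; exact_mod_cast hD v
      _ = _ := by ring

lemma walkSum_le {Y : SimpleGraph W} {D : ℕ} (hD : ∀ v, deg Y v ≤ D) (i : ℕ) :
    walkSum Y i ≤ Fintype.card W * (D : ℝ) ^ i := by
  calc walkSum Y i ≤ ∑ _v : W, (D : ℝ) ^ i := Finset.sum_le_sum fun v _ => walk_le hD i v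
    _ = _ := by simp

lemma walkSum_nonneg (Y : SimpleGraph W) (i : ℕ) : 0 ≤ walkSum Y i :=
  Finset.sum_nonneg fun v _ => walk_nonneg Y i v

lemma walk_one (Y : SimpleGraph W) (v : W) : walk Y 1 v = deg Y v := by
  simp [walk, nbrSum, sum_ind_eq_deg]

lemma walkSum_zero (Y : SimpleGraph W) : walkSum Y 0 = Fintype.card W := by
  simp [walkSum, walk]

lemma walkSum_one (Y : SimpleGraph W) : walkSum Y 1 = 2 * numEdges Y := by
  simp only [walkSum, walk_one, sum_deg_eq]

/-- A two-edge walk is an edge continued at one end, and symmetrising gives degree sums. Together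
with `walkSum_three` this makes the walk counts depend only on the degree pairs at the edges. -/
lemma walkSum_two (Y : SimpleGraph W) :
    2 * walkSum Y 2 = ∑ u, ∑ v, ind Y u v * ((deg Y u : ℝ) + deg Y v) := by
  have h1 : walkSum Y 2 = ∑ u, ∑ v, ind Y u v * (deg Y v : ℝ) := by
    refine Finset.sum_congr rfl fun u _ => Finset.sum_congr rfl fun v _ => ?_
    rw [walk_one]
  have h2 : walkSum Y 2 = ∑ u, ∑ v, ind Y u v * (deg Y u : ℝ) := by
    rw [h1, Finset.sum_comm]
    exact Finset.sum_congr rfl fun u _ => Finset.sum_congr rfl fun v _ => by rw [ind_comm]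
  simp only [mul_add, Finset.sum_add_distrib, ← h1, ← h2]
  ring

lemma walkSum_three (Y : SimpleGraph W) :
    walkSum Y 3 = ∑ u, ∑ v, ind Y u v * ((deg Y u : ℝ) * deg Y v) := by
  have h1 : walkSum Y 3 = ∑ v, walk Y 1 v * nbrSum Y (walk Y 1) v := by
    have h := sum_nbrSum_mul_comm Y (walk Y 2) (walk Y 0)
    have h' := sum_nbrSum_mul_comm Y (walk Y 1) (walk Y 1)
    rw [← h']
    simp only [walk, mul_one] at h
    exact h
  rw [h1]
  refine Finset.sum_congr rfl fun u _ => ?_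
  rw [nbrSum, Finset.mul_sum]
  refine Finset.sum_congr rfl fun v _ => ?_
  rw [walk_one, walk_one]; ring

variable {k : ℕ}

lemma nbrSum_graphJoin_inl {V : Type*} [Fintype V] (A : SimpleGraph V) (Y : SimpleGraph W)
    (x : V ⊕ W → ℝ) (i : V) : nbrSum (graphJoin A Y) x (Sum.inl i)
      = nbrSum A (x ∘ Sum.inl) i + ∑ v, x (Sum.inr v) := by
  simp only [nbrSum, Fintype.sum_sum_type, Function.comp_apply]
  congr 1
  · exact Finset.sum_congr rfl fun u _ => by rw [ind_congr graphJoin_inl_inl]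
  · exact Finset.sum_congr rfl fun u _ => by rw [ind_of_adj graphJoin_inl_inr, one_mul]

lemma nbrSum_graphJoin_inr {V : Type*} [Fintype V] (A : SimpleGraph V) (Y : SimpleGraph W)
    (x : V ⊕ W → ℝ) (v : W) : nbrSum (graphJoin A Y) x (Sum.inr v)
      = ∑ i, x (Sum.inl i) + nbrSum Y (x ∘ Sum.inr) v := by
  simp only [nbrSum, Fintype.sum_sum_type, Function.comp_apply]
  congr 1
  · exact Finset.sum_congr rfl fun u _ => by rw [ind_of_adj graphJoin_inr_inl, one_mul]
  · exact Finset.sum_congr rfl fun u _ => by rw [ind_congr graphJoin_inr_inr]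

lemma nbrSum_top (x : Fin k → ℝ) (i : Fin k) :
    nbrSum (⊤ : SimpleGraph (Fin k)) x i = ∑ j, x j - x i := by
  classical
  have : ∀ j, ind (⊤ : SimpleGraph (Fin k)) i j * x j = x j - if i = j then x j else 0 := by
    intro j
    by_cases h : i = j <;> simp [ind, h]
  simp [nbrSum, this]

/-- The contribution of walks with at most three edges to the characteristic equation of a
join. -/
noncomputable def walkPoly (Y : SimpleGraph W) (l : ℝ) : ℝ :=
  l ^ 3 * walkSum Y 0 + l ^ 2 * walkSum Y 1 + l * walkSum Y 2 + walkSum Y 3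

/-- Rayleigh bound with a test vector equal to 1 on the clique and to a truncated solution of the
eigenvalue equation on X. Truncation only errs in the favourable direction, since walk counts are
nonnegative. -/
lemma walkPoly_le_of_lambdaMax_le (hk : 1 ≤ k) (X : SimpleGraph W) {l : ℝ} (hl : 0 < l)
    (hX : lambdaMax (cliqueJoin k X) ≤ l) : k * walkPoly X l ≤ l ^ 4 * (l - (k - 1)) := by
  have hk' : (0 : ℝ) < k := by exact_mod_cast hk
  have : Nonempty (Fin k ⊕ W) := ⟨Sum.inl ⟨0, hk⟩⟩
  -- The first four terms of the series k Σ A^i 1 / l^{i+1}, which formally solves ly = k + Ay with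
  -- A the adjacency matrix of X.
  obtain ⟨y, hy⟩ : ∃ y : W → ℝ, y = fun v => k / l ^ 4 *
    (l ^ 3 * walk X 0 v + l ^ 2 * walk X 1 v + l * walk X 2 v + walk X 3 v) := ⟨_, rfl⟩
  have hy0 : ∀ v, 0 ≤ y v := fun v => by
    have h0 := walk_nonneg X 0 v
    have h1 := walk_nonneg X 1 v
    have h2 := walk_nonneg X 2 v
    have h3 := walk_nonneg X 3 v
    rw [hy]; positivity
  have hysum : ∑ v, y v = k / l ^ 4 * walkPoly X l := by
    rw [hy, ← Finset.mul_sum]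
    simp only [Finset.sum_add_distrib, ← Finset.mul_sum]
    rfl
  have hAy : ∀ v, nbrSum X y v = k / l ^ 4 *
      (l ^ 3 * walk X 1 v + l ^ 2 * walk X 2 v + l * walk X 3 v + walk X 4 v) := by
    intro v
    simp only [nbrSum, hy, walk, mul_add, Finset.mul_sum, ← Finset.sum_add_distrib]
    exact Finset.sum_congr rfl fun u _ => by ring_nf
  have hle : ∀ v, l * y v ≤ k + nbrSum X y v := by
    intro v
    have h4 := walk_nonneg X 4 v
    have h5 : k + nbrSum X y v - l * y v = k / l ^ 4 * walk X 4 v := by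
      rw [hAy]
      simp only [hy]
      have : walk X 0 v = 1 := rfl
      rw [this]
      field_simp
      ring
    have : 0 ≤ k / l ^ 4 * walk X 4 v := by positivity
    linarith
  obtain ⟨z, hz⟩ : ∃ z : Fin k ⊕ W → ℝ, z = Sum.elim (fun _ => 1) y := ⟨_, rfl⟩
  have hQ : quadForm (cliqueJoin k X) z
      = k * (k - 1 + ∑ v, y v) + ∑ v, y v * (k + nbrSum X y v) := by
    rw [quadForm_eq_sum_mul_nbrSum, Fintype.sum_sum_type]
    simp only [nbrSum_graphJoin_inl, nbrSum_graphJoin_inr]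
    have e1 : z ∘ Sum.inl = fun _ => 1 := by rw [hz]; rfl
    have e2 : z ∘ Sum.inr = y := by rw [hz]; rfl
    rw [e1, e2]
    simp [hz, nbrSum_top]
    ring
  have hz2 : ∑ v, z v ^ 2 = k + ∑ v, y v ^ 2 := by
    rw [Fintype.sum_sum_type]; simp [hz]
  have h1 := quadForm_le (cliqueJoin k X) z
  have h2 : lambdaMax (cliqueJoin k X) * ∑ v, z v ^ 2 ≤ l * ∑ v, z v ^ 2 :=
    mul_le_mul_of_nonneg_right hX (Finset.sum_nonneg fun v _ => sq_nonneg _)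
  have h3 : l * ∑ v, y v ^ 2 ≤ ∑ v, y v * (k + nbrSum X y v) := by
    rw [Finset.mul_sum]
    refine Finset.sum_le_sum fun v _ => ?_
    calc l * y v ^ 2 = y v * (l * y v) := by ring
      _ ≤ _ := mul_le_mul_of_nonneg_left (hle v) (hy0 v)
  rw [hQ] at h1
  rw [hz2] at h1 h2
  have h4 : k * (k - 1 + ∑ v, y v) ≤ k * l := by linarith
  have h5 := le_of_mul_le_mul_left h4 hk'
  have h6 : k * walkPoly X l = l ^ 4 * ∑ v, y v := by rw [hysum]; field_simp
  rw [h6]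
  refine mul_le_mul_of_nonneg_left ?_ (by positivity)
  linarith

/-- Pairing the equation ly = s + Yy with the walk vectors gives an exact expansion of l⁴ Σ y with a
remainder in four-edge walks. The remainder is at most D⁴ Σ y, and kΣy ≤ ls. The parameter τ records
what is lost when A is not complete. -/
lemma le_walkPoly_of_isPerron (hk : 1 ≤ k) {A : SimpleGraph (Fin k)} {Y : SimpleGraph W}
    {x : Fin k ⊕ W → ℝ} (hx : IsPerron (graphJoin A Y) x) (hl : 0 < lambdaMax (graphJoin A Y))
    (hL : ∀ i, 1 / 2 ≤ x (Sum.inl i)) {D : ℕ} (hD : ∀ v, deg Y v ≤ D) {τ : ℝ}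
    (hτ : ∑ i, nbrSum A (x ∘ Sum.inl) i ≤ (k - 1 - τ) * ∑ i, x (Sum.inl i)) :
    lambdaMax (graphJoin A Y) ^ 4 * (lambdaMax (graphJoin A Y) + τ - (k - 1))
      ≤ k * walkPoly Y (lambdaMax (graphJoin A Y)) + D ^ 4 * lambdaMax (graphJoin A Y) := by
  obtain ⟨l, hldef⟩ : ∃ l, l = lambdaMax (graphJoin A Y) := ⟨_, rfl⟩
  obtain ⟨s, hs⟩ : ∃ s, s = ∑ i, x (Sum.inl i) := ⟨_, rfl⟩
  obtain ⟨y, hy⟩ : ∃ y : W → ℝ, y = x ∘ Sum.inr := ⟨_, rfl⟩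
  have heig := hx.eigen
  rw [← hldef] at hl heig ⊢
  rw [← hs] at hτ
  have hk' : (0 : ℝ) < k := by exact_mod_cast hk
  have hs0 : 0 < s := by
    rw [hs]
    have : Nonempty (Fin k) := ⟨⟨0, hk⟩⟩
    exact Finset.sum_pos (fun i _ => by linarith [hL i]) Finset.univ_nonempty
  have hy0 : ∀ v, 0 ≤ y v := fun v => by rw [hy]; exact hx.nonneg _
  have hY : ∀ v, l * y v = s + nbrSum Y y v := by
    intro v
    have := heig (Sum.inr v)
    rw [nbrSum_graphJoin_inr, ← hs, ← hy] at this
    rw [this, hy]; rfl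
  have hsum : ∀ i, l * ∑ v, walk Y i v * y v
      = s * walkSum Y i + ∑ v, walk Y (i + 1) v * y v := by
    intro i
    have h1 : ∑ v, walk Y (i + 1) v * y v = ∑ v, walk Y i v * nbrSum Y y v :=
      sum_nbrSum_mul_comm Y (walk Y i) y
    rw [h1, walkSum, Finset.mul_sum, Finset.mul_sum, ← Finset.sum_add_distrib]
    refine Finset.sum_congr rfl fun v _ => ?_
    calc l * (walk Y i v * y v) = walk Y i v * (l * y v) := by ring
      _ = _ := by rw [hY]; ring
  have h0 := hsum 0
  have h1 := hsum 1
  have h2 := hsum 2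
  have h3 := hsum 3
  have hy1 : ∑ v, walk Y 0 v * y v = ∑ v, y v := by simp [walk]
  rw [hy1] at h0
  have h4 : l ^ 4 * ∑ v, y v = s * walkPoly Y l + ∑ v, walk Y 4 v * y v := by
    calc l ^ 4 * ∑ v, y v = l ^ 3 * (l * ∑ v, y v) := by ring
      _ = l ^ 3 * s * walkSum Y 0 + l ^ 2 * (l * ∑ v, walk Y 1 v * y v) := by rw [h0]; ring
      _ = l ^ 3 * s * walkSum Y 0 + l ^ 2 * s * walkSum Y 1
          + l * (l * ∑ v, walk Y 2 v * y v) := by rw [h1]; ring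
      _ = l ^ 3 * s * walkSum Y 0 + l ^ 2 * s * walkSum Y 1 + l * s * walkSum Y 2
          + l * ∑ v, walk Y 3 v * y v := by rw [h2]; ring
      _ = _ := by rw [h3, walkPoly]; ring
  have h5 : ∑ v, walk Y 4 v * y v ≤ D ^ 4 * ∑ v, y v := by
    rw [Finset.mul_sum]
    exact Finset.sum_le_sum fun v _ => mul_le_mul_of_nonneg_right (walk_le hD 4 v) (hy0 v)
  have h6 : l * s = ∑ i, nbrSum A (x ∘ Sum.inl) i + k * ∑ v, y v := by
    rw [hs, Finset.mul_sum]
    have : ∀ i, l * x (Sum.inl i) = nbrSum A (x ∘ Sum.inl) i + ∑ v, y v := by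
      intro i
      rw [← heig, nbrSum_graphJoin_inl, hy]; rfl
    simp [this, Finset.sum_add_distrib]
  have h7 : 0 ≤ ∑ i, nbrSum A (x ∘ Sum.inl) i :=
    Finset.sum_nonneg fun i _ => nbrSum_nonneg A (fun j => hx.nonneg _) i
  have h8 : k * ∑ v, y v ≤ l * s := by linarith
  have h9 : (l ^ 4 * (l + τ - (k - 1))) * s ≤ (k * walkPoly Y l + D ^ 4 * l) * s := by
    calc (l ^ 4 * (l + τ - (k - 1))) * s = l ^ 4 * (l * s - (k - 1 - τ) * s) := by ring
      _ ≤ l ^ 4 * (k * ∑ v, y v) := by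
        refine mul_le_mul_of_nonneg_left ?_ (by positivity)
        linarith
      _ = k * (s * walkPoly Y l + ∑ v, walk Y 4 v * y v) := by rw [← h4]; ring
      _ ≤ k * (s * walkPoly Y l + D ^ 4 * ∑ v, y v) := by gcongr
      _ = k * s * walkPoly Y l + D ^ 4 * (k * ∑ v, y v) := by ring
      _ ≤ k * s * walkPoly Y l + D ^ 4 * (l * s) := by gcongr
      _ = _ := by ring
  exact le_of_mul_le_mul_right h9 hs0

lemma sum_nbrSum_le (A : SimpleGraph (Fin k)) {x : Fin k → ℝ} (hx : ∀ i, 0 ≤ x i) :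
    ∑ i, nbrSum A x i ≤ (k - 1) * ∑ i, x i := by
  calc ∑ i, nbrSum A x i ≤ ∑ i, nbrSum ⊤ x i :=
        Finset.sum_le_sum fun i _ => Finset.sum_le_sum fun j _ =>
          mul_le_mul_of_nonneg_right (ind_mono le_top i j) (hx j)
    _ = _ := by
      simp only [nbrSum_top, Finset.sum_sub_distrib]
      simp
      ring

/-- A single missing edge costs at least 1/2 in total, and the total weight is at most k, whence the
relative loss 1/(2k). -/
lemma sum_nbrSum_le_of_ne_top (hk : 1 ≤ k) {A : SimpleGraph (Fin k)} (hA : A ≠ ⊤)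
    {x : Fin k → ℝ} (hx : ∀ i, 1 / 2 ≤ x i) (hx1 : ∀ i, x i ≤ 1) :
    ∑ i, nbrSum A x i ≤ (k - 1 - 1 / (2 * k)) * ∑ i, x i := by
  have hk' : (0 : ℝ) < k := by exact_mod_cast hk
  obtain ⟨a, b, hab, hnadj⟩ := SimpleGraph.ne_top_iff_exists_not_adj.1 hA
  have h1 : ∑ i, nbrSum A x i + 1 / 2 ≤ ∑ i, nbrSum ⊤ x i := by
    have hle : ∀ i j, ind A i j * x j ≤ ind ⊤ i j * x j := fun i j =>
      mul_le_mul_of_nonneg_right (ind_mono le_top i j) (by linarith [hx j])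
    have hstrict : nbrSum A x a + 1 / 2 ≤ nbrSum ⊤ x a := by
      unfold nbrSum
      rw [← Finset.add_sum_erase _ _ (Finset.mem_univ b),
        ← Finset.add_sum_erase _ (fun u => ind ⊤ a u * x u) (Finset.mem_univ b)]
      rw [ind_of_not_adj hnadj, ind_of_adj (show (⊤ : SimpleGraph (Fin k)).Adj a b from hab)]
      have := Finset.sum_le_sum (s := Finset.univ.erase b) fun j _ => hle a j
      linarith [hx b]
    rw [← Finset.add_sum_erase _ _ (Finset.mem_univ a),
      ← Finset.add_sum_erase _ (nbrSum ⊤ x) (Finset.mem_univ a)]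
    have : ∑ i ∈ Finset.univ.erase a, nbrSum A x i ≤ ∑ i ∈ Finset.univ.erase a, nbrSum ⊤ x i :=
      Finset.sum_le_sum fun i _ => Finset.sum_le_sum fun j _ => hle i j
    linarith
  have h2 : ∑ i, nbrSum ⊤ x i = (k - 1) * ∑ i, x i := by
    simp only [nbrSum_top, Finset.sum_sub_distrib]
    simp
    ring
  have h3 : ∑ i, x i ≤ k := by
    calc ∑ i, x i ≤ ∑ _i : Fin k, (1 : ℝ) := Finset.sum_le_sum fun i _ => hx1 i
      _ = k := by simp
  have h4 : 1 / (2 * (k : ℝ)) * ∑ i, x i ≤ 1 / 2 := by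
    calc 1 / (2 * (k : ℝ)) * ∑ i, x i ≤ 1 / (2 * k) * k := by gcongr
      _ = 1 / 2 := by field_simp
  linarith

end Walks

/-! ### Comparison of walk counts for finite families. -/

section FiniteFamily

open scoped Classical

/-- Comparison of `K_k + X` with a join `A + Y` of at least the same spectral radius. -/
lemma walk_comparison {W : Type*} [Fintype W] {k : ℕ} (hk : 1 ≤ k) {A : SimpleGraph (Fin k)}
    {X Y : SimpleGraph W} {x : Fin k ⊕ W → ℝ} (hx : IsPerron (graphJoin A Y) x) {l : ℝ}
    (hldef : l = lambdaMax (graphJoin A Y)) (hl : 0 < l)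
    (hL : ∀ i, 1 / 2 ≤ x (Sum.inl i)) {D : ℕ} (hD : ∀ v, deg Y v ≤ D) {τ : ℝ}
    (hτ : ∑ i, nbrSum A (x ∘ Sum.inl) i ≤ (k - 1 - τ) * ∑ i, x (Sum.inl i))
    (hX : lambdaMax (cliqueJoin k X) ≤ l) :
    k * (l ^ 2 * walkSum X 1 + l * walkSum X 2 + walkSum X 3) + τ * l ^ 4
      ≤ k * (l ^ 2 * walkSum Y 1 + l * walkSum Y 2 + walkSum Y 3) + D ^ 4 * l := by
  have h1 := walkPoly_le_of_lambdaMax_le hk X hl hX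
  have h2 := le_walkPoly_of_isPerron hk hx (hldef ▸ hl) hL hD hτ
  rw [← hldef] at h2
  rw [walkPoly, walkSum_zero] at h1 h2
  linarith

/-- A missing core edge costs a term of order l⁴. What Y can gain is only of order l³: its edge
excess is at most the number of edges of K_k, and its longer walks number O(n) = O(l²). -/
lemma eq_top_of_walk_comparison {W : Type*} [Fintype W] {k n : ℕ} (hk : 1 ≤ k)
    {A : SimpleGraph (Fin k)} {X Y : SimpleGraph W} {x : Fin k ⊕ W → ℝ}
    (hx : IsPerron (graphJoin A Y) x) {l : ℝ}
    (hldef : l = lambdaMax (graphJoin A Y)) (hl : 1 ≤ l)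
    (hL : ∀ i, 1 / 2 ≤ x (Sum.inl i)) {D : ℕ} (hD : ∀ v, deg Y v ≤ D)
    (hX : lambdaMax (cliqueJoin k X) ≤ l) (hWn : Fintype.card W ≤ n) (hn : (n : ℝ) ≤ 2 * l ^ 2)
    (hbig : 2 * k * ((k : ℝ) ^ 3 + 2 * k * D ^ 2 + 2 * k * D ^ 3 + D ^ 4) < l)
    (he : numEdges A + numEdges Y ≤ numEdges (⊤ : SimpleGraph (Fin k)) + numEdges X) : A = ⊤ := by
  by_contra hA
  have hk' : (0 : ℝ) < k := by exact_mod_cast hk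
  have h1 := walk_comparison hk hx hldef (by linarith) hL hD
    (sum_nbrSum_le_of_ne_top hk hA hL fun i => hx.le_one _) hX
  have h2 := two_mul_numEdges_top k
  have h3 : (numEdges A : ℝ) + numEdges Y ≤ numEdges (⊤ : SimpleGraph (Fin k)) + numEdges X := by
    exact_mod_cast he
  have h4 : walkSum Y 1 ≤ walkSum X 1 + k ^ 2 := by
    rw [walkSum_one, walkSum_one]
    have : (0 : ℝ) ≤ numEdges A := Nat.cast_nonneg _
    linarith
  have hW : (Fintype.card W : ℝ) ≤ 2 * l ^ 2 := le_trans (by exact_mod_cast hWn) hn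
  have h5 : walkSum Y 2 ≤ 2 * l ^ 2 * D ^ 2 := (walkSum_le hD 2).trans (by gcongr)
  have h6 : walkSum Y 3 ≤ 2 * l ^ 2 * D ^ 3 := (walkSum_le hD 3).trans (by gcongr)
  have h7 := walkSum_nonneg X 2
  have h8 := walkSum_nonneg X 3
  have h9 : 1 / (2 * (k : ℝ)) * l ^ 4
      ≤ k * (l ^ 2 * k ^ 2 + l * (2 * l ^ 2 * D ^ 2) + 2 * l ^ 2 * D ^ 3) + D ^ 4 * l := by
    have e1 : k * (l ^ 2 * walkSum Y 1 + l * walkSum Y 2 + walkSum Y 3) ≤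
      k * (l ^ 2 * (walkSum X 1 + k ^ 2) + l * (2 * l ^ 2 * D ^ 2) + 2 * l ^ 2 * D ^ 3) := by
      gcongr
    have e2 : 0 ≤ k * (l * walkSum X 2 + walkSum X 3) := by positivity
    linarith
  have h10 : l ^ 2 ≤ l ^ 3 := pow_le_pow_right₀ hl (by norm_num)
  have h11 : l ≤ l ^ 3 := le_self_pow₀ hl (by norm_num)
  have h12 : 1 / (2 * (k : ℝ)) * l ^ 4
      ≤ l ^ 3 * ((k : ℝ) ^ 3 + 2 * k * D ^ 2 + 2 * k * D ^ 3 + D ^ 4) := by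
    refine h9.trans ?_
    have e1 : k * (l ^ 2 * k ^ 2 + l * (2 * l ^ 2 * D ^ 2) + 2 * l ^ 2 * D ^ 3) + D ^ 4 * l
      ≤ k * (l ^ 3 * k ^ 2 + l * (2 * l ^ 2 * D ^ 2) + 2 * l ^ 3 * D ^ 3) + D ^ 4 * l ^ 3 := by
      gcongr
    refine e1.trans (le_of_eq ?_)
    ring
  have h13 : l ^ 3 * l ≤ l ^ 3 *
      (2 * k * ((k : ℝ) ^ 3 + 2 * k * D ^ 2 + 2 * k * D ^ 3 + D ^ 4)) := by
    calc l ^ 3 * l = 2 * k * (1 / (2 * (k : ℝ)) * l ^ 4) := by field_simp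
      _ ≤ 2 * k * (l ^ 3 * ((k : ℝ) ^ 3 + 2 * k * D ^ 2 + 2 * k * D ^ 3 + D ^ 4)) := by gcongr
      _ = _ := by ring
  have h14 := le_of_mul_le_mul_left h13 (by positivity)
  linarith

/-- For a finite family, the spectral extremal graphs are joins `K_k + Y` with `Y` of bounded
degree, and the walk counts of `Y` compare to those of `X`. -/
theorem exists_degree_bound_and_join {F : GraphFamily} {k : ℕ} (hk : 1 ≤ k)
    (hex : (fun n : ℕ => (ex F n : ℝ)) =O[atTop] (fun n : ℕ => (n : ℝ)))
    (hK : ¬ FamilyFree F (completeBipartiteGraph (Fin (k + 1)) ℕ)) (hF : F.Finite) :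
    ∃ D : ℕ, ∀ X : ∀ n : ℕ, SimpleGraph (Fin (n - k)),
      (∀ᶠ n : ℕ in atTop, MemUpToIso (cliqueJoin k (X n)) (EXContaining (Kbip k (n - k)) F n)) →
      ∀ K : ℝ, ∀ᶠ n : ℕ in atTop, (∀ v, deg (X n) v ≤ D) ∧ ∀ G ∈ SPEX F n,
        ∃ Y : SimpleGraph (Fin (n - k)), Nonempty (G ≃g cliqueJoin k Y) ∧ (∀ v, deg Y v ≤ D) ∧
          ∃ l : ℝ, K ≤ l ∧ 1 ≤ l ∧ (n : ℝ) ≤ 2 * l ^ 2 ∧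
          k * (l ^ 2 * walkSum (X n) 1 + l * walkSum (X n) 2 + walkSum (X n) 3)
            ≤ k * (l ^ 2 * walkSum Y 1 + l * walkSum Y 2 + walkSum Y 3) + D ^ 4 * l := by
  obtain ⟨C, hC, hS⟩ := exists_sparse hex
  obtain ⟨D, hB⟩ := exists_noBip hK
  refine ⟨D, fun X hX K => ?_⟩
  obtain ⟨r, hr⟩ : ∃ r, ∀ A ∈ F, A.1 ≤ r := by
    obtain ⟨r, hr⟩ := (hF.image Sigma.fst).bddAbove
    exact ⟨r, fun A hA => hr ⟨A, hA, rfl⟩⟩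
  obtain ⟨ε, hεdef⟩ : ∃ ε, ε = 1 / (4 + 2 * (D : ℝ) + 4 * C) := ⟨_, rfl⟩
  have hpos : 0 < 4 + 2 * (D : ℝ) + 4 * C := by positivity
  have hε : 0 < ε := by rw [hεdef]; positivity
  have hε1 : ε ≤ 1 / 2 := by
    rw [hεdef]
    apply one_div_le_one_div_of_le (by norm_num)
    have : (0 : ℝ) ≤ D := by positivity
    linarith
  have hε2 : ε * (2 + 2 * D + 4 * C) ≤ 1 := by
    rw [hεdef, div_mul_eq_mul_div, one_mul, div_le_one hpos]
    linarith
  -- The last entry is the threshold above which `eq_top_of_walk_comparison` applies.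
  obtain ⟨K', hK'⟩ : ∃ K' : ℝ, K' = max 1 (max K
    (2 * k * ((k : ℝ) ^ 3 + 2 * k * D ^ 2 + 2 * k * D ^ 3 + D ^ 4) + 1)) := ⟨_, rfl⟩
  have hK1 : 1 ≤ K' := hK' ▸ le_max_left _ _
  have hK2 : K ≤ K' := hK' ▸ (le_max_left _ _).trans (le_max_right _ _)
  have hK3 : 2 * k * ((k : ℝ) ^ 3 + 2 * k * D ^ 2 + 2 * k * D ^ 3 + D ^ 4) + 1 ≤ K' :=
    hK' ▸ (le_max_right _ _).trans (le_max_right _ _)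
  have e1 : ∀ᶠ n : ℕ in atTop, 2 * ((k : ℝ) + r) ≤ n :=
    tendsto_natCast_atTop_atTop.eventually_ge_atTop _
  filter_upwards [eventually_exists_isCore hk hC hS hB hε K', hX, eventually_gt_atTop 0, e1] with
    n hcore ⟨H₀, hH₀, ⟨isoH₀⟩⟩ hn hn1
  have hne : Nonempty (Fin n) := ⟨⟨0, hn⟩⟩
  have hne' : Nonempty (Fin k ⊕ Fin (n - k)) := ⟨Sum.inl ⟨0, hk⟩⟩
  refine ⟨fun v => ((hB _ H₀ hH₀.1.1).congr isoH₀).deg_le v, fun G hG => ?_⟩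
  obtain ⟨x, L, hL, hKl, hl0, hnl⟩ := hcore G hG ⟨H₀, hH₀.1⟩
  have hScard : r ≤ (commonNb G L).card := by
    have h1 := hL.le_card_commonNb hε1
    rw [Fintype.card_fin] at h1
    have : (r : ℝ) ≤ (commonNb G L).card := by linarith
    exact_mod_cast this
  have hfree : FamilyFree F (cleaned G L) :=
    hG.1.cleaned fun A hA => (hr A hA).trans hScard
  have hR := hL.exceptional_eq_empty hε.le hε2 hε1 (H := cleaned G L) le_sup_left le_rfl
    (hG.2 _ hfree)
  have hGc : crossOn L ≤ G := by
    rw [← cleaned_eq_of_exceptional_eq_empty hR]; exact le_sup_left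
  obtain ⟨e, he1, he2⟩ := exists_split_equiv hL.card (Fintype.card_fin n)
  obtain ⟨A, hA⟩ : ∃ A, A = G.comap (e ∘ Sum.inl) := ⟨_, rfl⟩
  obtain ⟨Y, hY⟩ : ∃ Y, Y = G.comap (e ∘ Sum.inr) := ⟨_, rfl⟩
  obtain ⟨iso, hiso⟩ : ∃ iso : graphJoin A Y ≃g G, ∀ i, iso i = e i := by
    rw [hA, hY]
    exact ⟨graphJoinIso e he1 he2 hGc, fun _ => rfl⟩
  have hx := hL.perron.congr iso
  have hldef : lambdaMax G = lambdaMax (graphJoin A Y) := lambdaMax_congr iso.symm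
  have hDY : ∀ v, deg Y v ≤ D := (hL.noBip.congr iso.symm).deg_le
  have hxL : ∀ i, 1 / 2 ≤ (x ∘ iso) (Sum.inl i) := by
    intro i
    rw [Function.comp_apply, hiso]
    have := hL.heavy _ (he1 i)
    linarith
  have hXl : lambdaMax (cliqueJoin k (X n)) ≤ lambdaMax G :=
    lambdaMax_le_of_mem_SPEX hG hH₀.1.1 isoH₀
  have hedges : numEdges A + numEdges Y ≤ numEdges (⊤ : SimpleGraph (Fin k)) + numEdges (X n) := by
    have h1 := hH₀.2 G hG.1 ((SimpleGraph.IsContained.of_le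
      (completeBipartiteGraph_le_graphJoin A Y)).trans iso.isContained)
    rw [numEdges_congr isoH₀, ← numEdges_congr iso, numEdges_graphJoin, numEdges_graphJoin] at h1
    omega
  have hAtop : A = ⊤ := eq_top_of_walk_comparison (n := n) hk hx hldef (by linarith) hxL hDY hXl
    (by simp) hnl (by linarith) hedges
  have hcomp := walk_comparison (τ := 0) hk hx hldef hl0 hxL hDY
    (by rw [sub_zero]; exact sum_nbrSum_le A fun i => hx.nonneg _) hXl
  rw [zero_mul, add_zero] at hcomp
  rw [hAtop] at iso
  exact ⟨Y, ⟨iso.symm⟩, hDY, lambdaMax G, by linarith, by linarith, hnl, hcomp⟩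

/-- Divide the comparison by l². The walk terms of Y are then O(n/l) + O(n/l²) + O(1/l), hence
O(√n), because l is at least of order √n. -/
theorem exists_join_of_mem_SPEX {F : GraphFamily} {k : ℕ} (hk : 1 ≤ k)
    (hex : (fun n : ℕ => (ex F n : ℝ)) =O[atTop] (fun n : ℕ => (n : ℝ)))
    (hK : ¬ FamilyFree F (completeBipartiteGraph (Fin (k + 1)) ℕ)) (hF : F.Finite) :
    ∃ D : ℕ, ∀ X : ∀ n : ℕ, SimpleGraph (Fin (n - k)),
      (∀ᶠ n : ℕ in atTop, MemUpToIso (cliqueJoin k (X n)) (EXContaining (Kbip k (n - k)) F n)) →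
      ∃ C : ℝ, ∀ᶠ n : ℕ in atTop, ∀ G ∈ SPEX F n,
        ∃ Y : SimpleGraph (Fin (n - k)), Nonempty (G ≃g cliqueJoin k Y) ∧
          (numEdges (X n) : ℝ) - C * Real.sqrt n ≤ numEdges Y ∧ ∀ v, deg Y v ≤ D := by
  obtain ⟨D, hD⟩ := exists_degree_bound_and_join hk hex hK hF
  refine ⟨D, fun X hX => ⟨2 * D ^ 2 + 2 * D ^ 3 + D ^ 4, ?_⟩⟩
  filter_upwards [hD X hX 1, eventually_gt_atTop 0] with n ⟨_, h⟩ hn G hG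
  obtain ⟨Y, hiso, hY, l, -, hl1, hnl, hcomp⟩ := h G hG
  refine ⟨Y, hiso, ?_, hY⟩
  have hk1 : (1 : ℝ) ≤ k := by exact_mod_cast hk
  have hk' : (0 : ℝ) < k := by linarith
  have hl : 0 < l := by linarith
  have hW : (Fintype.card (Fin (n - k)) : ℝ) ≤ n := by
    rw [Fintype.card_fin]; exact_mod_cast Nat.sub_le _ _
  obtain ⟨q, hq⟩ : ∃ q, q = Real.sqrt n := ⟨_, rfl⟩
  have hqn : q ^ 2 = n := by rw [hq, Real.sq_sqrt (Nat.cast_nonneg n)]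
  have hq1 : 1 ≤ q := by
    rw [hq, Real.one_le_sqrt]; exact_mod_cast hn
  have hql : q ≤ 2 * l := by
    have : q ^ 2 ≤ (2 * l) ^ 2 := by rw [hqn]; linarith [sq_nonneg l]
    exact le_of_sq_le_sq this (by linarith)
  have hnl' : (n : ℝ) ≤ 2 * l * q := by
    rw [← hqn, sq]; gcongr
  have h2 : walkSum Y 2 ≤ (2 * l * q) * D ^ 2 := (walkSum_le hY 2).trans (by
    gcongr; exact hW.trans hnl')
  have h3 : walkSum Y 3 ≤ (2 * l ^ 2) * D ^ 3 := (walkSum_le hY 3).trans (by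
    gcongr; exact hW.trans hnl)
  have h4 := walkSum_nonneg (X n) 2
  have h5 := walkSum_nonneg (X n) 3
  rw [walkSum_one, walkSum_one] at hcomp
  have h6 : k * l ^ 2 * (2 * numEdges (X n) : ℝ) ≤ k * l ^ 2 * (2 * numEdges Y
      + (2 * D ^ 2 + 2 * D ^ 3 + D ^ 4) * q) := by
    have e1 : (D : ℝ) ^ 4 * l ≤ k * l ^ 2 * (D ^ 4 * q) := by
      have : 1 * l * 1 ≤ k * l ^ 2 * q := by
        gcongr
        exact le_self_pow₀ hl1 (by norm_num)
      calc (D : ℝ) ^ 4 * l = D ^ 4 * (1 * l * 1) := by ring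
        _ ≤ D ^ 4 * (k * l ^ 2 * q) := by gcongr
        _ = _ := by ring
    have e2 : k * (l * walkSum Y 2) ≤ k * (l * ((2 * l * q) * D ^ 2)) := by gcongr
    have e3 : k * walkSum Y 3 ≤ k * ((2 * l ^ 2) * D ^ 3 * q) := by
      gcongr
      refine h3.trans (le_mul_of_one_le_right (by positivity) hq1)
    have e4 : 0 ≤ k * (l * walkSum (X n) 2 + walkSum (X n) 3) := by positivity
    linarith
  have h7 := le_of_mul_le_mul_left h6 (by positivity)
  rw [← hq]
  have h8 : 0 ≤ ((2 : ℝ) * D ^ 2 + 2 * D ^ 3 + D ^ 4) * q := by positivity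
  linarith

/-- If the walk counts of competitors `Y` with fewer edges do not exceed those of `X` by more than
a constant, then spectral extremal graphs are edge extremal. -/
theorem SPEX_subset_of_walkSum_le {F : GraphFamily} {k : ℕ} (hk : 1 ≤ k)
    (hex : (fun n : ℕ => (ex F n : ℝ)) =O[atTop] (fun n : ℕ => (n : ℝ)))
    (hK : ¬ FamilyFree F (completeBipartiteGraph (Fin (k + 1)) ℕ)) (hF : F.Finite)
    {X : ∀ n : ℕ, SimpleGraph (Fin (n - k))}
    (hX : ∀ᶠ n : ℕ in atTop,
      MemUpToIso (cliqueJoin k (X n)) (EXContaining (Kbip k (n - k)) F n))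
    (hwalk : ∀ D : ℕ, ∃ K : ℝ, ∀ᶠ n : ℕ in atTop, (∀ v, deg (X n) v ≤ D) →
      FamilyFree F (cliqueJoin k (X n)) → ∀ Y : SimpleGraph (Fin (n - k)), (∀ v, deg Y v ≤ D) →
      FamilyFree F (cliqueJoin k Y) → numEdges Y ≤ numEdges (X n) →
      walkSum Y 2 ≤ walkSum (X n) 2 + K ∧ walkSum Y 3 ≤ walkSum (X n) 3 + K) :
    ∀ᶠ n : ℕ in atTop, SPEX F n ⊆ EXContaining (cliqueJoinEmpty k n) F n := by
  obtain ⟨D, hD⟩ := exists_degree_bound_and_join hk hex hK hF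
  obtain ⟨K₀, hK₀⟩ := hwalk D
  obtain ⟨K, hKdef⟩ : ∃ K, K = |K₀| := ⟨_, rfl⟩
  have hK0 : 0 ≤ K := hKdef ▸ abs_nonneg _
  have hKK : K₀ ≤ K := hKdef ▸ le_abs_self _
  have hk1 : (1 : ℝ) ≤ k := by exact_mod_cast hk
  -- If Y had fewer edges than X, the comparison would give 2kl² ≤ kKl + kK + D⁴l, hence 2kl ≤ 2kK +
  -- D⁴, contrary to this lower bound on l.
  filter_upwards [hD X hX (2 * k * K + D ^ 4 + 1), hK₀, hX] with n ⟨hXD, h⟩ hw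
    ⟨H₀, hH₀, ⟨isoH₀⟩⟩ G hG
  obtain ⟨Y, ⟨iso⟩, hY, l, hKl, hl1, -, hcomp⟩ := h G hG
  have hXfree : FamilyFree F (cliqueJoin k (X n)) := hH₀.1.1.congr isoH₀
  have hYfree : FamilyFree F (cliqueJoin k Y) := hG.1.congr iso
  have hbip : ∀ Z : SimpleGraph (Fin (n - k)), (Kbip k (n - k)).IsContained (cliqueJoin k Z) :=
    fun Z => SimpleGraph.IsContained.of_le (completeBipartiteGraph_le_graphJoin _ _)
  have hYX : numEdges Y ≤ numEdges (X n) := by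
    have h1 := hH₀.2 G hG.1 ((hbip Y).trans iso.symm.isContained)
    rw [numEdges_congr isoH₀, numEdges_congr iso, numEdges_graphJoin, numEdges_graphJoin] at h1
    omega
  have hXY : numEdges (X n) ≤ numEdges Y := by
    by_contra! hlt
    obtain ⟨h2, h3⟩ := hw hXD hXfree Y hY hYfree hYX
    rw [walkSum_one, walkSum_one] at hcomp
    have hlt' : (numEdges Y : ℝ) + 1 ≤ numEdges (X n) := by exact_mod_cast hlt
    have hl0 : 0 < l := by linarith
    have e1 : k * l * walkSum Y 2 ≤ k * l * (walkSum (X n) 2 + K) := by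
      gcongr; linarith
    have e2 : k * walkSum Y 3 ≤ k * (walkSum (X n) 3 + K) := by
      gcongr; linarith
    have e3 : k * l ^ 2 * (2 * ((numEdges Y : ℝ) + 1)) ≤ k * l ^ 2 * (2 * numEdges (X n)) := by
      gcongr
    have e4 : k * K ≤ k * K * l := le_mul_of_one_le_right (by positivity) hl1
    have e5 : l * (k * 2 * l) ≤ l * (2 * k * K + D ^ 4) := by linarith
    have e6 := le_of_mul_le_mul_left e5 hl0
    have e7 : l ≤ k * 2 * l := by
      have : 1 * 1 * l ≤ k * 2 * l := by gcongr; norm_num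
      linarith
    linarith
  refine ⟨⟨hG.1, ?_⟩, fun G' hG' hcG' => ?_⟩
  · exact (SimpleGraph.IsContained.of_le (graphJoin_mono le_rfl bot_le)).trans
      iso.symm.isContained
  · have h1 := hH₀.2 G' hG' ((hbip ⊥).trans hcG')
    rw [numEdges_congr isoH₀, numEdges_graphJoin] at h1
    rw [numEdges_congr iso, numEdges_graphJoin]
    omega

end FiniteFamily

/-! ### Packing disjoint copies of a fixed graph. -/

section Packing

open scoped Classical

/-- The forbidden member is finite and meets only finitely many of the copies. -/
lemma exists_not_free_copies_fin {F : GraphFamily} {k : ℕ} {τ : Type} {T : SimpleGraph τ}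
    (h : ¬ FamilyFree F (cliqueJoin k (copies ℕ T))) :
    ∃ t : ℕ, ¬ FamilyFree F (cliqueJoin k (copies (Fin t) T)) := by
  unfold FamilyFree at h
  push Not at h
  obtain ⟨A, hA, hAf⟩ := h
  obtain ⟨f⟩ := hAf
  let idx : Fin k ⊕ ℕ × τ → ℕ := Sum.elim (fun _ => 0) Prod.fst
  obtain ⟨t, ht⟩ : ∃ t, ∀ i, idx (f i) < t + 1 :=
    ⟨Finset.univ.sup fun i => idx (f i), fun i =>
      Nat.lt_succ_of_le (Finset.le_sup (f := fun i => idx (f i)) (Finset.mem_univ i))⟩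
  -- Reduction modulo t+1 fixes every index that the copy uses.
  let φ : Fin k ⊕ ℕ × τ → Fin k ⊕ Fin (t + 1) × τ :=
    Sum.map id fun p => (Fin.ofNat (t + 1) p.1, p.2)
  refine ⟨t + 1, fun hfree => hfree A hA ⟨⟨⟨fun a => φ (f a), ?_⟩, ?_⟩⟩⟩
  · intro a b hab
    have h : (cliqueJoin k (copies ℕ T)).Adj (f a) (f b) := f.toHom.map_adj hab
    change (cliqueJoin k (copies (Fin (t + 1)) T)).Adj (φ (f a)) (φ (f b))
    rcases ha : f a with i | i <;> rcases hb : f b with j | j <;> rw [ha, hb] at h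
    · simpa [φ] using h
    · simp [φ]
    · simp [φ]
    · simp only [φ, Sum.map_inr]
      rw [graphJoin_inr_inr] at h ⊢
      exact ⟨by rw [h.1], h.2⟩
  · intro a b hab
    change φ (f a) = φ (f b) at hab
    apply f.injective
    change f a = f b
    have hma := ht a
    have hmb := ht b
    rcases ha : f a with i | i <;> rcases hb : f b with j | j <;> rw [ha] at hab hma <;>
      rw [hb] at hab hmb
    · simpa [φ] using hab
    · simp [φ] at hab
    · simp [φ] at hab
    · simp only [φ, Sum.map_inr, Sum.inr.injEq, Prod.mk.injEq] at hab
      simp only [idx, Sum.elim_inr] at hma hmb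
      have h1 := congrArg Fin.val hab.1
      simp only [Fin.ofNat, Nat.mod_eq_of_lt hma, Nat.mod_eq_of_lt hmb] at h1
      rw [Prod.ext h1 hab.2]

/-- If `K_k` joined with infinitely many copies of `T` is not free, then in every free `K_k + Y`
all copies of `T` in `Y` meet a set of bounded size. -/
lemma exists_transversal {F : GraphFamily} {k : ℕ} {τ : Type} [Fintype τ] {T : SimpleGraph τ}
    (h : ¬ FamilyFree F (cliqueJoin k (copies ℕ T))) :
    ∃ c : ℕ, ∀ (W : Type) [Fintype W] (Y : SimpleGraph W), FamilyFree F (cliqueJoin k Y) →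
      ∃ U : Finset W, U.card ≤ c ∧ ∀ f : T.Copy Y, ∃ i, f i ∈ U := by
  obtain ⟨t, ht⟩ := exists_not_free_copies_fin h
  refine ⟨t * Fintype.card τ, fun W _ Y hY => ?_⟩
  have hex : ∃ s, ¬ (copies (Fin s) T).IsContained Y := ⟨t, fun hc =>
    ht (hY.of_isContained (graphJoin_isContained (SimpleGraph.IsContained.refl _) hc))⟩
  -- The least number of disjoint copies that do not fit in Y. One copy fewer gives a maximum
  -- packing, and every copy of T must meet its vertex set.
  obtain ⟨s, hs⟩ : ∃ s, s = Nat.find hex := ⟨_, rfl⟩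
  have hs1 : ¬ (copies (Fin s) T).IsContained Y := hs ▸ Nat.find_spec hex
  have hst : s ≤ t := hs ▸ Nat.find_min' hex fun hc =>
    ht (hY.of_isContained (graphJoin_isContained (SimpleGraph.IsContained.refl _) hc))
  rcases s with _ | s
  · exact absurd SimpleGraph.IsContained.of_isEmpty hs1
  have hs2 : (copies (Fin s) T).IsContained Y := by
    by_contra hc
    have := Nat.find_min' hex hc
    omega
  obtain ⟨g⟩ := hs2
  refine ⟨Finset.univ.image g, ?_, fun f => ?_⟩
  · refine Finset.card_image_le.trans ?_
    rw [Finset.card_univ, Fintype.card_prod, Fintype.card_fin]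
    exact Nat.mul_le_mul_right _ (by omega)
  · by_contra! hcon
    have hne : ∀ p v, g p ≠ f v := fun p v hpv =>
      hcon v (hpv ▸ Finset.mem_image_of_mem _ (Finset.mem_univ p))
    apply hs1
    let ψ : Fin (s + 1) × τ → W := fun p =>
      Fin.lastCases (motive := fun _ => W) (f p.2) (fun i => g (i, p.2)) p.1
    have hψ1 : ∀ v, ψ (Fin.last s, v) = f v := fun v => by simp [ψ]
    have hψ2 : ∀ (i : Fin s) v, ψ (i.castSucc, v) = g (i, v) := fun i v => by simp [ψ]
    refine ⟨⟨⟨ψ, ?_⟩, ?_⟩⟩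
    · rintro ⟨i, u⟩ ⟨j, v⟩ ⟨hij, huv⟩
      simp only at hij huv
      subst hij
      induction i using Fin.lastCases with
      | last => rw [hψ1, hψ1]; exact f.toHom.map_adj huv
      | cast i => rw [hψ2, hψ2]; exact g.toHom.map_adj ⟨rfl, huv⟩
    · rintro ⟨i, u⟩ ⟨j, v⟩ huv
      change ψ (i, u) = ψ (j, v) at huv
      induction i using Fin.lastCases with
      | last =>
        induction j using Fin.lastCases with
        | last => rw [hψ1, hψ1] at huv; rw [f.injective huv]
        | cast j => rw [hψ1, hψ2] at huv; exact absurd huv.symm (hne _ _)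
      | cast i =>
        induction j using Fin.lastCases with
        | last => rw [hψ1, hψ2] at huv; exact absurd huv (hne _ _)
        | cast j =>
          rw [hψ2, hψ2] at huv
          have := g.injective huv
          simp only [Prod.mk.injEq] at this
          rw [this.1, this.2]

lemma numEdges_copies {τ : Type} [Fintype τ] (T : SimpleGraph τ) (s : ℕ) :
    numEdges (copies (Fin s) T) = s * numEdges T := by
  have h := sum_sum_ind (copies (Fin s) T)
  have h1 : ∀ (i j : Fin s) (u v : τ), ind (copies (Fin s) T) (i, u) (j, v)
      = if i = j then ind T u v else 0 := by
    intro i j u v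
    split_ifs with hij
    · exact ind_congr ⟨fun h => h.2, fun h => ⟨hij, h⟩⟩
    · exact ind_of_not_adj fun h => hij h.1
  simp only [Fintype.sum_prod_type, h1] at h
  have h2 : ∀ (i : Fin s) (u : τ), ∑ j : Fin s, ∑ v, (if i = j then ind T u v else 0)
      = ∑ v, ind T u v := by
    intro i u
    rw [Finset.sum_comm]
    simp
  simp only [h2, sum_sum_ind, Finset.sum_const, Finset.card_univ, Fintype.card_fin,
    nsmul_eq_mul] at h
  have : (numEdges (copies (Fin s) T) : ℝ) = s * numEdges T := by linarith
  exact_mod_cast this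

/-- If `K_k` joined with infinitely many copies of `T` is free, then the extremal `X` has at least
as many edges as a packing of copies of `T`. -/
lemma mul_le_numEdges_of_free_copies {F : GraphFamily} {k n : ℕ} {τ : Type} [Fintype τ]
    [Nonempty τ] {T : SimpleGraph τ} (h : FamilyFree F (cliqueJoin k (copies ℕ T))) (hkn : k ≤ n)
    {X : SimpleGraph (Fin (n - k))}
    (hX : MemUpToIso (cliqueJoin k X) (EXContaining (Kbip k (n - k)) F n)) :
    (n - k) / Fintype.card τ * numEdges T ≤ numEdges X := by
  obtain ⟨p, hp⟩ : ∃ p, p = Fintype.card τ := ⟨_, rfl⟩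
  have hp0 : 0 < p := hp ▸ Fintype.card_pos
  let e : τ ≃ Fin p := Fintype.equivFinOfCardEq hp.symm
  -- Cut the vertices into blocks of size p, each carrying a copy of T; an incomplete last block
  -- carries part of one.
  let ψ : Fin (n - k) → ℕ × τ := fun i => (i / p, e.symm ⟨i % p, Nat.mod_lt _ hp0⟩)
  have hψ : Function.Injective ψ := by
    intro i j hij
    simp only [ψ, Prod.mk.injEq, e.symm.apply_eq_iff_eq, Fin.mk.injEq] at hij
    ext
    rw [← Nat.div_add_mod i p, ← Nat.div_add_mod j p, hij.1, hij.2]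
  let Z : SimpleGraph (Fin (n - k)) := (copies ℕ T).comap ψ
  have hZ : Z.IsContained (copies ℕ T) := (SimpleGraph.Embedding.comap ⟨ψ, hψ⟩ _).isContained
  have hZfree : FamilyFree F (cliqueJoin k Z) :=
    h.of_isContained (graphJoin_isContained (SimpleGraph.IsContained.refl _) hZ)
  have hcopies : (copies (Fin ((n - k) / p)) T).IsContained Z := by
    have hlt : ∀ q : Fin ((n - k) / p) × τ, q.1 * p + e q.2 < n - k := by
      intro q
      have h1 := q.1.2
      have h2 := (e q.2).2
      have h3 : ((q.1 : ℕ) + 1) * p ≤ (n - k) / p * p := Nat.mul_le_mul_right _ h1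
      have h4 := Nat.div_mul_le_self (n - k) p
      have h5 : ((q.1 : ℕ) + 1) * p = q.1 * p + p := by ring
      omega
    have hψ' : ∀ q : Fin ((n - k) / p) × τ, ψ ⟨q.1 * p + e q.2, hlt q⟩ = ((q.1 : ℕ), q.2) := by
      intro q
      have h2 := (e q.2).2
      have h3 : (q.1 * p + e q.2 : ℕ) / p = q.1 := by
        rw [mul_comm, Nat.mul_add_div hp0, Nat.div_eq_of_lt h2, add_zero]
      have h4 : (q.1 * p + e q.2 : ℕ) % p = e q.2 := by
        rw [mul_comm, Nat.mul_add_mod, Nat.mod_eq_of_lt h2]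
      simp only [ψ, h3, h4, Fin.eta, Equiv.symm_apply_apply]
    refine ⟨⟨⟨fun q => ⟨q.1 * p + e q.2, hlt q⟩, ?_⟩, ?_⟩⟩
    · intro a b hab
      change (copies ℕ T).Adj (ψ _) (ψ _)
      rw [hψ', hψ']
      exact ⟨congrArg Fin.val hab.1, hab.2⟩
    · intro a b hab
      have := congrArg ψ hab
      change ψ ⟨a.1 * p + e a.2, hlt a⟩ = ψ ⟨b.1 * p + e b.2, hlt b⟩ at this
      rw [hψ', hψ', Prod.mk.injEq] at this
      exact Prod.ext (Fin.ext this.1) this.2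
  obtain ⟨H₀, ⟨-, hmax⟩, ⟨iso⟩⟩ := hX
  have hc : Fintype.card (Fin k ⊕ Fin (n - k)) = n := by simp; omega
  have e' := (cliqueJoin k Z).overFinIso hc
  have h1 := hmax ((cliqueJoin k Z).overFin hc) (hZfree.congr e')
    ((SimpleGraph.IsContained.of_le (completeBipartiteGraph_le_graphJoin _ _)).trans
      e'.isContained)
  rw [numEdges_congr iso, ← numEdges_congr e', numEdges_graphJoin, numEdges_graphJoin] at h1
  have h2 := numEdges_le_of_isContained hcopies
  rw [numEdges_copies] at h2
  rw [← hp]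
  omega

end Packing

/-! ### Degree types of edges. -/

section EdgeTypes

open scoped Classical

variable {W : Type*} [Fintype W]

/-- Only edges meeting N count, and at most 2|N|D ordered adjacent pairs do. -/
lemma sum_ind_mul_le_of_nonpos {Y : SimpleGraph W} {D : ℕ} (hD : ∀ v, deg Y v ≤ D) {N : Finset W}
    {g : W → W → ℝ} {M : ℝ} (hM : 0 ≤ M)
    (h1 : ∀ u v, Y.Adj u v → u ∉ N → v ∉ N → g u v ≤ 0) (h2 : ∀ u v, Y.Adj u v → g u v ≤ M) :
    ∑ u, ∑ v, ind Y u v * g u v ≤ 2 * N.card * D * M := by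
  have hsum : ∑ u, ∑ v, (if u ∈ N then ind Y u v else 0) ≤ N.card * D := by
    have : ∀ u, ∑ v, (if u ∈ N then ind Y u v else 0) = if u ∈ N then (deg Y u : ℝ) else 0 := by
      intro u
      split_ifs
      · exact sum_ind_eq_deg Y u
      · simp
    simp only [this]
    rw [Finset.sum_ite_mem, Finset.univ_inter]
    calc ∑ u ∈ N, (deg Y u : ℝ) ≤ ∑ u ∈ N, (D : ℝ) :=
          Finset.sum_le_sum fun u _ => by exact_mod_cast hD u
      _ = _ := by simp
  have hsum' : ∑ u, ∑ v, (if v ∈ N then ind Y u v else 0) ≤ N.card * D := by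
    rw [Finset.sum_comm]
    refine le_trans (le_of_eq ?_) hsum
    refine Finset.sum_congr rfl fun u _ => Finset.sum_congr rfl fun v _ => ?_
    rw [ind_comm]
  calc ∑ u, ∑ v, ind Y u v * g u v
      ≤ ∑ u, ∑ v, ((if u ∈ N then ind Y u v else 0) + (if v ∈ N then ind Y u v else 0)) * M := by
        refine Finset.sum_le_sum fun u _ => Finset.sum_le_sum fun v _ => ?_
        by_cases hY : Y.Adj u v
        · have h3 := h1 u v hY
          have h4 := h2 u v hY
          rw [ind_of_adj hY]
          split_ifs with hu hv hv
          · linarith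
          · linarith
          · linarith
          · linarith [h3 hu hv]
        · simp [ind_of_not_adj hY]
    _ = (∑ u, ∑ v, (if u ∈ N then ind Y u v else 0)
        + ∑ u, ∑ v, (if v ∈ N then ind Y u v else 0)) * M := by
        simp only [← Finset.sum_mul, Finset.sum_add_distrib]
    _ ≤ (N.card * D + N.card * D) * M := by gcongr
    _ = _ := by ring

/-- If almost all edges of `Y` have degree sum at most `p` and degree product at most `q`, and
almost all edges of `X` have at least these, then the walk counts compare. -/
lemma walkSum_le_of_edge_types {X Y : SimpleGraph W} {D c p q : ℕ} (hXD : ∀ v, deg X v ≤ D)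
    (hYD : ∀ v, deg Y v ≤ D) {N N' : Finset W} (hN : N.card ≤ c) (hN' : N'.card ≤ c)
    (hY : ∀ u v, Y.Adj u v → u ∉ N → v ∉ N → deg Y u + deg Y v ≤ p ∧ deg Y u * deg Y v ≤ q)
    (hX : ∀ u v, X.Adj u v → u ∉ N' → v ∉ N' → p ≤ deg X u + deg X v ∧ q ≤ deg X u * deg X v)
    (he : numEdges Y ≤ numEdges X) :
    walkSum Y 2 ≤ walkSum X 2 + c * D * (2 * D + p + 2 * D ^ 2 + 2 * q) ∧
      walkSum Y 3 ≤ walkSum X 3 + c * D * (2 * D + p + 2 * D ^ 2 + 2 * q) := by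
  have hYD' : ∀ v, (deg Y v : ℝ) ≤ D := fun v => by exact_mod_cast hYD v
  have hYe := sum_sum_ind Y
  have hXe := sum_sum_ind X
  have hN1 : (N.card : ℝ) ≤ c := by exact_mod_cast hN
  have hN2 : (N'.card : ℝ) ≤ c := by exact_mod_cast hN'
  have he' : (numEdges Y : ℝ) ≤ numEdges X := by exact_mod_cast he
  -- Up to bounded error the sums of edge types are at most p or q times 2e(Y) for Y, and at least p
  -- or q times 2e(X) for X.
  have y2 := sum_ind_mul_le_of_nonpos hYD (N := N) (M := 2 * D)
    (g := fun u v => (deg Y u + deg Y v : ℝ) - p) (by positivity)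
    (fun u v huv hu hv => by
      have : ((deg Y u + deg Y v : ℕ) : ℝ) ≤ p := by exact_mod_cast (hY u v huv hu hv).1
      push_cast at this
      linarith)
    (fun u v _ => by
      have : (0 : ℝ) ≤ p := Nat.cast_nonneg _
      linarith [hYD' u, hYD' v])
  have y3 := sum_ind_mul_le_of_nonpos hYD (N := N) (M := D ^ 2)
    (g := fun u v => (deg Y u * deg Y v : ℝ) - q) (by positivity)
    (fun u v huv hu hv => by
      have : ((deg Y u * deg Y v : ℕ) : ℝ) ≤ q := by exact_mod_cast (hY u v huv hu hv).2
      push_cast at this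
      linarith)
    (fun u v _ => by
      have : (0 : ℝ) ≤ q := Nat.cast_nonneg _
      have : (deg Y u : ℝ) * deg Y v ≤ D * D := by
        gcongr
        · exact hYD u
        · exact hYD v
      linarith)
  have x2 := sum_ind_mul_le_of_nonpos hXD (N := N') (M := p)
    (g := fun u v => (p : ℝ) - (deg X u + deg X v : ℝ)) (by positivity)
    (fun u v huv hu hv => by
      have : (p : ℝ) ≤ ((deg X u + deg X v : ℕ) : ℝ) := by exact_mod_cast (hX u v huv hu hv).1
      push_cast at this
      linarith)
    (fun u v _ => by
      have h1 : (0 : ℝ) ≤ deg X u := Nat.cast_nonneg _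
      have h2 : (0 : ℝ) ≤ deg X v := Nat.cast_nonneg _
      linarith)
  have x3 := sum_ind_mul_le_of_nonpos hXD (N := N') (M := q)
    (g := fun u v => (q : ℝ) - (deg X u * deg X v : ℝ)) (by positivity)
    (fun u v huv hu hv => by
      have : (q : ℝ) ≤ ((deg X u * deg X v : ℕ) : ℝ) := by exact_mod_cast (hX u v huv hu hv).2
      push_cast at this
      linarith)
    (fun u v _ => by
      have h1 : (0 : ℝ) ≤ deg X u * deg X v := by positivity
      linarith)
  simp only [mul_sub, Finset.sum_sub_distrib, ← walkSum_two, ← walkSum_three, ← Finset.sum_mul,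
    hYe, hXe] at y2 y3 x2 x3
  have b1 : 2 * (N.card : ℝ) * D * (2 * D) ≤ 2 * c * D * (2 * D) := by gcongr
  have b2 : 2 * (N.card : ℝ) * D * D ^ 2 ≤ 2 * c * D * D ^ 2 := by gcongr
  have b3 : 2 * (N'.card : ℝ) * D * p ≤ 2 * c * D * p := by gcongr
  have b4 : 2 * (N'.card : ℝ) * D * q ≤ 2 * c * D * q := by gcongr
  have c1 : 2 * (numEdges Y : ℝ) * p ≤ 2 * numEdges X * p := by gcongr
  have c2 : 2 * (numEdges Y : ℝ) * q ≤ 2 * numEdges X * q := by gcongr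
  have d1 : (0 : ℝ) ≤ c * D * D := by positivity
  have d2 : (0 : ℝ) ≤ c * D * p := by positivity
  have d3 : (0 : ℝ) ≤ c * D * D ^ 2 := by positivity
  have d4 : (0 : ℝ) ≤ c * D * q := by positivity
  constructor <;> linarith

/-- The closed neighbourhood of a set of vertices. -/
noncomputable def closedNb (Y : SimpleGraph W) (U : Finset W) : Finset W := U ∪ U.biUnion (nb Y)

lemma card_closedNb_le {Y : SimpleGraph W} {D c : ℕ} (hD : ∀ v, deg Y v ≤ D) {U : Finset W}
    (hU : U.card ≤ c) : (closedNb Y U).card ≤ c * (D + 1) := by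
  have h1 : (U.biUnion (nb Y)).card ≤ U.card * D :=
    Finset.card_biUnion_le_card_mul _ _ _ fun v _ => by rw [card_nb]; exact hD v
  calc (closedNb Y U).card ≤ U.card + (U.biUnion (nb Y)).card := Finset.card_union_le _ _
    _ ≤ U.card + U.card * D := by omega
    _ = U.card * (D + 1) := by ring
    _ ≤ _ := Nat.mul_le_mul_right _ hU

lemma notMem_of_notMem_closedNb {Y : SimpleGraph W} {U : Finset W} {v : W}
    (hv : v ∉ closedNb Y U) : v ∉ U ∧ ∀ w, Y.Adj v w → w ∉ U := by
  refine ⟨fun h => hv (Finset.mem_union_left _ h), fun w hvw hw => hv ?_⟩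
  exact Finset.mem_union_right _ (Finset.mem_biUnion.2 ⟨w, hw, mem_nb.2 hvw.symm⟩)

/-- Otherwise v is the centre of a star with d+1 leaves, and this star avoids U since v and all its
neighbours do. -/
lemma deg_le_of_notMem_closedNb {Y : SimpleGraph W} {d : ℕ} {U : Finset W}
    (hU : ∀ f : (completeBipartiteGraph (Fin 1) (Fin (d + 1))).Copy Y, ∃ i, f i ∈ U) {v : W}
    (hv : v ∉ closedNb Y U) : deg Y v ≤ d := by
  by_contra! hcon
  obtain ⟨hvU, hnU⟩ := notMem_of_notMem_closedNb hv
  obtain ⟨g⟩ : Nonempty (Fin (d + 1) ↪ nb Y v) := Function.Embedding.nonempty_of_card_le (by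
    rw [Fintype.card_fin, Fintype.card_coe, card_nb]; omega)
  have hg : ∀ i, Y.Adj v (g i) := fun i => mem_nb.1 (g i).2
  let φ : Fin 1 ⊕ Fin (d + 1) → W := Sum.elim (fun _ => v) fun i => g i
  obtain ⟨i, hi⟩ := hU ⟨⟨φ, by
      rintro (a | a) (b | b) hab
      · simp at hab
      · exact hg b
      · exact (hg a).symm
      · simp at hab⟩, by
      rintro (a | a) (b | b) hab
      · rw [Subsingleton.elim a b]
      · exact absurd hab (hg b).ne
      · exact absurd hab.symm (hg a).ne
      · change (g a : W) = g b at hab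
        rw [g.injective (Subtype.ext hab)]⟩
  rcases i with i | i
  · exact hvU hi
  · exact hnU _ (hg i) hi

lemma exists_ne_adj {Y : SimpleGraph W} {u : W} (hu : 2 ≤ deg Y u) (v : W) :
    ∃ a, Y.Adj u a ∧ a ≠ v := by
  rw [← card_nb] at hu
  obtain ⟨a, ha, hav⟩ := Finset.exists_mem_ne (by omega : 1 < (nb Y u).card) v
  exact ⟨a, mem_nb.1 ha, hav⟩

/-- Further neighbours a of u and b of v give a triangle if they coincide and a path with three
edges if not; all its vertices are u, v or neighbours of these, so it avoids the transversal. -/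
lemma not_two_le_deg_of_notMem_closedNb {Y : SimpleGraph W} {U U' : Finset W}
    (hU : ∀ f : (SimpleGraph.pathGraph 4).Copy Y, ∃ i, f i ∈ U)
    (hU' : ∀ f : (⊤ : SimpleGraph (Fin 3)).Copy Y, ∃ i, f i ∈ U') {u v : W} (huv : Y.Adj u v)
    (hu : u ∉ closedNb Y U) (hv : v ∉ closedNb Y U) (hu' : u ∉ closedNb Y U')
    (hv' : v ∉ closedNb Y U') (hdu : 2 ≤ deg Y u) (hdv : 2 ≤ deg Y v) : False := by
  obtain ⟨a, hua, hav⟩ := exists_ne_adj hdu v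
  obtain ⟨b, hvb, hbu⟩ := exists_ne_adj hdv u
  obtain ⟨h1, h2⟩ := notMem_of_notMem_closedNb hu
  obtain ⟨h3, h4⟩ := notMem_of_notMem_closedNb hv
  obtain ⟨h5, h6⟩ := notMem_of_notMem_closedNb hu'
  obtain ⟨h7, h8⟩ := notMem_of_notMem_closedNb hv'
  have e1 := hua.ne
  have e2 := hvb.ne
  have e3 := huv.ne
  by_cases hab : a = b
  · subst hab
    obtain ⟨i, hi⟩ := hU' ⟨⟨![u, v, a], by
        intro i j hij
        fin_cases i <;> fin_cases j <;>
          simp [huv, huv.symm, hua, hua.symm, hvb, hvb.symm] at hij ⊢⟩, by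
        intro i j hij
        fin_cases i <;> fin_cases j <;>
          simp [e1, e2, e3, e1.symm, e2.symm, e3.symm] at hij ⊢⟩
    fin_cases i
    · exact h5 hi
    · exact h7 hi
    · exact h6 _ hua hi
  · obtain ⟨i, hi⟩ := hU ⟨⟨![a, u, v, b], by
        intro i j hij
        rw [SimpleGraph.pathGraph_adj] at hij
        fin_cases i <;> fin_cases j <;>
          simp [huv, huv.symm, hua, hua.symm, hvb, hvb.symm] at hij ⊢⟩, by
        have n1 := Ne.symm hab
        intro i j hij
        fin_cases i <;> fin_cases j <;>
          simp [e1, e2, e3, e1.symm, e2.symm, e3.symm, hab, n1, hav, hav.symm, hbu, hbu.symm]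
            at hij ⊢⟩
    fin_cases i
    · exact h2 _ hua hi
    · exact h1 hi
    · exact h3 hi
    · exact h4 _ hvb hi

/-- If almost all edges have degree sum at most `3` and the number of edges is close to that of a
perfect packing of paths with two edges, then few edges are isolated. -/
lemma card_isolated_edges_le {X : SimpleGraph W} {D : ℕ} (hD : ∀ v, deg X v ≤ D) {N : Finset W}
    (hN : ∀ u v, X.Adj u v → u ∉ N → v ∉ N → deg X u + deg X v ≤ 3) {P : Finset W}
    (hP : ∀ u ∈ P, u ∉ N ∧ ∃ v, X.Adj u v ∧ v ∉ N ∧ deg X u = 1 ∧ deg X v = 1) :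
    3 * (numEdges X : ℝ) + P.card / 2 ≤ 2 * Fintype.card W + 4 * N.card * D := by
  have hdeg : ∀ u v, X.Adj u v → 1 ≤ deg X u := by
    intro u v huv
    rw [← card_nb]
    exact Finset.card_pos.2 ⟨v, mem_nb.2 huv⟩
  have hinv : ∑ u, ∑ v, ind X u v * (1 / (deg X u : ℝ)) ≤ Fintype.card W := by
    calc ∑ u, ∑ v, ind X u v * (1 / (deg X u : ℝ)) ≤ ∑ _u : W, (1 : ℝ) := by
          refine Finset.sum_le_sum fun u _ => ?_
          rw [← Finset.sum_mul, sum_ind_eq_deg, mul_one_div]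
          exact div_self_le_one _
      _ = _ := by simp
  have hinv' : ∑ u, ∑ v, ind X u v * (1 / (deg X v : ℝ)) ≤ Fintype.card W := by
    rw [Finset.sum_comm]
    refine le_trans (le_of_eq ?_) hinv
    exact Finset.sum_congr rfl fun u _ => Finset.sum_congr rfl fun v _ => by rw [ind_comm]
  have hPsum : ∑ u, ∑ v, ind X u v * (if u ∈ P then (1 : ℝ) / 2 else 0) = P.card / 2 := by
    have : ∀ u, ∑ v, ind X u v * (if u ∈ P then (1 : ℝ) / 2 else 0)
        = if u ∈ P then (1 : ℝ) / 2 else 0 := by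
      intro u
      rw [← Finset.sum_mul, sum_ind_eq_deg]
      split_ifs with hu
      · obtain ⟨-, v, -, -, hu1, -⟩ := hP u hu
        rw [hu1]; simp
      · simp
    simp only [this]
    rw [Finset.sum_ite_mem, Finset.univ_inter]
    simp [div_eq_mul_inv]
  -- Discharging: the values 1/deg u + 1/deg v over ordered adjacent pairs sum to at most 2|W|. Off
  -- N an edge of a two-edge path has value 3/2 and an isolated edge 2, so isolated edges waste 1/2.
  have hmain := sum_ind_mul_le_of_nonpos hD (N := N) (M := 2)
    (g := fun u v => 3 / 2 + (if u ∈ P then (1 : ℝ) / 2 else 0) - 1 / (deg X u : ℝ)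
      - 1 / (deg X v : ℝ)) (by norm_num) ?_ ?_
  · have hconst : ∑ u, ∑ v, ind X u v * (3 / 2 : ℝ) = 2 * numEdges X * (3 / 2) := by
      simp only [← Finset.sum_mul, sum_sum_ind]
    simp only [mul_sub, mul_add, Finset.sum_sub_distrib, Finset.sum_add_distrib] at hmain
    rw [hPsum, hconst] at hmain
    linarith
  · intro u v huv hu hv
    have h1 := hdeg u v huv
    have h2 := hdeg v u huv.symm
    have h3 := hN u v huv hu hv
    by_cases huP : u ∈ P
    · obtain ⟨-, w, huw, -, hu1, hw1⟩ := hP u huP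
      have hwv : w = v := by
        have hc : (nb X u).card = 1 := by rw [card_nb, hu1]
        exact Finset.card_le_one.1 hc.le _ (mem_nb.2 huw) _ (mem_nb.2 huv)
      rw [hwv] at hw1
      rw [hu1, hw1, if_pos huP]
      norm_num
    · rw [if_neg huP]
      obtain h | h | h : (deg X u = 1 ∧ deg X v = 1) ∨ (deg X u = 1 ∧ deg X v = 2) ∨
          (deg X u = 2 ∧ deg X v = 1) := by omega
      all_goals rw [h.1, h.2]; norm_num
  · intro u v _
    have h1 : (0 : ℝ) ≤ 1 / (deg X u : ℝ) := by positivity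
    have h2 : (0 : ℝ) ≤ 1 / (deg X v : ℝ) := by positivity
    split_ifs <;> linarith

end EdgeTypes

/-! ### Sparse and almost regular extremal graphs. -/

section SmallTrees

open scoped Classical

variable {F : GraphFamily} {k : ℕ} {X : ∀ n : ℕ, SimpleGraph (Fin (n - k))} {Q : ℝ}

lemma exists_deg_le_off {d : ℕ} (h : ¬ FamilyFree F (cliqueJoin k
      (copies ℕ (completeBipartiteGraph (Fin 1) (Fin (d + 1)))))) :
    ∃ c : ℕ, ∀ (W : Type) [Fintype W] (Y : SimpleGraph W) (D : ℕ), FamilyFree F (cliqueJoin k Y) →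
      (∀ v, deg Y v ≤ D) → ∃ N : Finset W, N.card ≤ c * (D + 1) ∧ ∀ v, v ∉ N → deg Y v ≤ d := by
  obtain ⟨c, hc⟩ := exists_transversal h
  refine ⟨c, fun W _ Y D hY hD => ?_⟩
  obtain ⟨U, hUc, hU⟩ := hc W Y hY
  exact ⟨closedNb Y U, card_closedNb_le hD hUc, fun v hv => deg_le_of_notMem_closedNb hU hv⟩

/-- If `K_k` joined with infinitely many disjoint copies of `K_{1,3}`, of a path with three edges,
or of a triangle is never free, then almost all components of `Y` in a free `K_k + Y` of bounded
degree have at most two edges. -/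
lemma exists_edge_types_off
    (h₁ : ¬ FamilyFree F (cliqueJoin k (copies ℕ (completeBipartiteGraph (Fin 1) (Fin 3)))))
    (h₂ : ¬ FamilyFree F (cliqueJoin k (copies ℕ (SimpleGraph.pathGraph 4))))
    (h₃ : ¬ FamilyFree F (cliqueJoin k (copies ℕ (⊤ : SimpleGraph (Fin 3))))) :
    ∃ c : ℕ, ∀ (W : Type) [Fintype W] (Y : SimpleGraph W) (D : ℕ), FamilyFree F (cliqueJoin k Y) →
      (∀ v, deg Y v ≤ D) → ∃ N : Finset W, N.card ≤ c * (D + 1) ∧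
        ∀ u v, Y.Adj u v → u ∉ N → v ∉ N → deg Y u + deg Y v ≤ 3 ∧ deg Y u * deg Y v ≤ 2 := by
  obtain ⟨c₁, hc₁⟩ := exists_deg_le_off (d := 2) h₁
  obtain ⟨c₂, hc₂⟩ := exists_transversal h₂
  obtain ⟨c₃, hc₃⟩ := exists_transversal h₃
  refine ⟨c₁ + c₂ + c₃, fun W _ Y D hY hD => ?_⟩
  obtain ⟨N, hNc, hN⟩ := hc₁ W Y D hY hD
  obtain ⟨U, hUc, hU⟩ := hc₂ W Y hY
  obtain ⟨U', hUc', hU'⟩ := hc₃ W Y hY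
  refine ⟨N ∪ closedNb Y U ∪ closedNb Y U', ?_, fun u v huv hu hv => ?_⟩
  · have := card_closedNb_le hD hUc
    have := card_closedNb_le hD hUc'
    have := Finset.card_union_le (N ∪ closedNb Y U) (closedNb Y U')
    have := Finset.card_union_le N (closedNb Y U)
    have : (c₁ + c₂ + c₃) * (D + 1) = c₁ * (D + 1) + c₂ * (D + 1) + c₃ * (D + 1) := by ring
    omega
  · simp only [Finset.mem_union, not_or] at hu hv
    have hu2 := hN u hu.1.1
    have hv2 := hN v hv.1.1
    have hnot : ¬ (2 ≤ deg Y u ∧ 2 ≤ deg Y v) := fun h =>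
      not_two_le_deg_of_notMem_closedNb hU hU' huv hu.1.2 hv.1.2 hu.2 hv.2 h.1 h.2
    refine ⟨by omega, ?_⟩
    obtain h | h : deg Y u ≤ 1 ∨ deg Y v ≤ 1 := by omega
    · calc deg Y u * deg Y v ≤ 1 * 2 := Nat.mul_le_mul h hv2
        _ = 2 := rfl
    · calc deg Y u * deg Y v ≤ 2 * 1 := Nat.mul_le_mul hu2 h
        _ = 2 := rfl

/-- Packing graphs with at least three edges on at most four vertices would give X at least 3n/4 -
O(1) edges. This is where the constant 3/4 enters. -/
lemma not_free_copies_of_sparse (hQ : Q < 3 / 4) (hX : JoinExtremal F k X Q) {τ : Type}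
    [Fintype τ] [Nonempty τ] {T : SimpleGraph τ} (hτ : Fintype.card τ ≤ 4)
    (hT : 3 ≤ numEdges T) : ¬ FamilyFree F (cliqueJoin k (copies ℕ T)) := by
  intro hfree
  obtain ⟨hJ, C, hC⟩ := hX
  have hlim : Tendsto (fun n : ℕ => (3 / 4 - Q) * (n : ℝ)) atTop atTop :=
    tendsto_natCast_atTop_atTop.const_mul_atTop (by linarith)
  obtain ⟨n, hn1, hn2, hn3, hn4⟩ := (hJ.and (hC.and ((hlim.eventually_gt_atTop
    (C + 3 * (k + 3) / 4)).and (eventually_ge_atTop k)))).exists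
  have h1 := mul_le_numEdges_of_free_copies hfree hn4 hn1
  have h2 : (n - k) / 4 ≤ (n - k) / Fintype.card τ := Nat.div_le_div_left hτ Fintype.card_pos
  have h3 : (n - k) / 4 * 3 ≤ numEdges (X n) := (Nat.mul_le_mul h2 hT).trans h1
  have h4 : 3 * n ≤ 4 * numEdges (X n) + 3 * (k + 3) := by omega
  have h5 : 3 * (n : ℝ) ≤ 4 * numEdges (X n) + 3 * (k + 3) := by exact_mod_cast h4
  linarith

lemma numEdges_pathGraph_four : numEdges (SimpleGraph.pathGraph 4) = 3 := by
  have h := sum_sum_ind (SimpleGraph.pathGraph 4)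
  simp [Fin.sum_univ_four, ind, SimpleGraph.pathGraph_adj, -Finset.sum_boole] at h
  have : (numEdges (SimpleGraph.pathGraph 4) : ℝ) = 3 := by linarith
  exact_mod_cast this

/-- Excluding infinitely many stars with d+1 leaves makes almost all degrees in Y at most d, while
almost all degrees in X equal d; the common edge type has sum 2d and product d². -/
theorem SPEX_subset_of_almost_regular (hk : 1 ≤ k)
    (hex : (fun n : ℕ => (ex F n : ℝ)) =O[atTop] (fun n : ℕ => (n : ℝ)))
    (hK : ¬ FamilyFree F (completeBipartiteGraph (Fin (k + 1)) ℕ)) (hF : F.Finite)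
    (hX : JoinExtremal F k X Q) {d : ℕ}
    (hB : ∃ B : ℕ, ∀ᶠ n : ℕ in atTop, {v | deg (X n) v ≠ d}.ncard ≤ B)
    (hstar : ¬ FamilyFree F (cliqueJoin k
      (copies ℕ (completeBipartiteGraph (Fin 1) (Fin (d + 1)))))) :
    ∀ᶠ n : ℕ in atTop, SPEX F n ⊆ EXContaining (cliqueJoinEmpty k n) F n := by
  obtain ⟨B, hB⟩ := hB
  obtain ⟨c, hc⟩ := exists_deg_le_off hstar
  refine SPEX_subset_of_walkSum_le hk hex hK hF hX.1 fun D =>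
    ⟨(c * (D + 1) + B : ℕ) * D * (2 * D + (d + d : ℕ) + 2 * D ^ 2 + 2 * (d * d : ℕ)), ?_⟩
  filter_upwards [hB] with n hn hXD _ Y hYD hY he
  obtain ⟨N, hNc, hN⟩ := hc _ Y D hY hYD
  refine walkSum_le_of_edge_types (c := c * (D + 1) + B) (p := d + d) (q := d * d)
    (N' := Finset.univ.filter fun v => deg (X n) v ≠ d) hXD hYD
    (hNc.trans (Nat.le_add_right _ _)) ?_ ?_ ?_ he
  · rw [← Set.ncard_coe_finset]
    simp only [Finset.coe_filter, Finset.mem_univ, true_and]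
    omega
  · intro u v _ hu hv
    exact ⟨add_le_add (hN u hu) (hN v hv), Nat.mul_le_mul (hN u hu) (hN v hv)⟩
  · intro u v _ hu hv
    simp only [Finset.mem_filter, Finset.mem_univ, true_and, not_not] at hu hv
    rw [hu, hv]
    exact ⟨le_rfl, le_rfl⟩

lemma one_le_deg_of_adj {W : Type*} [Fintype W] {Y : SimpleGraph W} {u v : W} (h : Y.Adj u v) :
    1 ≤ deg Y u := by
  rw [← card_nb]
  exact Finset.card_pos.2 ⟨v, mem_nb.2 h⟩

theorem SPEX_subset_of_sparse (hk : 1 ≤ k)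
    (hex : (fun n : ℕ => (ex F n : ℝ)) =O[atTop] (fun n : ℕ => (n : ℝ)))
    (hK : ¬ FamilyFree F (completeBipartiteGraph (Fin (k + 1)) ℕ)) (hF : F.Finite)
    (hQ : Q < 3 / 4) (hX : JoinExtremal F k X Q) :
    ∀ᶠ n : ℕ in atTop, SPEX F n ⊆ EXContaining (cliqueJoinEmpty k n) F n := by
  refine SPEX_subset_of_walkSum_le hk hex hK hF hX.1 fun D => ?_
  -- If two-edge paths can be packed, X has at least 2(n-k)/3 - O(1) edges, so almost all its edges
  -- lie in such paths and the type is sum 3, product 2. If not, almost all edges of Y are isolated,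
  -- with sum 2 and product 1, which is the least any edge of X can have.
  by_cases hcherry : FamilyFree F (cliqueJoin k
      (copies ℕ (completeBipartiteGraph (Fin 1) (Fin 2))))
  · obtain ⟨c, hc⟩ := exists_edge_types_off
      (not_free_copies_of_sparse hQ hX (by simp) (numEdges_Kbip 1 3).ge)
      (not_free_copies_of_sparse hQ hX (by simp) numEdges_pathGraph_four.ge)
      (not_free_copies_of_sparse hQ hX (T := (⊤ : SimpleGraph (Fin 3))) (by simp) (by
        have h := two_mul_numEdges_top 3
        have : (3 : ℝ) ≤ numEdges (⊤ : SimpleGraph (Fin 3)) := by norm_num at h; linarith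
        exact_mod_cast this))
    -- The set removed from X consists of N', of size at most c(D+1), and the ends P of isolated
    -- edges, whose number is bounded by `card_isolated_edges_le`.
    refine ⟨(c * (D + 1) + (8 * (c * (D + 1)) * D + 8) : ℕ) * D *
      (2 * D + (3 : ℕ) + 2 * D ^ 2 + 2 * (2 : ℕ)), ?_⟩
    filter_upwards [hX.1, eventually_ge_atTop k] with n hn hkn hXD hXfree Y hYD hY he
    obtain ⟨N, hNc, hN⟩ := hc _ Y D hY hYD
    obtain ⟨N', hNc', hN'⟩ := hc _ (X n) D hXfree hXD
    have h1 := mul_le_numEdges_of_free_copies hcherry hkn hn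
    rw [numEdges_Kbip] at h1
    simp only [Fintype.card_sum, Fintype.card_fin] at h1
    let P : Finset (Fin (n - k)) := Finset.univ.filter fun u =>
      u ∉ N' ∧ ∃ v, (X n).Adj u v ∧ v ∉ N' ∧ deg (X n) u = 1 ∧ deg (X n) v = 1
    have h2 := card_isolated_edges_le hXD (fun u v huv hu hv => (hN' u v huv hu hv).1) (P := P)
      fun u hu => (Finset.mem_filter.1 hu).2
    have h3 : 2 * (n - k) ≤ 3 * numEdges (X n) + 4 := by omega
    have h3' : 2 * ((n - k : ℕ) : ℝ) ≤ 3 * numEdges (X n) + 4 := by exact_mod_cast h3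
    rw [Fintype.card_fin] at h2
    have h4 : (P.card : ℝ) ≤ ((8 * N'.card * D + 8 : ℕ) : ℝ) := by push_cast; linarith
    have h5 : P.card ≤ 8 * N'.card * D + 8 := by exact_mod_cast h4
    have h6 : 8 * N'.card * D ≤ 8 * (c * (D + 1)) * D := by gcongr
    refine walkSum_le_of_edge_types (c := c * (D + 1) + (8 * (c * (D + 1)) * D + 8)) (p := 3)
      (q := 2) (N' := N' ∪ P) hXD hYD
      (hNc.trans (Nat.le_add_right _ _)) ?_ hN ?_ he
    · have := Finset.card_union_le N' P
      omega
    · intro u v huv hu hv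
      rw [Finset.mem_union, not_or] at hu hv
      have hu1 := one_le_deg_of_adj huv
      have hv1 := one_le_deg_of_adj huv.symm
      have hnot : ¬ (deg (X n) u = 1 ∧ deg (X n) v = 1) := fun h => hu.2
        (Finset.mem_filter.2 ⟨Finset.mem_univ _, hu.1, v, huv, hv.1, h.1, h.2⟩)
      refine ⟨by omega, ?_⟩
      obtain h | h : 2 ≤ deg (X n) u ∨ 2 ≤ deg (X n) v := by omega
      · exact Nat.mul_le_mul h hv1
      · exact Nat.mul_le_mul hu1 h
  · obtain ⟨c, hc⟩ := exists_deg_le_off (d := 1) hcherry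
    refine ⟨(c * (D + 1) : ℕ) * D * (2 * D + (2 : ℕ) + 2 * D ^ 2 + 2 * (1 : ℕ)),
      Eventually.of_forall fun n hXD _ Y hYD hY he => ?_⟩
    obtain ⟨N, hNc, hN⟩ := hc _ Y D hY hYD
    refine walkSum_le_of_edge_types (c := c * (D + 1)) (p := 2) (q := 1) (N' := ∅) hXD hYD hNc
      (by simp) ?_ ?_ he
    · intro u v _ hu hv
      exact ⟨add_le_add (hN u hu) (hN v hv), Nat.mul_le_mul (hN u hu) (hN v hv)⟩
    · intro u v huv _ _
      have hu := one_le_deg_of_adj huv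
      have hv := one_le_deg_of_adj huv.symm
      exact ⟨add_le_add hu hv, Nat.mul_le_mul hu hv⟩

end SmallTrees

end SpectralTuran

/-! ### The main theorem. -/

theorem theorem1p1 (F : SpectralTuran.GraphFamily) (k : ℕ) (hk : 1 ≤ k)
    (hex : (fun n : ℕ => (SpectralTuran.ex F n : ℝ)) =O[Filter.atTop] (fun n : ℕ => (n : ℝ)))
    (hK : ¬ SpectralTuran.FamilyFree F (completeBipartiteGraph (Fin (k + 1)) ℕ)) :
    -- case (a)
    ((∀ᶠ n : ℕ in Filter.atTop, SpectralTuran.MemUpToIso (SpectralTuran.Kbip k (n - k))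
        (SpectralTuran.EXContaining (SpectralTuran.Kbip k (n - k)) F n)) →
      ∀ᶠ n : ℕ in Filter.atTop,
        SpectralTuran.SPEX F n = SpectralTuran.isoClass (SpectralTuran.Kbip k (n - k)) n) ∧
    -- case (b)
    ((∀ᶠ n : ℕ in Filter.atTop, SpectralTuran.MemUpToIso (SpectralTuran.cliqueJoinEmpty k n)
        (SpectralTuran.EXContaining (SpectralTuran.Kbip k (n - k)) F n)) →
      ∀ᶠ n : ℕ in Filter.atTop,
        SpectralTuran.SPEX F n = SpectralTuran.isoClass (SpectralTuran.cliqueJoinEmpty k n) n) ∧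
    -- case (c)
    ((∀ᶠ n : ℕ in Filter.atTop, SpectralTuran.MemUpToIso (SpectralTuran.cliqueJoinEdge k n)
        (SpectralTuran.EXContaining (SpectralTuran.Kbip k (n - k)) F n)) →
      ∀ᶠ n : ℕ in Filter.atTop,
        SpectralTuran.SPEX F n = SpectralTuran.isoClass (SpectralTuran.cliqueJoinEdge k n) n) ∧
    -- case (d)
    (F.Finite → ∀ (X : ∀ n : ℕ, SimpleGraph (Fin (n - k))) (Q : ℝ), 0 ≤ Q → Q < 3 / 4 →
      SpectralTuran.JoinExtremal F k X Q →
      ∀ᶠ n : ℕ in Filter.atTop, SpectralTuran.SPEX F n ⊆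
        SpectralTuran.EXContaining (SpectralTuran.cliqueJoinEmpty k n) F n) ∧
    -- case (e); the bound `D` on the maximum degree is chosen before `X` and `Q`
    (F.Finite → ∃ D : ℕ, ∀ (X : ∀ n : ℕ, SimpleGraph (Fin (n - k))) (Q : ℝ), 3 / 4 ≤ Q →
      SpectralTuran.JoinExtremal F k X Q →
      ∃ C : ℝ, ∀ᶠ n : ℕ in Filter.atTop, ∀ G ∈ SpectralTuran.SPEX F n,
        ∃ Y : SimpleGraph (Fin (n - k)),
          Nonempty (G ≃g SpectralTuran.cliqueJoin k Y) ∧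
          (SpectralTuran.numEdges (X n) : ℝ) - C * Real.sqrt n ≤ SpectralTuran.numEdges Y ∧
          ∀ v, SpectralTuran.deg Y v ≤ D) ∧
    -- case (f)
    (F.Finite → ∀ (X : ∀ n : ℕ, SimpleGraph (Fin (n - k))) (Q : ℝ), 3 / 4 ≤ Q →
      SpectralTuran.JoinExtremal F k X Q →
      ∀ d : ℕ,
      (∃ B : ℕ, ∀ᶠ n : ℕ in Filter.atTop,
        {v | SpectralTuran.deg (X n) v ≠ d}.ncard ≤ B) →
      ¬ SpectralTuran.FamilyFree F (SpectralTuran.cliqueJoin k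
        (SpectralTuran.copies ℕ (completeBipartiteGraph (Fin 1) (Fin (d + 1))))) →
      ∀ᶠ n : ℕ in Filter.atTop, SpectralTuran.SPEX F n ⊆
        SpectralTuran.EXContaining (SpectralTuran.cliqueJoinEmpty k n) F n) := by
  refine ⟨SpectralTuran.SPEX_eq_Kbip hk hex hK, SpectralTuran.SPEX_eq_cliqueJoinEmpty hk hex hK,
    SpectralTuran.SPEX_eq_cliqueJoinEdge hk hex hK,
    fun hF X Q _ hQ hX => SpectralTuran.SPEX_subset_of_sparse hk hex hK hF hQ hX, fun hF => ?_,
    fun hF X Q _ hX d hB hstar =>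
      SpectralTuran.SPEX_subset_of_almost_regular hk hex hK hF hX hB hstar⟩
  obtain ⟨D, hD⟩ := SpectralTuran.exists_join_of_mem_SPEX hk hex hK hF
  exact ⟨D, fun X Q _ hX => hD X hX.1⟩
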